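/- Let $(E,d)$ be a locally compact separable metric space and $\mu$ a positive Borel measure on $E$ with full support that is finite on compact sets. Let $(\mathcal E,\mathcal F)$ be a symmetric, strongly local, regular Dirichlet form on $L^2(E,\mu)$ that admits a carré du champ $\Gamma$: a positive semidefinite symmetric bilinear map $\Gamma:\mathcal F\times\mathcal F\to L^1(E,\mu)$ such that $\mathcal E(f,g)=\int_E\Gamma(f,g)\,d\mu$ for $f,g\in\mathcal F$, and $2\int_E h\,\Gamma(f,g)\,d\mu=\mathcal E(fh,g)+\mathcal E(gh,f)-\mathcal E(h,fg)$ for all bounded $f,g,h\in\mathcal F$. Here strongly local means that $\mathcal E(u,v)=0$ whenever $u\in\mathcal F$ is constant on a neighbourhood of the support of $v\in\mathcal F$. Let $\mathcal F_{loc}$ be the set of measurable functions $u$ such that for every relatively compact open $V\subset E$ there is $v\in\mathcal F$ with $u=v$ $\mu$-a.e. on $V$; by locality, $\Gamma(u,u)$ is extended to $u\in\mathcal F_{loc}$ by $\Gamma(u,u)=\Gamma(v,v)$ $\mu$-a.e. on $V$. Let $(T_t)_{t>0}$ be the $C_0$-semigroup of contractions on $L^2(E,\mu)$ associated with $(\mathcal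 E,\mathcal F)$, i.e. the one whose generator $L$ is given by: $u\in D(L)$ and $Lu=w$ if and only if $u\in\mathcal F$ and $\mathcal E(u,v)=-\int_E wv\,d\mu$ for all $v\in\mathcal F$. It is called conservative if $T_t1=1$ $\mu$-a.e. for every $t>0$, where $T_t1:=\lim_{n\to\infty}T_tf_n$ $\mu$-a.e. for any $f_n\in L^2(E,\mu)\cap L^\infty(E,\mu)$ with $f_n\nearrow1$ $\mu$-a.e. Fix $x_0\in E$, write $d(x):=d(x,x_0)$ and $E_r:=\{x\in E: d(x)<r\}$. Assume that $d\in\mathcal F_{loc}$, that $E_r$ is relatively compact for every $r>0$, and that there is a compact set $K_0\subset E$ with $\Gamma(d,d)\in L^\infty_{loc}(E\setminus K_0,\mu)$. (i) Assume that there are constants $M,N>0$, $0\le\beta\le2$ and a compact set $K\supset K_0$ such that $$\Gamma(d,d)\le M(d+1)^2\left(\log(d+1)\right)^\beta\quad\mu\text{-a.e. on }E\setminus K,$$ and that for all sufficiently large $n\in\mathbb N$ $$\mu(E_{4n}\setminus E_{2n})\le\exp\left(2N(\log(n+1))^{2-\beta}\right)\ \text{ if }0\le\beta<2,\qquad \mu(E_{4n}\setminus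 E_{2n})\le(\log(n+1))^{2N}\ \text{ if }\beta=2.$$ Then $(T_t)_{t>0}$ is conservative. (ii) Assume that there are constants $M,N>0$ and a compact set $K\supset K_0$ such that $\Gamma(d,d)\le M$ $\mu$-a.e. on $E\setminus K$, and that $\mu(E_{4n}\setminus E_{2n})\le\exp(2Nn^2)$ for all sufficiently large $n\in\mathbb N$. Then $(T_t)_{t>0}$ is conservative. -/

import Mathlib

open MeasureTheory Filter Topology
open scoped ENNReal

section DirichletForms

variable {X : Type*} [MeasurableSpace X]

/-- A symmetric Dirichlet form on `L²(X, μ)`: a densely defined, symmetric, nonnegative bilinear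
form whose domain is complete for `𝓔₁(u, u) = 𝓔(u, u) + (u, u)` and on which the unit
contraction `u ↦ (0 ∨ u) ∧ 1` operates. -/
structure SymmDirichletForm (μ : Measure X) where
  /-- The domain of the form. -/
  domain : Submodule ℝ (Lp ℝ 2 μ)
  /-- The bilinear form. -/
  form : domain →ₗ[ℝ] domain →ₗ[ℝ] ℝ
  dense_domain : Dense (domain : Set (Lp ℝ 2 μ))
  symm : ∀ u v : domain, form u v = form v u
  nonneg : ∀ u : domain, 0 ≤ form u u
  closed : ∀ u : ℕ → domain,
    (∀ ε > 0, ∃ n₀ : ℕ, ∀ m ≥ n₀, ∀ n ≥ n₀,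
      form (u m - u n) (u m - u n) + ‖(u m : Lp ℝ 2 μ) - u n‖ ^ 2 < ε) →
    ∃ v : domain, Tendsto
      (fun n => form (u n - v) (u n - v) + ‖(u n : Lp ℝ 2 μ) - v‖ ^ 2) atTop (𝓝 0)
  markov : ∀ (u : domain) (v : Lp ℝ 2 μ),
    (v =ᵐ[μ] fun x => min (max ((u : Lp ℝ 2 μ) x) 0) 1) →
    ∃ hv : v ∈ domain, form ⟨v, hv⟩ ⟨v, hv⟩ ≤ form u u

namespace SymmDirichletForm

variable {μ : Measure X} (𝓔 : SymmDirichletForm μ)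

/-- Regularity: `C₀(X) ∩ 𝓕` is dense in `𝓕` for `𝓔₁`, and dense in `C₀(X)` for the uniform norm,
where `C₀(X)` is the space of continuous functions with compact support. -/
def IsRegular [TopologicalSpace X] : Prop :=
  (∀ u : 𝓔.domain, ∀ ε > 0, ∃ (v : 𝓔.domain) (φ : X → ℝ), Continuous φ ∧ HasCompactSupport φ ∧
    (v : Lp ℝ 2 μ) =ᵐ[μ] φ ∧ 𝓔.form (u - v) (u - v) + ‖(u : Lp ℝ 2 μ) - v‖ ^ 2 < ε) ∧
  (∀ φ : X → ℝ, Continuous φ → HasCompactSupport φ → ∀ ε > 0,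
    ∃ (v : 𝓔.domain) (ψ : X → ℝ), Continuous ψ ∧ HasCompactSupport ψ ∧
      (v : Lp ℝ 2 μ) =ᵐ[μ] ψ ∧ ∀ x, |φ x - ψ x| < ε)

/-- The support of the measure `|u| dμ`. -/
def essSupport [TopologicalSpace X] (μ : Measure X) (u : X → ℝ) : Set X :=
  {x | ∀ U ∈ 𝓝 x, ¬ (u =ᵐ[μ.restrict U] 0)}

/-- Strong locality: `𝓔(u, v) = 0` whenever `u` is constant on a neighbourhood of `supp v`. -/
def IsStronglyLocal [TopologicalSpace X] : Prop :=
  ∀ (u v : 𝓔.domain) (U : Set X) (c : ℝ), IsOpen U → essSupport μ (v : Lp ℝ 2 μ) ⊆ U →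
    ((u : Lp ℝ 2 μ) =ᵐ[μ.restrict U] fun _ => c) → 𝓔.form u v = 0

/-- `Γ` is the carré du champ of `𝓔`, normalised so that `𝓔(u, v) = ∫ Γ(u, v) dμ`: a symmetric,
positive semidefinite, `L¹`-valued bilinear map on `𝓕` with
`2 ∫ h Γ(f, g) dμ = 𝓔(fh, g) + 𝓔(gh, f) - 𝓔(h, fg)` for all bounded `f, g, h ∈ 𝓕`. -/
structure IsCarreDuChamp (Γ : 𝓔.domain →ₗ[ℝ] 𝓔.domain →ₗ[ℝ] Lp ℝ 1 μ) : Prop where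
  symm : ∀ u v, Γ u v = Γ v u
  nonneg : ∀ u, ∀ᵐ x ∂μ, 0 ≤ Γ u u x
  form_eq : ∀ u v, 𝓔.form u v = ∫ x, Γ u v x ∂μ
  density : ∀ f g h fh gh fg : 𝓔.domain,
    MemLp (f : Lp ℝ 2 μ) ∞ μ → MemLp (g : Lp ℝ 2 μ) ∞ μ → MemLp (h : Lp ℝ 2 μ) ∞ μ →
    ((fh : Lp ℝ 2 μ) =ᵐ[μ] fun x => (f : Lp ℝ 2 μ) x * (h : Lp ℝ 2 μ) x) →
    ((gh : Lp ℝ 2 μ) =ᵐ[μ] fun x => (g : Lp ℝ 2 μ) x * (h : Lp ℝ 2 μ) x) →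
    ((fg : Lp ℝ 2 μ) =ᵐ[μ] fun x => (f : Lp ℝ 2 μ) x * (g : Lp ℝ 2 μ) x) →
    𝓔.form fh g + 𝓔.form gh f - 𝓔.form h fg = 2 * ∫ x, (h : Lp ℝ 2 μ) x * Γ f g x ∂μ

/-- `u ∈ 𝓕_loc`: `u` is measurable and coincides a.e. on each relatively compact open set with
some element of `𝓕`. -/
def MemLoc [TopologicalSpace X] (u : X → ℝ) : Prop :=
  Measurable u ∧ ∀ V : Set X, IsOpen V → IsCompact (closure V) →
    ∃ v : 𝓔.domain, (v : Lp ℝ 2 μ) =ᵐ[μ.restrict V] u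

/-- An element of `𝓕` that coincides a.e. on `V` with `u` (if there is one). -/
noncomputable def localRep (u : X → ℝ) (V : Set X) : 𝓔.domain :=
  Classical.epsilon fun v : 𝓔.domain => (v : Lp ℝ 2 μ) =ᵐ[μ.restrict V] u

/-- The extension of `u ↦ Γ(u, u)` to `u ∈ 𝓕_loc`. With `K₀ ⊆ K₁ ⊆ …` a compact exhaustion of `X`,
`K_n ⊆ interior K_{n+1}`, and `v_n ∈ 𝓕` equal to `u` a.e. on `interior K_{n+1}`, the value is that
of `Γ(v_n, v_n)` at the points of `K_n` outside `K_{n-1}`. By locality of `Γ` another exhaustion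
or other `v_n` change it only on a null set. -/
noncomputable def energyLoc [TopologicalSpace X] [WeaklyLocallyCompactSpace X]
    [SigmaCompactSpace X] (Γ : 𝓔.domain →ₗ[ℝ] 𝓔.domain →ₗ[ℝ] Lp ℝ 1 μ) (u : X → ℝ) : X → ℝ :=
  fun x =>
    let K := CompactExhaustion.choice X
    let v := 𝓔.localRep u (interior (K (K.find x + 1)))
    Γ v v x

/-- The graph of the generator `L` of `𝓔`: `u ∈ D(L)` and `L u = w` if and only if `u ∈ 𝓕` and
`𝓔(u, v) = (-w, v)` for all `v ∈ 𝓕`. -/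
def IsGenerator (u w : Lp ℝ 2 μ) : Prop :=
  ∃ hu : u ∈ 𝓔.domain, ∀ v : 𝓔.domain, 𝓔.form ⟨u, hu⟩ v = - inner ℝ w (v : Lp ℝ 2 μ)

/-- `(T_t)_{t ≥ 0}` is the strongly continuous contraction semigroup on `L²(X, μ)` associated with
`𝓔`, i.e. the one whose infinitesimal generator is the generator of `𝓔`. (The values of `T` at
negative times play no role.) -/
structure IsSemigroup (T : ℝ → Lp ℝ 2 μ →L[ℝ] Lp ℝ 2 μ) : Prop where
  zero : T 0 = ContinuousLinearMap.id ℝ (Lp ℝ 2 μ)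
  add : ∀ s t, 0 ≤ s → 0 ≤ t → T (s + t) = (T s).comp (T t)
  contraction : ∀ t, 0 ≤ t → ‖T t‖ ≤ 1
  continuous : ∀ f, Tendsto (fun t => T t f) (𝓝[>] 0) (𝓝 f)
  generator : ∀ u w : Lp ℝ 2 μ,
    Tendsto (fun t : ℝ => t⁻¹ • (T t u - u)) (𝓝[>] 0) (𝓝 w) ↔ 𝓔.IsGenerator u w

end SymmDirichletForm

/-- `T_t 1 = 1` a.e. for every `t > 0`, where `T_t 1 = lim T_t f_n` a.e. for
`f_n ∈ L² ∩ L^∞` with `f_n ↗ 1` a.e. -/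
def IsConservative {μ : Measure X} (T : ℝ → Lp ℝ 2 μ →L[ℝ] Lp ℝ 2 μ) : Prop :=
  ∀ t > 0, ∀ f : ℕ → Lp ℝ 2 μ, (∀ n, MemLp (f n) ∞ μ) →
    (∀ᵐ x ∂μ, Monotone fun n => f n x) →
    (∀ᵐ x ∂μ, Tendsto (fun n => f n x) atTop (𝓝 1)) →
    ∀ᵐ x ∂μ, Tendsto (fun n => T t (f n) x) atTop (𝓝 1)

end DirichletForms

/-! By symmetry of `T t`, conservativeness is dual to conservation of mass: it suffices that `∫ T t
f = ∫ f` for bounded `f ≥ 0` vanishing off a ball (`IsSemigroup.preservesIntegral_of_bounded`,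
`IsSemigroup.isConservative`). Let `φ` be a radial cutoff, 1 on the ball of radius `2n` and 0 off
the ball of radius `4n`. Then `∫ (T t f - f) φ = -∫₀ᵗ 𝓔(T s f, φ) ds`, and one has to see that
little energy of `T s f` reaches the annulus where `φ` varies.

This is measured by a weight `w` equal to 1 on the ball carrying `f`, equal to a large constant `Y`
beyond radius `2n`, and with `Γ(w, w) ≤ Λ w²`. For `u = T s f` the Leibniz rule gives `d/ds ∫ w u² ≤
Λ ∫ w u² - ∫ w Γ(u, u)`, so `∫₀ᵗ ∫ w Γ(u, u) ≤ exp(Λt) ‖f‖²`. Since `w = Y` where `Γ(φ, φ) ≠ 0`,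
Young's inequality bounds `|(T t f - f, φ)|` by `(η/2) exp(Λt) ‖f‖² + t 𝓔(φ, φ) / (2ηY)` for every
`η > 0` (`IsSemigroup.abs_inner_sub_le`). Hence mass is conserved as soon as `exp(Λt) 𝓔(φ, φ) / Y →
0`, where `𝓔(φ, φ)` is at most `n⁻²` times the bound for `Γ(d, d)` times the measure of the annulus
(`IsSemigroup.preservesIntegral_of_weights`).

The weights are piecewise affine in `d`, prolonged shell by shell (`IsWeight.exists_extend`); the
constraint is that the logarithmic slope of `w` times `√Γ(d, d)` stays of order `√Λ`. Bounded `Γ(d,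
d)` allows exponentials of rate proportional to `n`; for `β < 2` one takes powers `(d + 1)^α` with
`α` proportional to `(log n)^(1 - β)`; for `β = 2`, powers of `log (d + 1)`. In the first two cases
`Λ` grows with `n`, so the limit is obtained for small `t` only and the semigroup law does the rest.

The tools come straight from the definitions: bounded elements of `𝓕` form an algebra, `Γ` is local,
`T` is symmetric and Markovian. Orbits are replaced by time averages, which lie in the domain of the
generator. -/

set_option linter.unusedSectionVars false

/-! ### Pointwise domination in `L²`. -/

section SquareIntegrable

variable {X : Type*} [MeasurableSpace X] {μ : Measure X}

theorem inner_Lp_two_eq_integral (f g : Lp ℝ 2 μ) : inner ℝ f g = ∫ x, f x * g x ∂μ := by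
  rw [MeasureTheory.L2.inner_def]
  refine integral_congr_ae (Eventually.of_forall fun x => ?_)
  simp [mul_comm]

theorem integrable_mul_Lp_two (f g : Lp ℝ 2 μ) : Integrable (fun x => f x * g x) μ :=
  (Lp.memLp f).integrable_mul (Lp.memLp g)

theorem norm_sq_Lp_two_eq_integral (f : Lp ℝ 2 μ) : ‖f‖ ^ 2 = ∫ x, f x ^ 2 ∂μ := by
  rw [← real_inner_self_eq_norm_sq, inner_Lp_two_eq_integral]
  simp only [sq]

theorem tendsto_Lp_two_of_dominated {F : ℕ → Lp ℝ 2 μ} {G g : Lp ℝ 2 μ}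
    (hb : ∀ n, ∀ᵐ x ∂μ, |F n x| ≤ |g x|)
    (hlim : ∀ᵐ x ∂μ, Tendsto (fun n => F n x) atTop (𝓝 (G x))) :
    Tendsto F atTop (𝓝 G) := by
  rw [tendsto_iff_norm_sub_tendsto_zero]
  have h1 : Tendsto (fun n => ‖F n - G‖ ^ 2) atTop (𝓝 0) := by
    have h2 : ∀ n, ‖F n - G‖ ^ 2 = ∫ x, (F n x - G x) ^ 2 ∂μ := by
      intro n
      rw [norm_sq_Lp_two_eq_integral]
      refine integral_congr_ae ?_
      filter_upwards [Lp.coeFn_sub (F n) G] with x hx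
      rw [hx, Pi.sub_apply]
    simp_rw [h2]
    have h0 : (0 : ℝ) = ∫ _x, (0 : ℝ) ∂μ := by simp
    rw [h0]
    refine tendsto_integral_of_dominated_convergence (fun x => 4 * (g x * g x)) ?_ ?_ ?_ ?_
    · intro n
      exact (((Lp.memLp (F n)).1.sub (Lp.memLp G).1).pow 2)
    · exact (integrable_mul_Lp_two g g).const_mul 4
    · intro n
      have hall := ae_all_iff.2 hb
      filter_upwards [hall, hlim] with x hx hl
      have hG : |G x| ≤ |g x| := le_of_tendsto hl.abs (Eventually.of_forall hx)
      have h3 : |F n x - G x| ≤ 2 * |g x| := by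
        have := abs_sub (F n x) (G x)
        linarith [hx n]
      rw [Real.norm_eq_abs, abs_pow]
      calc |F n x - G x| ^ 2 ≤ (2 * |g x|) ^ 2 := by gcongr
        _ = 4 * (g x * g x) := by rw [mul_pow, sq_abs]; ring
    · filter_upwards [hlim] with x hl
      have := (hl.sub_const (G x)).pow 2
      simpa using this
  have h3 := h1.sqrt
  simpa using h3

theorem exists_Lp_two_of_le {φ : X → ℝ} (hφ : AEStronglyMeasurable φ μ) (g : Lp ℝ 2 μ)
    (h : ∀ᵐ x ∂μ, |φ x| ≤ |g x|) : ∃ F : Lp ℝ 2 μ, F =ᵐ[μ] φ := by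
  have hm : MemLp φ 2 μ := (Lp.memLp g).mono hφ (by simpa using h)
  exact ⟨hm.toLp φ, hm.coeFn_toLp⟩

theorem norm_le_norm_Lp_two {f g : Lp ℝ 2 μ} (h : ∀ᵐ x ∂μ, |f x| ≤ |g x|) : ‖f‖ ≤ ‖g‖ :=
  Lp.norm_le_norm_of_ae_le (by simpa using h)

end SquareIntegrable

/-! ### Cauchy–Schwarz and lower semicontinuity of the energy. -/

namespace SymmDirichletForm

variable {X : Type*} [MeasurableSpace X] {μ : Measure X} (𝓔 : SymmDirichletForm μ)

theorem form_add_self (u v : 𝓔.domain) :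
    𝓔.form (u + v) (u + v) = 𝓔.form u u + 2 * 𝓔.form u v + 𝓔.form v v := by
  simp only [map_add, LinearMap.add_apply]
  rw [𝓔.symm v u]; ring

theorem form_sub_self (u v : 𝓔.domain) :
    𝓔.form (u - v) (u - v) = 𝓔.form u u - 2 * 𝓔.form u v + 𝓔.form v v := by
  simp only [map_sub, LinearMap.sub_apply]
  rw [𝓔.symm v u]; ring

theorem form_smul_self (c : ℝ) (u : 𝓔.domain) :
    𝓔.form (c • u) (c • u) = c ^ 2 * 𝓔.form u u := by
  simp only [map_smul, LinearMap.smul_apply, smul_eq_mul]; ring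

theorem form_sq_le (u v : 𝓔.domain) : 𝓔.form u v ^ 2 ≤ 𝓔.form u u * 𝓔.form v v :=
  LinearMap.BilinForm.apply_sq_le_of_symm 𝓔.form 𝓔.nonneg ⟨fun u v => by simpa using 𝓔.symm u v⟩ u v

theorem abs_form_le (u v : 𝓔.domain) :
    |𝓔.form u v| ≤ √(𝓔.form u u) * √(𝓔.form v v) := by
  rw [← Real.sqrt_mul (𝓔.nonneg u)]
  exact Real.abs_le_sqrt (𝓔.form_sq_le u v)

theorem sqrt_form_add_le (u v : 𝓔.domain) :
    √(𝓔.form (u + v) (u + v)) ≤ √(𝓔.form u u) + √(𝓔.form v v) := by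
  rw [Real.sqrt_le_left (by positivity), form_add_self]
  have h1 := (le_abs_self _).trans (𝓔.abs_form_le u v)
  have h2 := Real.sq_sqrt (𝓔.nonneg u)
  have h3 := Real.sq_sqrt (𝓔.nonneg v)
  nlinarith

theorem sqrt_form_sum_le {ι : Type*} (s : Finset ι) (u : ι → 𝓔.domain) :
    √(𝓔.form (∑ i ∈ s, u i) (∑ i ∈ s, u i)) ≤ ∑ i ∈ s, √(𝓔.form (u i) (u i)) := by
  classical
  induction s using Finset.induction_on with
  | empty => simp
  | insert a s ha ih =>
    rw [Finset.sum_insert ha, Finset.sum_insert ha]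
    exact (𝓔.sqrt_form_add_le _ _).trans (by gcongr)

/-- Lower semicontinuity of the form with respect to `L²`-convergence. -/
theorem mem_domain_of_tendsto (u : ℕ → 𝓔.domain) (w : Lp ℝ 2 μ) (C : ℝ)
    (hu : Tendsto (fun n => (u n : Lp ℝ 2 μ)) atTop (𝓝 w)) (hC : ∀ n, 𝓔.form (u n) (u n) ≤ C) :
    ∃ hw : w ∈ 𝓔.domain, 𝓔.form ⟨w, hw⟩ ⟨w, hw⟩ ≤ C := by
  -- In place of weak compactness: minimise the energy over elements of the domain within `1 / (n +
  -- 1)` of `w`. The infima `m n` increase and stay below `C`, which makes near-minimisers Cauchy in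
  -- energy.
  let S : ℕ → Set ℝ := fun n => {r | ∃ v : 𝓔.domain, ‖v.1 - w‖ ≤ 1 / ((n : ℝ) + 1) ∧
    𝓔.form v v = r}
  let m : ℕ → ℝ := fun n => sInf (S n)
  have hbdd : ∀ n, BddBelow (S n) := fun n => ⟨0, by rintro r ⟨v, -, rfl⟩; exact 𝓔.nonneg v⟩
  have hSu : ∀ n, ∃ k, 𝓔.form (u k) (u k) ∈ S n := by
    intro n
    have h0 : (0 : ℝ) < 1 / ((n : ℝ) + 1) := by positivity
    obtain ⟨k, hk⟩ := ((tendsto_iff_norm_sub_tendsto_zero.1 hu).eventually (gt_mem_nhds h0)).exists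
    exact ⟨k, u k, hk.le, rfl⟩
  have hne : ∀ n, (S n).Nonempty := fun n => (hSu n).imp' _ (fun _ h => h)
  have hmC : ∀ n, m n ≤ C := fun n => by
    obtain ⟨k, hk⟩ := hSu n
    exact (csInf_le (hbdd n) hk).trans (hC k)
  have hSmono : ∀ k n, k ≤ n → S n ⊆ S k := by
    rintro k n hkn r ⟨v, hv, rfl⟩
    refine ⟨v, hv.trans ?_, rfl⟩
    gcongr
  have hmmono : Monotone m := fun k n hkn => csInf_le_csInf (hbdd k) (hne n) (hSmono k n hkn)
  have hex : ∀ n : ℕ, ∃ v : 𝓔.domain, ‖v.1 - w‖ ≤ 1 / ((n : ℝ) + 1) ∧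
      𝓔.form v v < m n + 1 / ((n : ℝ) + 1) := by
    intro n
    obtain ⟨r, ⟨v, hv, rfl⟩, hr⟩ := exists_lt_of_csInf_lt (hne n)
      (show sInf (S n) < m n + 1 / ((n : ℝ) + 1) from lt_add_of_pos_right _ (by positivity))
    exact ⟨v, hv, hr⟩
  choose v hvw hvm using hex
  have hlim : Tendsto m atTop (𝓝 (⨆ n, m n)) :=
    tendsto_atTop_ciSup hmmono ⟨C, by rintro _ ⟨n, rfl⟩; exact hmC n⟩
  have hinv : Tendsto (fun n : ℕ => 1 / ((n : ℝ) + 1)) atTop (𝓝 0) :=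
    tendsto_one_div_add_atTop_nhds_zero_nat
  have hpar : ∀ k n j : ℕ, k ≤ n → k ≤ j → 𝓔.form (v n - v j) (v n - v j) ≤
      2 * (m n - m k) + 2 * (m j - m k) + 4 * (1 / ((k : ℝ) + 1)) := by
    intro k n j hn hj
    have hn' : 1 / ((n : ℝ) + 1) ≤ 1 / ((k : ℝ) + 1) := by gcongr
    have hj' : 1 / ((j : ℝ) + 1) ≤ 1 / ((k : ℝ) + 1) := by gcongr
    -- The midpoint is still within `1 / (k + 1)` of `w`; the parallelogram law then controls the
    -- difference.
    have hmid : m k ≤ 𝓔.form ((2⁻¹ : ℝ) • (v n + v j)) ((2⁻¹ : ℝ) • (v n + v j)) := by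
      refine csInf_le (hbdd k) ⟨_, ?_, rfl⟩
      have : (((2⁻¹ : ℝ) • (v n + v j) : 𝓔.domain) : Lp ℝ 2 μ) - w
          = (2⁻¹ : ℝ) • (((v n).1 - w) + ((v j).1 - w)) := by
        push_cast
        module
      rw [this, norm_smul]
      have h4 := norm_add_le ((v n).1 - w) ((v j).1 - w)
      have h5 := hvw n
      have h6 := hvw j
      have h2 : ‖(2⁻¹ : ℝ)‖ = 2⁻¹ := by norm_num
      rw [h2]
      linarith
    rw [form_smul_self, form_add_self] at hmid
    rw [form_sub_self]
    have h7 := hvm n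
    have h8 := hvm j
    nlinarith
  obtain ⟨z, hz⟩ := 𝓔.closed v (by
    intro ε hε
    have h1 : ∀ᶠ k in atTop, (⨆ n, m n) - m k < ε / 16 := by
      have : Tendsto (fun k => (⨆ n, m n) - m k) atTop (𝓝 0) := by
        simpa using hlim.const_sub (⨆ n, m n)
      exact this.eventually (gt_mem_nhds (by positivity))
    have h2 : ∀ᶠ k : ℕ in atTop, 1 / ((k : ℝ) + 1) < min 1 (ε / 16) :=
      hinv.eventually (gt_mem_nhds (by positivity))
    obtain ⟨k, hk1, hk2⟩ := (h1.and h2).exists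
    refine ⟨k, fun n hn j hj => ?_⟩
    have hsup : ∀ i, m i ≤ ⨆ n, m n := fun i =>
      le_ciSup (f := m) ⟨C, by rintro _ ⟨n, rfl⟩; exact hmC n⟩ i
    have h3 := hpar k n j hn hj
    have hn' : 1 / ((n : ℝ) + 1) ≤ 1 / ((k : ℝ) + 1) := by gcongr
    have hj' : 1 / ((j : ℝ) + 1) ≤ 1 / ((k : ℝ) + 1) := by gcongr
    have h4 : ‖(v n : Lp ℝ 2 μ) - v j‖ ≤ 2 * (1 / ((k : ℝ) + 1)) := by
      have : (v n : Lp ℝ 2 μ) - v j = ((v n).1 - w) - ((v j).1 - w) := by abel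
      rw [this]
      have := norm_sub_le ((v n).1 - w) ((v j).1 - w)
      linarith [hvw n, hvw j]
    have h5 : ‖(v n : Lp ℝ 2 μ) - v j‖ ^ 2 ≤ 4 * (1 / ((k : ℝ) + 1)) := by
      have h6 : (0 : ℝ) ≤ 1 / ((k : ℝ) + 1) := by positivity
      have h7 := lt_min_iff.1 hk2
      have h8 := norm_nonneg ((v n : Lp ℝ 2 μ) - v j)
      nlinarith
    have h7 := (lt_min_iff.1 hk2).2
    linarith [hsup n, hsup j])
  have hz1 : Tendsto (fun n => ‖(v n : Lp ℝ 2 μ) - z‖ ^ 2) atTop (𝓝 0) :=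
    squeeze_zero (fun _ => by positivity) (fun n => by linarith [𝓔.nonneg (v n - z)]) hz
  have hz2 : Tendsto (fun n => 𝓔.form (v n - z) (v n - z)) atTop (𝓝 0) :=
    squeeze_zero (fun n => 𝓔.nonneg _) (fun n => by linarith [sq_nonneg ‖(v n : Lp ℝ 2 μ) - z‖]) hz
  have hz3 : Tendsto (fun n => (v n : Lp ℝ 2 μ)) atTop (𝓝 z) := by
    rw [tendsto_iff_norm_sub_tendsto_zero]
    simpa using hz1.sqrt
  have hz4 : Tendsto (fun n => (v n : Lp ℝ 2 μ)) atTop (𝓝 w) := by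
    rw [tendsto_iff_norm_sub_tendsto_zero]
    exact squeeze_zero (fun _ => norm_nonneg _) hvw hinv
  obtain rfl := tendsto_nhds_unique hz3 hz4
  refine ⟨z.2, ?_⟩
  have h5 : ∀ n : ℕ, √(𝓔.form z z) ≤
      √(C + 1 / ((n : ℝ) + 1)) + √(𝓔.form (v n - z) (v n - z)) := by
    intro n
    have h6 := 𝓔.sqrt_form_add_le (v n) (z - v n)
    have h7 : 𝓔.form (z - v n) (z - v n) = 𝓔.form (v n - z) (v n - z) := by
      rw [form_sub_self, form_sub_self, 𝓔.symm z (v n)]; ring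
    rw [add_sub_cancel, h7] at h6
    refine h6.trans ?_
    gcongr
    exact (hvm n).le.trans (by gcongr; exact hmC n)
  have h6 : √(𝓔.form z z) ≤ √C := by
    refine ge_of_tendsto (x := atTop) ?_ (Eventually.of_forall h5)
    have := ((hinv.const_add C).sqrt).add hz2.sqrt
    simpa using this
  have hC0 : 0 ≤ C := (𝓔.nonneg _).trans (hC 0)
  exact (Real.sqrt_le_sqrt_iff hC0).1 h6

/-- Strong convergence from `L²`-convergence and a bound on the energies. -/
theorem tendsto_form_sub_of_le (u : ℕ → 𝓔.domain) (w : 𝓔.domain)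
    (hu : Tendsto (fun n => (u n : Lp ℝ 2 μ)) atTop (𝓝 w))
    (hle : ∀ n, 𝓔.form (u n) (u n) ≤ 𝓔.form w w) :
    Tendsto (fun n => 𝓔.form (u n - w) (u n - w)) atTop (𝓝 0) := by
  rw [Metric.tendsto_atTop]
  by_contra! hcon
  obtain ⟨ε, hε, hcon⟩ := hcon
  have hfreq : ∃ᶠ n in atTop, ε ≤ 𝓔.form (u n - w) (u n - w) := by
    rw [frequently_atTop]
    intro N
    obtain ⟨n, hn, h⟩ := hcon N
    refine ⟨n, hn, ?_⟩
    rwa [Real.dist_eq, sub_zero, abs_of_nonneg (𝓔.nonneg _)] at h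
  obtain ⟨φ, hφ, hφε⟩ := extraction_of_frequently_atTop hfreq
  -- The midpoints converge to `w` in `L²`, but along this subsequence their energies stay below
  -- `𝓔(w, w) - ε / 4`, against lower semicontinuity.
  have hlim : Tendsto (fun n => (((2⁻¹ : ℝ) • (u (φ n) + w) : 𝓔.domain) : Lp ℝ 2 μ)) atTop
      (𝓝 (w : Lp ℝ 2 μ)) := by
    have h1 := ((hu.comp hφ.tendsto_atTop).add_const (w : Lp ℝ 2 μ)).const_smul (2⁻¹ : ℝ)
    have h2 : (2⁻¹ : ℝ) • ((w : Lp ℝ 2 μ) + w) = w := by module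
    rw [h2] at h1
    exact h1
  obtain ⟨hw, hle'⟩ := 𝓔.mem_domain_of_tendsto _ _ (𝓔.form w w - ε / 4) hlim (by
    intro n
    have h1 := hφε n
    have h2 := hle (φ n)
    rw [form_sub_self] at h1
    rw [form_smul_self, form_add_self]
    nlinarith)
  have : 𝓔.form w w ≤ 𝓔.form w w - ε / 4 := hle'
  linarith

end SymmDirichletForm

/-! ### Truncations, and the algebra of bounded elements. -/

namespace SymmDirichletForm

variable {X : Type*} [MeasurableSpace X] {μ : Measure X} (𝓔 : SymmDirichletForm μ)

theorem coeFn_domain_add (u v : 𝓔.domain) : (u + v).1 =ᵐ[μ] fun x => u.1 x + v.1 x :=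
  Lp.coeFn_add u.1 v.1

theorem coeFn_domain_sub (u v : 𝓔.domain) : (u - v).1 =ᵐ[μ] fun x => u.1 x - v.1 x :=
  Lp.coeFn_sub u.1 v.1

theorem coeFn_domain_smul (c : ℝ) (u : 𝓔.domain) : (c • u).1 =ᵐ[μ] fun x => c * u.1 x :=
  Lp.coeFn_smul c u.1

theorem coeFn_domain_neg (u : 𝓔.domain) : (-u).1 =ᵐ[μ] fun x => -u.1 x :=
  Lp.coeFn_neg u.1

theorem coeFn_domain_sum {ι : Type*} (s : Finset ι) (u : ι → 𝓔.domain) :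
    (∑ i ∈ s, u i).1 =ᵐ[μ] fun x => ∑ i ∈ s, (u i).1 x := by
  classical
  induction s using Finset.induction_on with
  | empty => simp only [Finset.sum_empty]; exact Lp.coeFn_zero ℝ 2 μ
  | insert a s ha ih =>
    rw [Finset.sum_insert ha]
    filter_upwards [𝓔.coeFn_domain_add (u a) (∑ i ∈ s, u i), ih] with x h1 h2
    rw [h1, h2, Finset.sum_insert ha]

theorem abs_min_max_le (a c : ℝ) (hc : 0 ≤ c) : |min (max a 0) c| ≤ |a| := by
  rw [abs_of_nonneg (le_min (le_max_right _ _) hc)]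
  exact (min_le_left _ _).trans (max_le (le_abs_self a) (abs_nonneg a))

theorem exists_truncation (u : 𝓔.domain) {c : ℝ} (hc : 0 < c) :
    ∃ v : 𝓔.domain, v.1 =ᵐ[μ] (fun x => min (max (u.1 x) 0) c) ∧ 𝓔.form v v ≤ 𝓔.form u u := by
  have hs := 𝓔.coeFn_domain_smul c⁻¹ u
  obtain ⟨F, hF⟩ := exists_Lp_two_of_le (μ := μ)
    (φ := fun x => min (max ((c⁻¹ • u).1 x) 0) 1)
    (((Lp.aestronglyMeasurable (c⁻¹ • u).1).sup aestronglyMeasurable_const).inf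
      aestronglyMeasurable_const) (c⁻¹ • u).1
    (Eventually.of_forall fun x => abs_min_max_le _ _ zero_le_one)
  obtain ⟨hF', hle⟩ := 𝓔.markov (c⁻¹ • u) F hF
  refine ⟨c • ⟨F, hF'⟩, ?_, ?_⟩
  · filter_upwards [𝓔.coeFn_domain_smul c ⟨F, hF'⟩, hF, hs] with x h1 h2 h3
    rw [h1, h2, h3, mul_min_of_nonneg _ _ hc.le, mul_max_of_nonneg _ _ hc.le, mul_zero, mul_one,
      mul_inv_cancel_left₀ hc.ne']
  · rw [form_smul_self] at hle ⊢
    calc c ^ 2 * 𝓔.form ⟨F, hF'⟩ ⟨F, hF'⟩ ≤ c ^ 2 * (c⁻¹ ^ 2 * 𝓔.form u u) := by gcongr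
      _ = 𝓔.form u u := by field_simp

theorem exists_posPart (u : 𝓔.domain) :
    ∃ v : 𝓔.domain, v.1 =ᵐ[μ] (fun x => max (u.1 x) 0) ∧ 𝓔.form v v ≤ 𝓔.form u u := by
  choose v hv hle using fun n : ℕ => 𝓔.exists_truncation u (c := (n : ℝ) + 1) (by positivity)
  obtain ⟨F, hF⟩ := exists_Lp_two_of_le (μ := μ) (φ := fun x => max (u.1 x) 0)
    ((Lp.aestronglyMeasurable u.1).sup aestronglyMeasurable_const) u.1
    (Eventually.of_forall fun x => by
      rw [abs_of_nonneg (le_max_right _ _)]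
      exact max_le (le_abs_self _) (abs_nonneg _))
  have hlim : Tendsto (fun n => (v n : Lp ℝ 2 μ)) atTop (𝓝 F) := by
    refine tendsto_Lp_two_of_dominated (g := u.1) (fun n => ?_) ?_
    · filter_upwards [hv n] with x hx
      rw [hx]
      exact abs_min_max_le _ _ (by positivity)
    · filter_upwards [ae_all_iff.2 hv, hF] with x hx hFx
      rw [hFx]
      refine tendsto_const_nhds.congr' ?_
      obtain ⟨N, hN⟩ := exists_nat_ge (max (u.1 x) 0)
      filter_upwards [eventually_ge_atTop N] with n hn
      have hn' : (N : ℝ) ≤ n := by exact_mod_cast hn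
      rw [hx n, min_eq_left]
      linarith
  obtain ⟨h1, h2⟩ := 𝓔.mem_domain_of_tendsto v F _ hlim hle
  exact ⟨⟨F, h1⟩, hF, h2⟩

theorem exists_max (u v : 𝓔.domain) :
    ∃ w : 𝓔.domain, w.1 =ᵐ[μ] fun x => max (u.1 x) (v.1 x) := by
  obtain ⟨p, hp, -⟩ := 𝓔.exists_posPart (u - v)
  refine ⟨v + p, ?_⟩
  filter_upwards [𝓔.coeFn_domain_add v p, hp, 𝓔.coeFn_domain_sub u v] with x h1 h2 h3
  rw [h1, h2, h3, add_comm, max_add, sub_add_cancel, zero_add]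

theorem exists_abs (u : 𝓔.domain) : ∃ w : 𝓔.domain, w.1 =ᵐ[μ] fun x => |u.1 x| := by
  obtain ⟨w, hw⟩ := 𝓔.exists_max u (-u)
  refine ⟨w, ?_⟩
  filter_upwards [hw, 𝓔.coeFn_domain_neg u] with x h1 h2
  rw [h1, h2]; rfl

/-- Truncation is the nearest-point projection onto `[0, c]`, hence constant on the segment joining
a point to its image. -/
theorem truncation_segment (a c s : ℝ) (hc : 0 < c) (hs : 0 ≤ s) (hs1 : s ≤ 1) :
    min (max (min (max a 0) c + s * (a - min (max a 0) c)) 0) c = min (max a 0) c := by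
  rcases le_total a 0 with h | h
  · rw [max_eq_right h, min_eq_left hc.le, max_eq_right (by nlinarith), min_eq_left hc.le]
  · rw [max_eq_left h]
    rcases le_total a c with h' | h'
    · rw [min_eq_left h']; simp [h, h']
    · rw [min_eq_right h', max_eq_left (by nlinarith), min_eq_right (by nlinarith)]

/-- By `truncation_segment`, `v` is also the truncation of `v + s(u - v)`, so the energy does not
drop below its value at `v` when moving towards `u`; this is the first-order condition at `s = 0`.
-/
theorem form_truncation_sub_nonneg (u v : 𝓔.domain) {c : ℝ} (hc : 0 < c)
    (hv : v.1 =ᵐ[μ] fun x => min (max (u.1 x) 0) c) : 0 ≤ 𝓔.form v (u - v) := by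
  have key : ∀ s : ℝ, 0 < s → s ≤ 1 →
      0 ≤ 2 * 𝓔.form v (u - v) + s * 𝓔.form (u - v) (u - v) := by
    intro s hs hs1
    obtain ⟨w, hw, hle⟩ := 𝓔.exists_truncation (v + s • (u - v)) hc
    have hwv : w = v := by
      apply Subtype.ext
      apply Lp.ext
      filter_upwards [hw, hv, 𝓔.coeFn_domain_add v (s • (u - v)),
        𝓔.coeFn_domain_smul s (u - v), 𝓔.coeFn_domain_sub u v] with x h1 h2 h3 h4 h5
      rw [h1, h3, h4, h5, h2]
      exact truncation_segment _ _ _ hc hs.le hs1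
    rw [hwv, form_add_self, form_smul_self, map_smul, smul_eq_mul] at hle
    nlinarith
  by_contra! hneg
  have hq := 𝓔.nonneg (u - v)
  set A := 𝓔.form v (u - v)
  set B := 𝓔.form (u - v) (u - v)
  -- For this `s` the term `s * B` is at most `-A`, too small to offset `2 * A`.
  have h2 := key (min 1 (-A / (B + 1))) (lt_min one_pos (div_pos (by linarith) (by linarith)))
    (min_le_left _ _)
  have h3 : min 1 (-A / (B + 1)) * B ≤ -A := by
    calc min 1 (-A / (B + 1)) * B ≤ (-A / (B + 1)) * B := by
          gcongr; exact min_le_right _ _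
      _ ≤ (-A / (B + 1)) * (B + 1) := by
          have : 0 ≤ -A / (B + 1) := div_nonneg (by linarith) (by linarith)
          nlinarith
      _ = -A := by field_simp
  linarith

theorem form_sub_truncation_le (u v : 𝓔.domain) {c : ℝ} (hc : 0 < c)
    (hv : v.1 =ᵐ[μ] fun x => min (max (u.1 x) 0) c) : 𝓔.form (u - v) (u - v) ≤ 𝓔.form u u := by
  have h1 := 𝓔.form_truncation_sub_nonneg u v hc hv
  have h2 : 𝓔.form u u = 𝓔.form (v + (u - v)) (v + (u - v)) := by rw [add_sub_cancel]
  rw [h2, form_add_self]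
  linarith [𝓔.nonneg v]

/-- Dissipativity relative to the functions with values in `[0, c]`; it yields the Markov property
in `mem_Icc_of_mem_Icc`. -/
theorem form_sub_truncation_nonneg (u v : 𝓔.domain) {c : ℝ} (hc : 0 < c)
    (hv : v.1 =ᵐ[μ] fun x => min (max (u.1 x) 0) c) : 0 ≤ 𝓔.form u (u - v) := by
  have h1 := 𝓔.form_truncation_sub_nonneg u v hc hv
  have h2 : 𝓔.form u (u - v) = 𝓔.form v (u - v) + 𝓔.form (u - v) (u - v) := by
    rw [← LinearMap.add_apply, ← map_add, add_sub_cancel]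
  linarith [𝓔.nonneg (u - v)]

theorem exists_sub_posPart (u : 𝓔.domain) (hu : ∀ᵐ x ∂μ, 0 ≤ u.1 x) {a : ℝ} (ha : 0 ≤ a) :
    ∃ v : 𝓔.domain, v.1 =ᵐ[μ] (fun x => max (u.1 x - a) 0) ∧ 𝓔.form v v ≤ 𝓔.form u u := by
  rcases ha.eq_or_lt with rfl | ha
  · simpa using 𝓔.exists_posPart u
  obtain ⟨v, hv, -⟩ := 𝓔.exists_truncation u ha
  refine ⟨u - v, ?_, 𝓔.form_sub_truncation_le u v ha hv⟩
  filter_upwards [hv, hu, 𝓔.coeFn_domain_sub u v] with x h1 h2 h3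
  rw [h3, h1, max_eq_left h2]
  rcases le_total (u.1 x) a with h | h
  · rw [min_eq_left h, max_eq_right] <;> linarith
  · rw [min_eq_right h, max_eq_left] ; linarith

/-- A Riemann sum of mesh `δ` for `x² = 2 ∫₀^∞ (x - s)⁺ ds`. Passing from `x` to `x - δ` shifts the
index by one, which drives the induction. -/
theorem abs_sum_posPart_sub_sq_le (δ : ℝ) (hδ : 0 ≤ δ) (k : ℕ) :
    ∀ x : ℝ, 0 ≤ x → x ≤ k * δ →
      |2 * δ * ∑ i ∈ Finset.range k, max (x - i * δ) 0 - x ^ 2| ≤ 2 * δ * x := by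
  induction k with
  | zero =>
    intro x hx hx'
    have : x = 0 := le_antisymm (by simpa using hx') hx
    simp [this]
  | succ k ih =>
    intro x hx hx'
    have hsum : ∑ i ∈ Finset.range (k + 1), max (x - i * δ) 0
        = x + ∑ i ∈ Finset.range k, max ((x - δ) - i * δ) 0 := by
      rw [Finset.sum_range_succ', add_comm]
      congr 1
      · simp [hx]
      · refine Finset.sum_congr rfl fun i _ => ?_
        push_cast
        congr 1; ring
    rw [hsum]
    rcases le_total 0 (x - δ) with h | h
    · have h1 := ih (x - δ) h (by push_cast at hx'; linarith)
      rw [abs_le] at h1 ⊢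
      constructor <;> nlinarith
    · have h0 : ∑ i ∈ Finset.range k, max ((x - δ) - i * δ) 0 = 0 := by
        refine Finset.sum_eq_zero fun i _ => max_eq_right ?_
        have : (0 : ℝ) ≤ i * δ := by positivity
        linarith
      rw [h0, abs_le]
      constructor <;> nlinarith

/-- Each layer `(f - a)⁺` has at most the energy of `f`, and the coefficients of the Riemann sum add
up to `2c`; so the sums have bounded energy and lower semicontinuity applies to their limit `f²`. -/
theorem exists_sq_of_nonneg (f : 𝓔.domain) (hf : ∀ᵐ x ∂μ, 0 ≤ f.1 x) {c : ℝ} (hc : 0 < c)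
    (hfc : ∀ᵐ x ∂μ, f.1 x ≤ c) : ∃ g : 𝓔.domain, g.1 =ᵐ[μ] fun x => f.1 x ^ 2 := by
  let δ : ℕ → ℝ := fun k => c / (k + 1)
  have hδ : ∀ k, 0 < δ k := fun k => by positivity
  choose v hv hle using fun k i : ℕ =>
    𝓔.exists_sub_posPart f hf (a := i * δ k) (by have := hδ k; positivity)
  let F : ℕ → 𝓔.domain := fun k => (2 * δ k) • ∑ i ∈ Finset.range (k + 1), v k i
  obtain ⟨G, hG⟩ := exists_Lp_two_of_le (μ := μ) (φ := fun x => f.1 x ^ 2)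
    ((Lp.aestronglyMeasurable f.1).pow 2) (c • f.1) (by
      filter_upwards [hf, hfc, Lp.coeFn_smul c f.1] with x h1 h2 h3
      rw [h3, Pi.smul_apply, smul_eq_mul, abs_of_nonneg (by positivity),
        abs_of_nonneg (by positivity)]
      nlinarith)
  have hFx : ∀ k, (F k).1 =ᵐ[μ]
      fun x => 2 * δ k * ∑ i ∈ Finset.range (k + 1), max (f.1 x - i * δ k) 0 := by
    intro k
    filter_upwards [𝓔.coeFn_domain_smul (2 * δ k) (∑ i ∈ Finset.range (k + 1), v k i),
      𝓔.coeFn_domain_sum (Finset.range (k + 1)) (v k), ae_all_iff.2 (hv k)] with x h1 h2 h3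
    rw [h1, h2]
    simp only [h3]
  have hlim : Tendsto (fun k => (F k).1) atTop (𝓝 G) := by
    rw [tendsto_iff_norm_sub_tendsto_zero]
    have hδ0 : Tendsto (fun k => 2 * δ k * ‖f.1‖) atTop (𝓝 0) := by
      have : Tendsto (fun k : ℕ => 2 * (c * (1 / ((k : ℝ) + 1))) * ‖f.1‖) atTop (𝓝 0) := by
        simpa using ((tendsto_one_div_add_atTop_nhds_zero_nat.const_mul c).const_mul 2).mul_const
          ‖f.1‖
      refine this.congr fun k => ?_
      simp only [δ]; ring
    refine squeeze_zero (fun _ => norm_nonneg _) (fun k => ?_) hδ0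
    have h2 : 2 * δ k * ‖f.1‖ = ‖(2 * δ k) • f.1‖ := by
      rw [norm_smul, Real.norm_of_nonneg (by have := hδ k; positivity)]
    rw [h2]
    refine norm_le_norm_Lp_two ?_
    filter_upwards [Lp.coeFn_sub (F k).1 G, Lp.coeFn_smul (2 * δ k) f.1, hFx k, hG, hf, hfc] with
      x h1 h2 h3 h4 h5 h6
    rw [h1, h2, Pi.sub_apply, Pi.smul_apply, smul_eq_mul, h3, h4,
      abs_of_nonneg (a := 2 * δ k * _) (by have := hδ k; positivity)]
    refine abs_sum_posPart_sub_sq_le (δ k) (hδ k).le (k + 1) _ h5 (h6.trans (le_of_eq ?_))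
    simp only [δ]; push_cast; field_simp
  have hbd : ∀ k, 𝓔.form (F k) (F k) ≤ (2 * c) ^ 2 * 𝓔.form f f := by
    intro k
    have h1 := 𝓔.sqrt_form_sum_le (Finset.range (k + 1)) (v k)
    have h2 : ∑ i ∈ Finset.range (k + 1), √(𝓔.form (v k i) (v k i)) ≤
        (k + 1) * √(𝓔.form f f) := by
      refine (Finset.sum_le_card_nsmul _ _ (√(𝓔.form f f)) fun i _ =>
        Real.sqrt_le_sqrt (hle k i)).trans ?_
      simp
    have h3 := h1.trans h2
    rw [Real.sqrt_le_left (by positivity), mul_pow, Real.sq_sqrt (𝓔.nonneg f)] at h3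
    simp only [F]
    rw [form_smul_self]
    calc (2 * δ k) ^ 2 * _ ≤ (2 * δ k) ^ 2 * (((k : ℝ) + 1) ^ 2 * 𝓔.form f f) := by gcongr
      _ = (2 * c) ^ 2 * 𝓔.form f f := by simp only [δ]; field_simp
  obtain ⟨h1, -⟩ := 𝓔.mem_domain_of_tendsto F G _ hlim hbd
  exact ⟨⟨G, h1⟩, hG⟩

/-- An essentially bounded element of the domain. -/
def IsBdd (u : 𝓔.domain) : Prop := ∃ c : ℝ, ∀ᵐ x ∂μ, |u.1 x| ≤ c

variable {𝓔} in
theorem IsBdd.memLp {u : 𝓔.domain} (hu : 𝓔.IsBdd u) : MemLp u.1 ∞ μ := by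
  obtain ⟨c, hc⟩ := hu
  exact memLp_top_of_bound (Lp.aestronglyMeasurable u.1) c (by simpa using hc)

variable {𝓔} in
theorem IsBdd.add {u v : 𝓔.domain} (hu : 𝓔.IsBdd u) (hv : 𝓔.IsBdd v) : 𝓔.IsBdd (u + v) := by
  obtain ⟨c, hc⟩ := hu
  obtain ⟨d, hd⟩ := hv
  refine ⟨c + d, ?_⟩
  filter_upwards [hc, hd, 𝓔.coeFn_domain_add u v] with x h1 h2 h3
  rw [h3]
  exact (abs_add_le _ _).trans (add_le_add h1 h2)

variable {𝓔} in
theorem IsBdd.smul {u : 𝓔.domain} (hu : 𝓔.IsBdd u) (a : ℝ) : 𝓔.IsBdd (a • u) := by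
  obtain ⟨c, hc⟩ := hu
  refine ⟨|a| * c, ?_⟩
  filter_upwards [hc, 𝓔.coeFn_domain_smul a u] with x h1 h3
  rw [h3, abs_mul]
  gcongr

variable {𝓔} in
theorem IsBdd.sub {u v : 𝓔.domain} (hu : 𝓔.IsBdd u) (hv : 𝓔.IsBdd v) : 𝓔.IsBdd (u - v) := by
  have := hu.add (hv.smul (-1))
  rwa [neg_one_smul, ← sub_eq_add_neg] at this

variable {𝓔} in
theorem IsBdd.exists_sq {u : 𝓔.domain} (hu : 𝓔.IsBdd u) :
    ∃ w : 𝓔.domain, w.1 =ᵐ[μ] fun x => u.1 x ^ 2 := by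
  obtain ⟨c, hc⟩ := hu
  obtain ⟨v, hv⟩ := 𝓔.exists_abs u
  obtain ⟨w, hw⟩ := 𝓔.exists_sq_of_nonneg v (c := |c| + 1) (by
      filter_upwards [hv] with x hx
      rw [hx]; positivity) (by positivity) (by
      filter_upwards [hv, hc] with x hx h2
      rw [hx]; linarith [le_abs_self c])
  refine ⟨w, ?_⟩
  filter_upwards [hw, hv] with x h1 h2
  rw [h1, h2, sq_abs]

/-- The bounded elements of the domain form an algebra. -/
theorem exists_mul {u v : 𝓔.domain} (hu : 𝓔.IsBdd u) (hv : 𝓔.IsBdd v) :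
    ∃ w : 𝓔.domain, (w.1 =ᵐ[μ] fun x => u.1 x * v.1 x) ∧ 𝓔.IsBdd w := by
  obtain ⟨p, hp⟩ := (hu.add hv).exists_sq
  obtain ⟨m, hm⟩ := (hu.sub hv).exists_sq
  have h : ((1 / 4 : ℝ) • (p - m)).1 =ᵐ[μ] fun x => u.1 x * v.1 x := by
    filter_upwards [hp, hm, 𝓔.coeFn_domain_smul (1 / 4 : ℝ) (p - m), 𝓔.coeFn_domain_sub p m,
      𝓔.coeFn_domain_add u v, 𝓔.coeFn_domain_sub u v] with x h1 h2 h3 h4 h5 h6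
    rw [h3, h4, h1, h2, h5, h6]; ring
  refine ⟨_, h, ?_⟩
  obtain ⟨c, hc⟩ := hu
  obtain ⟨d, hd⟩ := hv
  refine ⟨|c| * |d|, ?_⟩
  filter_upwards [h, hc, hd] with x h1 h2 h3
  rw [h1, abs_mul]
  exact mul_le_mul (h2.trans (le_abs_self c)) (h3.trans (le_abs_self d)) (abs_nonneg _)
    (abs_nonneg _)

/-- Bounded elements approximate every element of the domain, by truncation. -/
theorem exists_bounded_approx (u : 𝓔.domain) :
    ∃ v : ℕ → 𝓔.domain, (∀ n, 𝓔.IsBdd (v n)) ∧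
      (∀ n : ℕ, (v n).1 =ᵐ[μ] fun x =>
        min (max (u.1 x) 0) ((n : ℝ) + 1) - min (max (-u.1 x) 0) ((n : ℝ) + 1)) ∧
      Tendsto (fun n => 𝓔.form (v n - u) (v n - u)) atTop (𝓝 0) := by
  obtain ⟨p, hp, -⟩ := 𝓔.exists_posPart u
  obtain ⟨m, hm, -⟩ := 𝓔.exists_posPart (-u)
  have strong : ∀ w : 𝓔.domain, (∀ᵐ x ∂μ, 0 ≤ w.1 x) → ∃ v : ℕ → 𝓔.domain,
      (∀ n : ℕ, (v n).1 =ᵐ[μ] fun x => min (max (w.1 x) 0) ((n : ℝ) + 1)) ∧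
      Tendsto (fun n => 𝓔.form (v n - w) (v n - w)) atTop (𝓝 0) := by
    intro w hw
    choose v hv hle using fun n : ℕ => 𝓔.exists_truncation w (c := (n : ℝ) + 1) (by positivity)
    refine ⟨v, hv, 𝓔.tendsto_form_sub_of_le v w ?_ hle⟩
    refine tendsto_Lp_two_of_dominated (g := w.1) (fun n => ?_) ?_
    · filter_upwards [hv n] with x hx
      rw [hx]
      exact abs_min_max_le _ _ (by positivity)
    · filter_upwards [ae_all_iff.2 hv, hw] with x hx hwx
      refine tendsto_const_nhds.congr' ?_
      obtain ⟨N, hN⟩ := exists_nat_ge (w.1 x)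
      filter_upwards [eventually_ge_atTop N] with n hn
      have hn' : (N : ℝ) ≤ n := by exact_mod_cast hn
      rw [hx n, max_eq_left hwx, min_eq_left]
      linarith
  obtain ⟨a, ha, ha'⟩ := strong p (by filter_upwards [hp] with x hx; rw [hx]; exact le_max_right _ _)
  obtain ⟨b, hb, hb'⟩ := strong m (by filter_upwards [hm] with x hx; rw [hx]; exact le_max_right _ _)
  have hab : ∀ n : ℕ, (a n - b n).1 =ᵐ[μ] fun x =>
        min (max (u.1 x) 0) ((n : ℝ) + 1) - min (max (-u.1 x) 0) ((n : ℝ) + 1) := by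
    intro n
    filter_upwards [ha n, hb n, hp, hm, 𝓔.coeFn_domain_neg u, 𝓔.coeFn_domain_sub (a n) (b n)] with
      x h1 h2 h3 h4 h5 h6
    rw [h6, h1, h2, h3, h4, h5, max_eq_left (le_max_right _ _), max_eq_left (le_max_right _ _)]
  refine ⟨fun n => a n - b n, fun n => ⟨(n : ℝ) + 1, ?_⟩, hab, ?_⟩
  · filter_upwards [hab n] with x hx
    have h0 : (0 : ℝ) ≤ (n : ℝ) + 1 := by positivity
    have h1 := min_le_right (max (u.1 x) 0) ((n : ℝ) + 1)
    have h2 := min_le_right (max (-u.1 x) 0) ((n : ℝ) + 1)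
    have h3 := le_min (le_max_right (u.1 x) 0) h0
    have h4 := le_min (le_max_right (-u.1 x) 0) h0
    rw [hx, abs_le]
    constructor <;> linarith
  · have hu : u = p - m := by
      apply Subtype.ext
      apply Lp.ext
      filter_upwards [hp, hm, 𝓔.coeFn_domain_neg u, 𝓔.coeFn_domain_sub p m] with x h1 h2 h3 h4
      rw [h4, h1, h2, h3]
      exact (max_zero_sub_max_neg_zero_eq_self (u.1 x)).symm
    have hle : ∀ n, 𝓔.form (a n - b n - u) (a n - b n - u) ≤
        2 * 𝓔.form (a n - p) (a n - p) + 2 * 𝓔.form (b n - m) (b n - m) := by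
      intro n
      have h1 : a n - b n - u = (a n - p) - (b n - m) := by rw [hu]; abel
      have h2 := 𝓔.nonneg ((a n - p) + (b n - m))
      rw [h1, form_sub_self]
      rw [form_add_self] at h2
      linarith
    refine squeeze_zero (fun n => 𝓔.nonneg _) hle ?_
    simpa using (ha'.const_mul 2).add (hb'.const_mul 2)

end SymmDirichletForm

namespace SymmDirichletForm

/-! ### The carré du champ: Cauchy–Schwarz and the Leibniz rule. -/

section CarreDuChamp

variable {X : Type*} [MeasurableSpace X] {μ : Measure X} {𝓔 : SymmDirichletForm μ}
  {Γ : 𝓔.domain →ₗ[ℝ] 𝓔.domain →ₗ[ℝ] Lp ℝ 1 μ}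

theorem integrable_carre (Γ : 𝓔.domain →ₗ[ℝ] 𝓔.domain →ₗ[ℝ] Lp ℝ 1 μ) (u v : 𝓔.domain) :
    Integrable (fun x => Γ u v x) μ :=
  L1.integrable_coeFn (Γ u v)

theorem IsBdd.integrable_mul_carre (Γ : 𝓔.domain →ₗ[ℝ] 𝓔.domain →ₗ[ℝ] Lp ℝ 1 μ)
    {h : 𝓔.domain} (hh : 𝓔.IsBdd h) (u v : 𝓔.domain) :
    Integrable (fun x => h.1 x * Γ u v x) μ := by
  obtain ⟨c, hc⟩ := hh
  exact (integrable_carre Γ u v).bdd_mul (Lp.aestronglyMeasurable h.1) (c := c) (by simpa using hc)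

theorem IsCarreDuChamp.add_smul_self (hΓ : 𝓔.IsCarreDuChamp Γ) (u v : 𝓔.domain) (c : ℝ) :
    ∀ᵐ x ∂μ, Γ (u + c • v) (u + c • v) x = Γ u u x + 2 * c * Γ u v x + c ^ 2 * Γ v v x := by
  have h : Γ (u + c • v) (u + c • v) = Γ u u + (2 * c) • Γ u v + c ^ 2 • Γ v v := by
    simp only [map_add, map_smul, LinearMap.add_apply, LinearMap.smul_apply]
    rw [hΓ.symm v u]; module
  rw [h]
  filter_upwards [Lp.coeFn_add (Γ u u + (2 * c) • Γ u v) (c ^ 2 • Γ v v),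
    Lp.coeFn_add (Γ u u) ((2 * c) • Γ u v), Lp.coeFn_smul (2 * c) (Γ u v),
    Lp.coeFn_smul (c ^ 2) (Γ v v)] with x h1 h2 h3 h4
  rw [h1, Pi.add_apply, h2, Pi.add_apply, h3, h4]; rfl

theorem IsCarreDuChamp.sq_le (hΓ : 𝓔.IsCarreDuChamp Γ) (u v : 𝓔.domain) :
    ∀ᵐ x ∂μ, Γ u v x ^ 2 ≤ Γ u u x * Γ v v x := by
  -- Rational `r` keep the exceptional set null; continuity recovers all real `r` and the
  -- discriminant concludes.
  have h1 : ∀ᵐ x ∂μ, ∀ r : ℚ, 0 ≤ Γ u u x + 2 * (r : ℝ) * Γ u v x + (r : ℝ) ^ 2 * Γ v v x := by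
    rw [ae_all_iff]
    intro r
    filter_upwards [hΓ.add_smul_self u v r, hΓ.nonneg (u + (r : ℝ) • v)] with x h1 h2
    rwa [← h1]
  filter_upwards [h1] with x hx
  have h2 : ∀ r : ℝ, 0 ≤ Γ v v x * (r * r) + (2 * Γ u v x) * r + Γ u u x := by
    intro r
    have hcl : IsClosed {r : ℝ | 0 ≤ Γ u u x + 2 * r * Γ u v x + r ^ 2 * Γ v v x} :=
      isClosed_le continuous_const (by fun_prop)
    have hd : Set.range ((↑) : ℚ → ℝ) ⊆
        {r : ℝ | 0 ≤ Γ u u x + 2 * r * Γ u v x + r ^ 2 * Γ v v x} := by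
      rintro _ ⟨q, rfl⟩
      exact hx q
    have := (hcl.closure_subset_iff.2 hd) (Rat.denseRange_cast (𝕜 := ℝ) r)
    simp only [Set.mem_ofPred_eq] at this
    linarith
  have h3 := discrim_le_zero h2
  rw [discrim] at h3
  linarith

theorem IsCarreDuChamp.sub_self_le (hΓ : 𝓔.IsCarreDuChamp Γ) (u v : 𝓔.domain) :
    ∀ᵐ x ∂μ, Γ (u - v) (u - v) x ≤ 2 * Γ u u x + 2 * Γ v v x := by
  filter_upwards [hΓ.add_smul_self u v 1, hΓ.add_smul_self u v (-1),
    hΓ.nonneg (u + (1 : ℝ) • v)] with x h1 h2 h3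
  rw [h1] at h3
  rw [neg_one_smul, ← sub_eq_add_neg] at h2
  rw [h2]
  linarith

/-- The Leibniz rule, integrated over the whole space. -/
theorem IsCarreDuChamp.form_mul (hΓ : 𝓔.IsCarreDuChamp Γ) {f g h fg : 𝓔.domain} (hf : 𝓔.IsBdd f) (hg : 𝓔.IsBdd g)
    (hh : 𝓔.IsBdd h) (hfg : fg.1 =ᵐ[μ] fun x => f.1 x * g.1 x) :
    𝓔.form h fg = (∫ x, f.1 x * Γ g h x ∂μ) + ∫ x, g.1 x * Γ f h x ∂μ := by
  obtain ⟨fh, hfh, -⟩ := 𝓔.exists_mul hf hh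
  obtain ⟨gh, hgh, -⟩ := 𝓔.exists_mul hg hh
  have hgf : fg.1 =ᵐ[μ] fun x => g.1 x * f.1 x := by
    filter_upwards [hfg] with x hx; rw [hx, mul_comm]
  have hhf : fh.1 =ᵐ[μ] fun x => h.1 x * f.1 x := by
    filter_upwards [hfh] with x hx; rw [hx, mul_comm]
  have hhg : gh.1 =ᵐ[μ] fun x => h.1 x * g.1 x := by
    filter_upwards [hgh] with x hx; rw [hx, mul_comm]
  -- Adding the instances of `density` with test factors `f` and `g` cancels everything except `2
  -- 𝓔(h, fg)`.
  have h2 := hΓ.density g h f fg fh gh hg.memLp hh.memLp hf.memLp hgf hhf hgh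
  have h3 := hΓ.density f h g fg gh fh hf.memLp hh.memLp hg.memLp hfg hhg hfh
  have e1 := 𝓔.symm fg h
  have e2 := 𝓔.symm fh g
  have e3 := 𝓔.symm gh f
  linarith

end CarreDuChamp

/-! ### Locality of the carré du champ and the chain rule for affine functions of the distance. -/

section Locality

variable {X : Type*} [MetricSpace X] [LocallyCompactSpace X] [SecondCountableTopology X]
  [MeasurableSpace X] [BorelSpace X] {μ : Measure X} {𝓔 : SymmDirichletForm μ}
  {Γ : 𝓔.domain →ₗ[ℝ] 𝓔.domain →ₗ[ℝ] Lp ℝ 1 μ}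

/-- Approximating `2φ` within `1/2` leaves room for a cut: the approximant exceeds `3/2` on `K` and
is below `1/2` off `U`, so one subtracts `1/2` and truncates to `[0, 1]`. -/
theorem IsRegular.exists_cutoff (hreg : 𝓔.IsRegular) {K U : Set X} (hK : IsCompact K)
    (hU : IsOpen U) (hKU : K ⊆ U) :
    ∃ (h : 𝓔.domain) (ψ : X → ℝ), h.1 =ᵐ[μ] ψ ∧ (∀ x, 0 ≤ ψ x) ∧ (∀ x, ψ x ≤ 1) ∧
      (∀ x ∈ K, ψ x = 1) ∧ tsupport ψ ⊆ U := by
  obtain ⟨φ, hφ1, hφ0, hφc, -⟩ := exists_continuous_one_zero_of_isCompact hK hU.isClosed_compl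
    (Set.disjoint_compl_right_iff_subset.2 hKU)
  obtain ⟨v, ψ₀, hψc, -, hv, hclose⟩ := hreg.2 (fun x => 2 * φ x) (by fun_prop)
    (hφc.mul_left (f' := φ) (f := fun _ => (2 : ℝ))) (1 / 2) (by norm_num)
  obtain ⟨p, hp, -⟩ := 𝓔.exists_posPart v
  obtain ⟨q, hq, -⟩ := 𝓔.exists_sub_posPart p
    (by filter_upwards [hp] with x hx; rw [hx]; exact le_max_right _ _)
    (a := 1 / 2) (by norm_num)
  obtain ⟨h, hh, -⟩ := 𝓔.exists_truncation q one_pos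
  refine ⟨h, fun x => min (max (max (ψ₀ x) 0 - 1 / 2) 0) 1, ?_, ?_, ?_, ?_, ?_⟩
  · filter_upwards [hh, hq, hp, hv] with x h1 h2 h3 h4
    rw [h1, h2, h3, h4, max_eq_left (le_max_right _ _)]
  · exact fun x => le_min (le_max_right _ _) zero_le_one
  · exact fun x => min_le_right _ _
  · intro x hx
    have h1 := abs_lt.1 (hclose x)
    have h2 : φ x = 1 := hφ1 hx
    rw [h2] at h1
    refine min_eq_right (le_max_of_le_left ?_)
    have := le_max_left (ψ₀ x) 0
    linarith [h1.2]
  · have hcl : IsClosed {x | (1 / 2 : ℝ) ≤ ψ₀ x} := isClosed_le continuous_const hψc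
    have hsub : Function.support (fun x => min (max (max (ψ₀ x) 0 - 1 / 2) 0) 1) ⊆
        {x | (1 / 2 : ℝ) ≤ ψ₀ x} := by
      intro x hx
      by_contra hlt
      simp only [Set.mem_ofPred_eq, not_le] at hlt
      apply hx
      have : max (ψ₀ x) 0 ≤ 1 / 2 := max_le hlt.le (by norm_num)
      simp only
      rw [max_eq_right (by linarith), min_eq_left zero_le_one]
    refine (closure_minimal hsub hcl).trans fun x hx => ?_
    by_contra hxU
    have h1 := abs_lt.1 (hclose x)
    have h2 : φ x = 0 := hφ0 hxU
    rw [h2] at h1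
    simp only [Set.mem_ofPred_eq] at hx
    linarith [h1.1]

theorem essSupport_subset_tsupport {u ψ : X → ℝ} (h : ∀ᵐ x ∂μ, ψ x = 0 → u x = 0) :
    essSupport μ u ⊆ tsupport ψ := by
  intro x hx
  by_contra hxs
  refine hx _ ((isClosed_tsupport ψ).isOpen_compl.mem_nhds hxs) ?_
  refine (ae_restrict_iff' (isClosed_tsupport ψ).isOpen_compl.measurableSet).2 ?_
  filter_upwards [h] with y hy hys
  exact hy (image_eq_zero_of_notMem_tsupport hys)

theorem ae_of_forall_compact_subset {p : X → Prop} {U : Set X} (hU : IsOpen U)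
    (h : ∀ K, IsCompact K → K ⊆ U → ∀ᵐ x ∂μ, x ∈ K → p x) : ∀ᵐ x ∂μ, x ∈ U → p x := by
  rw [ae_iff]
  refine measure_null_of_locally_null _ fun x hx => ?_
  simp only [Classical.not_imp, Set.mem_ofPred_eq] at hx
  obtain ⟨K, hK, hxK, hKU⟩ := exists_compact_subset hU hx.1
  refine ⟨K ∩ {a | ¬(a ∈ U → p a)}, inter_mem (mem_nhdsWithin_of_mem_nhds
    (mem_interior_iff_mem_nhds.1 hxK)) self_mem_nhdsWithin, ?_⟩
  refine measure_mono_null ?_ (ae_iff.1 (h K hK hKU))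
  rintro y ⟨hyK, hy⟩
  simp only [Classical.not_imp, Set.mem_ofPred_eq] at hy ⊢
  exact ⟨hyK, hy.2⟩

/-- For a cutoff `h` supported in `U`, `2 ∫ h Γ(v, v) = 2 𝓔(v, vh) - 𝓔(v², h)`, and strong locality
kills both terms because `v` and `v²` are constant on `U`. -/
theorem IsCarreDuChamp.eq_zero_of_const_of_isBdd (hΓ : 𝓔.IsCarreDuChamp Γ) (hreg : 𝓔.IsRegular)
    (hloc : 𝓔.IsStronglyLocal) {v : 𝓔.domain} (hvb : 𝓔.IsBdd v) {U : Set X} (hU : IsOpen U)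
    {c : ℝ} (hv : ∀ᵐ x ∂μ, x ∈ U → v.1 x = c) : ∀ᵐ x ∂μ, x ∈ U → Γ v v x = 0 := by
  refine ae_of_forall_compact_subset hU fun K hK hKU => ?_
  obtain ⟨h, ψ, hψ, hψ0, hψ1, hψK, hψU⟩ := hreg.exists_cutoff hK hU hKU
  have hhb : 𝓔.IsBdd h := ⟨1, by
    filter_upwards [hψ] with x hx
    rw [hx, abs_of_nonneg (hψ0 x)]; exact hψ1 x⟩
  obtain ⟨vh, hvh, -⟩ := 𝓔.exists_mul hvb hhb
  obtain ⟨vv, hvv, -⟩ := 𝓔.exists_mul hvb hvb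
  have hd := hΓ.density v v h vh vh vv hvb.memLp hvb.memLp hhb.memLp hvh hvh hvv
  have h1 : 𝓔.form v vh = 0 := by
    refine hloc v vh U c hU ((essSupport_subset_tsupport (ψ := ψ) ?_).trans hψU)
      ((ae_restrict_iff' hU.measurableSet).2 hv)
    filter_upwards [hvh, hψ] with x h1 h2 h3
    rw [h1, h2, h3, mul_zero]
  have h2 : 𝓔.form vv h = 0 := by
    refine hloc vv h U (c * c) hU ((essSupport_subset_tsupport (ψ := ψ) ?_).trans hψU)
      ((ae_restrict_iff' hU.measurableSet).2 ?_)
    · filter_upwards [hψ] with x h2 h3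
      rw [h2, h3]
    · filter_upwards [hvv, hv] with x h1 h2 h3
      rw [h1, h2 h3]
  rw [𝓔.symm vh v, 𝓔.symm h vv, h1, h2] at hd
  have h3 : ∫ x, h.1 x * Γ v v x ∂μ = 0 := by linarith
  rw [integral_eq_zero_iff_of_nonneg_ae] at h3
  · filter_upwards [h3, hψ] with x hx hx2 hxK
    rw [hx2, hψK x hxK, one_mul] at hx
    exact hx
  · filter_upwards [hψ, hΓ.nonneg v] with x hx hx2
    rw [hx]; exact mul_nonneg (hψ0 x) hx2
  · exact hhb.integrable_mul_carre Γ v v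

/-- Locality of the carré du champ. -/
theorem IsCarreDuChamp.eq_zero_of_const (hΓ : 𝓔.IsCarreDuChamp Γ) (hreg : 𝓔.IsRegular)
    (hloc : 𝓔.IsStronglyLocal) {v : 𝓔.domain} {U : Set X} (hU : IsOpen U)
    {c : ℝ} (hv : ∀ᵐ x ∂μ, x ∈ U → v.1 x = c) : ∀ᵐ x ∂μ, x ∈ U → Γ v v x = 0 := by
  obtain ⟨w, hwb, hw, hlim⟩ := 𝓔.exists_bounded_approx v
  have hint : ∫ x in U, Γ v v x ∂μ = 0 := by
    refine le_antisymm ?_ (setIntegral_nonneg_of_ae (hΓ.nonneg v))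
    have hlim2 : Tendsto (fun n => 2 * 𝓔.form (w n - v) (w n - v)) atTop (𝓝 0) := by
      simpa using hlim.const_mul 2
    refine ge_of_tendsto hlim2 (Eventually.of_forall fun n => ?_)
    have hz := hΓ.eq_zero_of_const_of_isBdd hreg hloc (hwb n) hU
      (c := min (max c 0) ((n : ℝ) + 1) - min (max (-c) 0) ((n : ℝ) + 1)) (by
        filter_upwards [hw n, hv] with x h1 h2 h3
        rw [h1, h2 h3])
    -- Write `v = w n - (w n - v)`: the truncation `w n` is again constant on `U`, so `Γ(w n, w n)`
    -- vanishes there.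
    have hle : ∀ᵐ x ∂μ, x ∈ U → Γ v v x ≤ 2 * Γ (w n - v) (w n - v) x := by
      filter_upwards [hΓ.sub_self_le (w n) (w n - v), hz] with x h1 h2 hx
      rw [sub_sub_cancel, h2 hx] at h1
      linarith
    calc ∫ x in U, Γ v v x ∂μ ≤ ∫ x in U, 2 * Γ (w n - v) (w n - v) x ∂μ :=
          setIntegral_mono_on_ae (integrable_carre Γ _ _).integrableOn
            ((integrable_carre Γ _ _).const_mul 2).integrableOn hU.measurableSet hle
      _ ≤ ∫ x, 2 * Γ (w n - v) (w n - v) x ∂μ := by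
          refine setIntegral_le_integral ((integrable_carre Γ _ _).const_mul 2) ?_
          filter_upwards [hΓ.nonneg (w n - v)] with x hx
          simp only [Pi.zero_apply]
          linarith
      _ = 2 * 𝓔.form (w n - v) (w n - v) := by rw [integral_const_mul, hΓ.form_eq]
  rw [setIntegral_eq_zero_iff_of_nonneg_ae (ae_restrict_of_ae (hΓ.nonneg v))
    (integrable_carre Γ _ _).integrableOn] at hint
  exact (ae_restrict_iff' hU.measurableSet).1 hint

/-- Expand `Γ` at `q = (q - s v) + s v`. The first summand is constant on `U`, so its density
vanishes there, and with it the cross term by Cauchy–Schwarz. -/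
theorem IsCarreDuChamp.eq_of_sub_smul_const (hΓ : 𝓔.IsCarreDuChamp Γ) (hreg : 𝓔.IsRegular)
    (hloc : 𝓔.IsStronglyLocal) {q v : 𝓔.domain} {U : Set X} (hU : IsOpen U) {α s : ℝ}
    (h : ∀ᵐ x ∂μ, x ∈ U → q.1 x = α + s * v.1 x) :
    ∀ᵐ x ∂μ, x ∈ U → Γ q q x = s ^ 2 * Γ v v x := by
  have hz := hΓ.eq_zero_of_const hreg hloc (v := q - s • v) hU (c := α) (by
    filter_upwards [h, 𝓔.coeFn_domain_sub q (s • v), 𝓔.coeFn_domain_smul s v] with x h1 h2 h3 hx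
    rw [h2, h3, h1 hx]; ring)
  filter_upwards [hz, hΓ.add_smul_self (q - s • v) v s, hΓ.sq_le (q - s • v) v] with x h1 h2 h3 hx
  rw [sub_add_cancel, h1 hx] at h2
  rw [h1 hx, zero_mul] at h3
  have h4 : Γ (q - s • v) v x = 0 := by
    have := sq_nonneg (Γ (q - s • v) v x)
    exact pow_eq_zero_iff (two_ne_zero) |>.1 (le_antisymm h3 this)
  rw [h2, h4]; ring

theorem MemLoc.localRep_ae {ρ : X → ℝ} (hρ : 𝓔.MemLoc ρ) {V : Set X} (hV : IsOpen V)
    (hVc : IsCompact (closure V)) : ∀ᵐ x ∂μ, x ∈ V → (𝓔.localRep ρ V).1 x = ρ x :=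
  (ae_restrict_iff' hV.measurableSet).1 (Classical.epsilon_spec (hρ.2 V hV hVc))

/-- The chain rule for functions that are locally affine functions of `ρ ∈ 𝓕_loc`. -/
theorem IsCarreDuChamp.eq_smul_energyLoc (hΓ : 𝓔.IsCarreDuChamp Γ) (hreg : 𝓔.IsRegular)
    (hloc : 𝓔.IsStronglyLocal) {ρ : X → ℝ} (hρ : 𝓔.MemLoc ρ) {q : 𝓔.domain} {U : Set X}
    (hU : IsOpen U) {α s : ℝ} (h : ∀ᵐ x ∂μ, x ∈ U → q.1 x = α + s * ρ x) :
    ∀ᵐ x ∂μ, x ∈ U → Γ q q x = s ^ 2 * 𝓔.energyLoc Γ ρ x := by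
  set K := CompactExhaustion.choice X
  have hn : ∀ n : ℕ, ∀ᵐ x ∂μ, x ∈ U ∩ interior (K (n + 1)) → Γ q q x =
      s ^ 2 * Γ (𝓔.localRep ρ (interior (K (n + 1)))) (𝓔.localRep ρ (interior (K (n + 1)))) x := by
    intro n
    refine hΓ.eq_of_sub_smul_const hreg hloc (hU.inter isOpen_interior) (α := α) ?_
    filter_upwards [h, hρ.localRep_ae isOpen_interior
      ((K.isCompact (n + 1)).closure_of_subset interior_subset)] with x h1 h2 hx
    rw [h1 hx.1, h2 hx.2]
  filter_upwards [ae_all_iff.2 hn] with x hx hxU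
  exact hx (K.find x) ⟨hxU, K.subset_interior_succ _ (K.mem_find x)⟩

/-- The function `(R - d(·, x₀))⁺` belongs to the domain. -/
theorem MemLoc.exists_tent (hreg : 𝓔.IsRegular) {x₀ : X} (hd : 𝓔.MemLoc fun x => dist x x₀)
    (hball : ∀ r > 0, IsCompact (closure (Metric.ball x₀ r))) {R : ℝ} (hR : 0 < R) :
    ∃ τ : 𝓔.domain, τ.1 =ᵐ[μ] fun x => max (R - dist x x₀) 0 := by
  obtain ⟨h, ψ, hψ, hψ0, hψ1, hψK, hψU⟩ := hreg.exists_cutoff (hball R hR)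
    (Metric.isOpen_ball (x := x₀) (ε := R + 1))
    (Metric.closure_ball_subset_closedBall.trans (Metric.closedBall_subset_ball (by linarith)))
  have hrep := hd.localRep_ae Metric.isOpen_ball (hball (R + 1) (by linarith))
  set v := 𝓔.localRep (fun x => dist x x₀) (Metric.ball x₀ (R + 1))
  obtain ⟨a, ha⟩ := 𝓔.exists_abs v
  -- Here `R h - |v|` is `R - d` on the ball of radius `R`, at most `R - d ≤ 0` up to radius `R +
  -- 1`, and `-|v|` beyond, where `h = 0`.
  obtain ⟨τ, hτ, -⟩ := 𝓔.exists_posPart (R • h - a)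
  refine ⟨τ, ?_⟩
  filter_upwards [hτ, 𝓔.coeFn_domain_sub (R • h) a, 𝓔.coeFn_domain_smul R h, ha, hψ, hrep] with
    x h1 h2 h3 h4 h5 h6
  rw [h1, h2, h3, h4, h5]
  by_cases hx : x ∈ Metric.ball x₀ R
  · have hx' : dist x x₀ < R := hx
    rw [hψK x (subset_closure hx), h6 (by rw [Metric.mem_ball]; linarith),
      abs_of_nonneg dist_nonneg, mul_one]
  · have hx' : R ≤ dist x x₀ := not_lt.1 hx
    rw [max_eq_right (a := R - dist x x₀) (by linarith), max_eq_right]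
    by_cases hx2 : x ∈ Metric.ball x₀ (R + 1)
    · rw [h6 hx2, abs_of_nonneg dist_nonneg]
      nlinarith [hψ1 x]
    · have : ψ x = 0 := image_eq_zero_of_notMem_tsupport fun h => hx2 (hψU h)
      rw [this, mul_zero, zero_sub]
      exact neg_nonpos.2 (abs_nonneg _)

end Locality

end SymmDirichletForm

namespace SymmDirichletForm

/-! ### Energy inequalities with a weight. -/

section Weights

variable {X : Type*} [MetricSpace X] [MeasurableSpace X] {μ : Measure X} {𝓔 : SymmDirichletForm μ}

/-- `Y + q` is a weight with values in `[1, Y]`, equal to `1` where `d(·, x₀) < R`, equal to `Y`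
where `d(·, x₀) > a`, and such that `Γ(q, q) ≤ Λ (Y + q)²`. -/
structure IsWeight (Γ : 𝓔.domain →ₗ[ℝ] 𝓔.domain →ₗ[ℝ] Lp ℝ 1 μ) (x₀ : X) (Λ R a Y : ℝ)
    (q : 𝓔.domain) : Prop where
  one_le : 1 ≤ Y
  lower : ∀ᵐ x ∂μ, 1 ≤ Y + q.1 x
  upper : ∀ᵐ x ∂μ, q.1 x ≤ 0
  inner : ∀ᵐ x ∂μ, dist x x₀ < R → Y + q.1 x = 1
  outer : ∀ᵐ x ∂μ, a < dist x x₀ → q.1 x = 0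
  energy : ∀ᵐ x ∂μ, Γ q q x ≤ Λ * (Y + q.1 x) ^ 2

variable {Γ : 𝓔.domain →ₗ[ℝ] 𝓔.domain →ₗ[ℝ] Lp ℝ 1 μ} {x₀ : X} {Λ R a Y : ℝ} {q : 𝓔.domain}

theorem IsWeight.abs_le (hq : IsWeight Γ x₀ Λ R a Y q) : ∀ᵐ x ∂μ, |q.1 x| ≤ Y := by
  filter_upwards [hq.lower, hq.upper] with x h1 h2
  rw [_root_.abs_le]
  constructor <;> linarith [hq.one_le]

theorem IsWeight.isBdd (hq : IsWeight Γ x₀ Λ R a Y q) : 𝓔.IsBdd q := ⟨Y, hq.abs_le⟩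

theorem isWeight_zero (hΛ : 0 ≤ Λ) : IsWeight Γ x₀ Λ R a 1 0 := by
  have h0 : (0 : 𝓔.domain).1 =ᵐ[μ] fun _ => (0 : ℝ) := Lp.coeFn_zero ℝ 2 μ
  refine ⟨le_rfl, ?_, ?_, ?_, ?_, ?_⟩
  · filter_upwards [h0] with x h; rw [h, add_zero]
  · filter_upwards [h0] with x h; rw [h]
  · filter_upwards [h0] with x h; rw [h]; simp
  · filter_upwards [h0] with x h; rw [h]; simp
  · have h1 : (Γ 0 0 : Lp ℝ 1 μ) = 0 := by simp
    rw [h1]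
    filter_upwards [Lp.coeFn_zero ℝ 1 μ] with x h
    rw [h]
    simp only [Pi.zero_apply]
    positivity

/-- With `w = Y + q`, Leibniz gives `𝓔(u, wu) = ∫ w Γ(u, u) + ∫ u Γ(q, u)`. The bound on `Γ(q, q)`
and the arithmetic–geometric mean inequality give `2 |u Γ(q, u)| ≤ w Γ(u, u) + Λ w u²`. -/
theorem integral_weight_mul_carre_le (hΓ : 𝓔.IsCarreDuChamp Γ) (hΛ : 0 ≤ Λ)
    (hq : IsWeight Γ x₀ Λ R a Y q) {u U : 𝓔.domain} (hu : 𝓔.IsBdd u)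
    (hU : U.1 =ᵐ[μ] fun x => (Y + q.1 x) * u.1 x) :
    ∫ x, (Y + q.1 x) * Γ u u x ∂μ ≤
      2 * 𝓔.form u U + Λ * ∫ x, (Y + q.1 x) * u.1 x * u.1 x ∂μ := by
  obtain ⟨p, hp, -⟩ := 𝓔.exists_mul hu hq.isBdd
  -- The constant `Y` need not belong to `𝓕`; it is split off, and only `q` enters the Leibniz rule.
  have hUp : U = Y • u + p := by
    apply Subtype.ext
    apply Lp.ext
    filter_upwards [hU, hp, 𝓔.coeFn_domain_add (Y • u) p, 𝓔.coeFn_domain_smul Y u] with x h1 h2 h3 h4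
    rw [h1, h3, h4, h2]; ring
  have hform : 𝓔.form u U = (∫ x, (Y + q.1 x) * Γ u u x ∂μ) + ∫ x, u.1 x * Γ q u x ∂μ := by
    rw [hUp, map_add, map_smul, smul_eq_mul, hΓ.form_mul hu hq.isBdd hu hp, hΓ.form_eq u u]
    have e : ∫ x, (Y + q.1 x) * Γ u u x ∂μ = Y * (∫ x, Γ u u x ∂μ) + ∫ x, q.1 x * Γ u u x ∂μ := by
      rw [← integral_const_mul, ← integral_add ((integrable_carre Γ u u).const_mul Y)
        (hq.isBdd.integrable_mul_carre Γ u u)]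
      simp only [add_mul]
    rw [e]; ring
  have i1 : Integrable (fun x => (Y + q.1 x) * Γ u u x) μ := by
    simp only [add_mul]
    exact ((integrable_carre Γ u u).const_mul Y).add (hq.isBdd.integrable_mul_carre Γ u u)
  have i2 : Integrable (fun x => u.1 x * Γ q u x) μ := hu.integrable_mul_carre Γ q u
  have i3 : Integrable (fun x => (Y + q.1 x) * u.1 x * u.1 x) μ := by
    refine (integrable_mul_Lp_two U.1 u.1).congr ?_
    filter_upwards [hU] with x h1
    rw [h1]
  have hpt : ∀ᵐ x ∂μ, -(2 * (u.1 x * Γ q u x)) ≤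
      (Y + q.1 x) * Γ u u x + Λ * ((Y + q.1 x) * u.1 x * u.1 x) := by
    filter_upwards [hΓ.sq_le q u, hΓ.nonneg u, hq.energy, hq.lower] with x h1 h2 h3 h4
    have h5 : Γ q u x ^ 2 ≤ Λ * (Y + q.1 x) ^ 2 * Γ u u x :=
      h1.trans (mul_le_mul_of_nonneg_right h3 h2)
    have h6 : 0 ≤ (Y + q.1 x) * Γ u u x + Λ * ((Y + q.1 x) * u.1 x * u.1 x) := by
      have : 0 ≤ u.1 x * u.1 x := mul_self_nonneg _
      rw [mul_assoc (Y + q.1 x)]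
      positivity
    have h7 : (2 * (u.1 x * Γ q u x)) ^ 2 ≤ 4 * u.1 x ^ 2 * (Λ * (Y + q.1 x) ^ 2 * Γ u u x) := by
      have : (2 * (u.1 x * Γ q u x)) ^ 2 = 4 * u.1 x ^ 2 * Γ q u x ^ 2 := by ring
      rw [this]
      gcongr
    have h8 := sq_nonneg ((Y + q.1 x) * Γ u u x - Λ * ((Y + q.1 x) * u.1 x * u.1 x))
    have h9 : (2 * (u.1 x * Γ q u x)) ^ 2 ≤
        ((Y + q.1 x) * Γ u u x + Λ * ((Y + q.1 x) * u.1 x * u.1 x)) ^ 2 :=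
      h7.trans (by nlinarith)
    linarith [(abs_le_of_sq_le_sq' h9 h6).1]
  have hint := integral_mono_ae (i2.const_mul 2).neg (i1.add (i3.const_mul Λ)) hpt
  rw [integral_add' i1 (i3.const_mul Λ), integral_neg', integral_const_mul, integral_const_mul] at hint
  linarith

/-- Pointwise Cauchy–Schwarz and Young. Only points with `Γ(φ, φ) ≠ 0` matter, and there the weight
equals `Y`: this is the source of the gain `1 / Y`. -/
theorem abs_form_cutoff_le (hΓ : 𝓔.IsCarreDuChamp Γ)
    (hq : IsWeight Γ x₀ Λ R a Y q) (u φ : 𝓔.domain) (hφ : ∀ᵐ x ∂μ, Γ φ φ x = 0 ∨ q.1 x = 0)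
    {η : ℝ} (hη : 0 < η) :
    |𝓔.form u φ| ≤ η / 2 * (∫ x, (Y + q.1 x) * Γ u u x ∂μ) + 𝓔.form φ φ / (2 * η * Y) := by
  have hY : 0 < Y := one_pos.trans_le hq.one_le
  have i1 : Integrable (fun x => (Y + q.1 x) * Γ u u x) μ := by
    simp only [add_mul]
    exact ((integrable_carre Γ u u).const_mul Y).add (hq.isBdd.integrable_mul_carre Γ u u)
  have i2 := integrable_carre Γ φ φ
  rw [hΓ.form_eq u φ, hΓ.form_eq φ φ, div_eq_inv_mul (∫ x, Γ φ φ x ∂μ)]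
  calc |∫ x, Γ u φ x ∂μ| ≤ ∫ x, |Γ u φ x| ∂μ := abs_integral_le_integral_abs
    _ ≤ ∫ x, (η / 2 * ((Y + q.1 x) * Γ u u x) + (2 * η * Y)⁻¹ * Γ φ φ x) ∂μ := by
        refine integral_mono_ae (integrable_carre Γ u φ).abs
          ((i1.const_mul _).add (i2.const_mul _)) ?_
        filter_upwards [hΓ.sq_le u φ, hΓ.nonneg u, hΓ.nonneg φ, hφ, hq.lower] with x h1 h2 h3 h4 h5
        have h6 : 0 ≤ η / 2 * ((Y + q.1 x) * Γ u u x) + (2 * η * Y)⁻¹ * Γ φ φ x := by positivity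
        refine abs_le_of_sq_le_sq ?_ h6
        rcases h4 with h4 | h4
        · rw [h4, mul_zero] at h1
          exact h1.trans (sq_nonneg _)
        · rw [h4, add_zero]
          refine h1.trans ?_
          have h8 := sq_nonneg (η / 2 * (Y * Γ u u x) - (2 * η * Y)⁻¹ * Γ φ φ x)
          have h9 : 4 * ((η / 2 * (Y * Γ u u x)) * ((2 * η * Y)⁻¹ * Γ φ φ x)) =
            Γ u u x * Γ φ φ x := by field_simp; norm_num
          nlinarith
    _ = _ := by
        rw [integral_add (i1.const_mul _) (i2.const_mul _), integral_const_mul, integral_const_mul]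

end Weights

/-! ### Radial cutoffs and prolongation of weights. -/

section RadialWeights

variable {X : Type*} [MetricSpace X] [LocallyCompactSpace X] [SecondCountableTopology X]
  [MeasurableSpace X] [BorelSpace X] {μ : Measure X} {𝓔 : SymmDirichletForm μ}
  {Γ : 𝓔.domain →ₗ[ℝ] 𝓔.domain →ₗ[ℝ] Lp ℝ 1 μ} {x₀ : X}

theorem IsCarreDuChamp.energyLoc_nonneg (hΓ : 𝓔.IsCarreDuChamp Γ) (ρ : X → ℝ) :
    ∀ᵐ x ∂μ, 0 ≤ 𝓔.energyLoc Γ ρ x := by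
  have h : ∀ᵐ x ∂μ, ∀ n : ℕ,
      0 ≤ Γ (𝓔.localRep ρ (interior (CompactExhaustion.choice X (n + 1))))
        (𝓔.localRep ρ (interior (CompactExhaustion.choice X (n + 1)))) x :=
    ae_all_iff.2 fun n => hΓ.nonneg _
  filter_upwards [h] with x hx
  exact hx _

/-- Spheres are disjoint and `μ` is s-finite, so only countably many are charged. With null boundary
spheres, piecewise radial functions can be treated on open pieces, where locality applies. -/
theorem exists_null_sphere [SFinite μ] (x₀ : X) {a b : ℝ} (hab : a < b) :
    ∃ c ∈ Set.Ioo a b, ∀ᵐ x ∂μ, dist x x₀ ≠ c := by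
  have hc := Measure.countable_meas_level_set_pos (μ := μ) (g := fun x : X => dist x x₀)
    (by fun_prop)
  obtain ⟨c, hcn, hcab⟩ := (hc.dense_compl ℝ).exists_between hab
  refine ⟨c, hcab, ?_⟩
  rw [ae_iff]
  simpa using hcn

/-- A normalised difference of two tents. Moving the radii to null spheres costs at most half of `b
- a`, whence the factor 2 in later slope bounds. -/
theorem exists_radial_cutoff [SFinite μ] (hreg : 𝓔.IsRegular) (hd : 𝓔.MemLoc fun x => dist x x₀)
    (hball : ∀ r > 0, IsCompact (closure (Metric.ball x₀ r))) {a b : ℝ} (ha : 0 < a)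
    (hab : a < b) : ∃ (φ : 𝓔.domain) (a' b' : ℝ), a < a' ∧ b' < b ∧ (b - a) / 2 ≤ b' - a' ∧
      (∀ᵐ x ∂μ, dist x x₀ ≠ a' ∧ dist x x₀ ≠ b') ∧
      (∀ᵐ x ∂μ, dist x x₀ < a' → φ.1 x = 1) ∧
      (∀ᵐ x ∂μ, a' < dist x x₀ → dist x x₀ < b' → φ.1 x = (b' - dist x x₀) / (b' - a')) ∧
      (∀ᵐ x ∂μ, b' < dist x x₀ → φ.1 x = 0) := by
  obtain ⟨a', ha', hna⟩ := exists_null_sphere (μ := μ) x₀ (show a < a + (b - a) / 4 by linarith)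
  obtain ⟨b', hb', hnb⟩ := exists_null_sphere (μ := μ) x₀ (show b - (b - a) / 4 < b by linarith)
  have hlt : a' < b' := by linarith [ha'.2, hb'.1]
  obtain ⟨s, hs⟩ := hd.exists_tent hreg hball (ha.trans ha'.1)
  obtain ⟨t, ht⟩ := hd.exists_tent hreg hball ((ha.trans ha'.1).trans hlt)
  have hpos : 0 < b' - a' := by linarith
  have hφ : ((b' - a')⁻¹ • (t - s)).1 =ᵐ[μ] fun x =>
      (b' - a')⁻¹ * (max (b' - dist x x₀) 0 - max (a' - dist x x₀) 0) := by
    filter_upwards [hs, ht, 𝓔.coeFn_domain_smul (b' - a')⁻¹ (t - s), 𝓔.coeFn_domain_sub t s] with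
      x h1 h2 h3 h4
    rw [h3, h4, h1, h2]
  refine ⟨(b' - a')⁻¹ • (t - s), a', b', ha'.1, hb'.2, by linarith [ha'.2, hb'.1], ?_, ?_, ?_, ?_⟩
  · filter_upwards [hna, hnb] with x h1 h2 using ⟨h1, h2⟩
  · filter_upwards [hφ] with x h1 h2
    rw [h1, max_eq_left (by linarith), max_eq_left (by linarith)]
    field_simp
    ring
  · filter_upwards [hφ] with x h1 h2 h3
    rw [h1, max_eq_left (by linarith), max_eq_right (by linarith)]
    field_simp
    ring
  · filter_upwards [hφ] with x h1 h2
    rw [h1, max_eq_right (by linarith), max_eq_right (by linarith)]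
    simp

theorem isOpen_dist_lt (x₀ : X) (a : ℝ) : IsOpen {x | dist x x₀ < a} :=
  isOpen_lt (by fun_prop) continuous_const

theorem isOpen_lt_dist (x₀ : X) (a : ℝ) : IsOpen {x | a < dist x x₀} :=
  isOpen_lt continuous_const (by fun_prop)

/-- A weight can be prolonged to a larger ball as long as its slope is small compared to its
value. -/
theorem IsWeight.exists_extend [SFinite μ] (hΓ : 𝓔.IsCarreDuChamp Γ) (hreg : 𝓔.IsRegular)
    (hloc : 𝓔.IsStronglyLocal) (hd : 𝓔.MemLoc fun x => dist x x₀)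
    (hball : ∀ r > 0, IsCompact (closure (Metric.ball x₀ r))) {Λ R a b Y Y' : ℝ} {q : 𝓔.domain}
    (hq : IsWeight Γ x₀ Λ R a Y q) (hΛ : 0 ≤ Λ) (hRa : R ≤ a) (ha : 0 < a) (hab : a < b)
    (hYY : Y ≤ Y')
    (he : ∀ᵐ x ∂μ, a < dist x x₀ → dist x x₀ < b →
      (2 * (Y' - Y) / (b - a)) ^ 2 * 𝓔.energyLoc Γ (fun y => dist y x₀) x ≤ Λ * Y ^ 2) :
    ∃ q' : 𝓔.domain, IsWeight Γ x₀ Λ R b Y' q' := by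
  obtain ⟨φ, a', b', haa, hbb, hlen, hnull, h1, h2, h3⟩ :=
    exists_radial_cutoff hreg hd hball ha hab
  have hpos : 0 < b' - a' := by linarith
  have hY := hq.one_le
  -- The new weight `Y' + q - (Y' - Y) φ` is the old one where `φ = 1`, climbs affinely in the
  -- distance from `Y` to `Y'` where `q` is already 0, and equals `Y'` beyond.
  have hsub : (q - (Y' - Y) • φ).1 =ᵐ[μ] fun x => q.1 x - (Y' - Y) * φ.1 x := by
    filter_upwards [𝓔.coeFn_domain_sub q ((Y' - Y) • φ), 𝓔.coeFn_domain_smul (Y' - Y) φ] with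
      x h1 h2
    rw [h1, h2]
  have c1 : ∀ᵐ x ∂μ, x ∈ {x | dist x x₀ < a'} →
      (q - (Y' - Y) • φ).1 x = -(Y' - Y) + 1 * q.1 x := by
    filter_upwards [hsub, h1] with x h4 h5 h6
    rw [h4, h5 h6]; ring
  have c2 : ∀ᵐ x ∂μ, x ∈ {x | a' < dist x x₀} ∩ {x | dist x x₀ < b'} →
      (q - (Y' - Y) • φ).1 x = -((Y' - Y) / (b' - a') * b') +
        (Y' - Y) / (b' - a') * dist x x₀ := by
    filter_upwards [hsub, h2, hq.outer] with x h4 h5 h6 h7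
    have h8 : a < dist x x₀ := haa.trans h7.1
    rw [h4, h5 h7.1 h7.2, h6 h8]; ring
  have c3 : ∀ᵐ x ∂μ, x ∈ {x | b' < dist x x₀} → (q - (Y' - Y) • φ).1 x = 0 := by
    filter_upwards [hsub, h3, hq.outer] with x h4 h5 h6 h7
    have h8 : b' < dist x x₀ := h7
    rw [h4, h5 h7, h6 (by linarith)]; ring
  have g1 := hΓ.eq_of_sub_smul_const hreg hloc (isOpen_dist_lt x₀ a') c1
  have g2 := hΓ.eq_smul_energyLoc hreg hloc hd ((isOpen_lt_dist x₀ a').inter (isOpen_dist_lt x₀ b')) c2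
  have g3 := hΓ.eq_zero_of_const hreg hloc (isOpen_lt_dist x₀ b') c3
  have mid : ∀ x, x ∈ {x | a' < dist x x₀} ∩ {x | dist x x₀ < b'} →
      Y - Y' ≤ -((Y' - Y) / (b' - a') * b') + (Y' - Y) / (b' - a') * dist x x₀ ∧
      -((Y' - Y) / (b' - a') * b') + (Y' - Y) / (b' - a') * dist x x₀ ≤ 0 := by
    rintro x ⟨hx1, hx2⟩
    simp only [Set.mem_ofPred_eq] at hx1 hx2
    have hs : 0 ≤ (Y' - Y) / (b' - a') := div_nonneg (by linarith) hpos.le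
    have hs2 : (Y' - Y) / (b' - a') * (b' - a') = Y' - Y := by field_simp
    constructor <;> nlinarith
  refine ⟨q - (Y' - Y) • φ, hY.trans hYY, ?_, ?_, ?_, ?_, ?_⟩
  · filter_upwards [hnull, c1, c2, c3, hq.lower] with x hn h4 h5 h6 h7
    rcases lt_or_gt_of_ne hn.1 with h | h
    · rw [h4 h]; linarith
    · rcases lt_or_gt_of_ne hn.2 with h' | h'
      · have := mid x ⟨h, h'⟩
        rw [h5 ⟨h, h'⟩]; linarith
      · rw [h6 h']; linarith
  · filter_upwards [hnull, c1, c2, c3, hq.upper] with x hn h4 h5 h6 h7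
    rcases lt_or_gt_of_ne hn.1 with h | h
    · rw [h4 h]; linarith
    · rcases lt_or_gt_of_ne hn.2 with h' | h'
      · have := mid x ⟨h, h'⟩
        rw [h5 ⟨h, h'⟩]; linarith
      · rw [h6 h']
  · filter_upwards [c1, hq.inner] with x h4 h5 h6
    have h7 : dist x x₀ < a' := by linarith
    rw [h4 h7]; linarith [h5 h6]
  · filter_upwards [c3] with x h4 h5
    exact h4 (hbb.trans h5)
  · filter_upwards [hnull, c1, c2, c3, g1, g2, g3, hq.energy, he, hΓ.energyLoc_nonneg
      (fun y => dist y x₀)] with x hn h4 h5 h6 h7 h8 h9 h10 h11 h12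
    rcases lt_or_gt_of_ne hn.1 with h | h
    · rw [h4 h, h7 h]
      convert h10 using 1 <;> ring
    · rcases lt_or_gt_of_ne hn.2 with h' | h'
      · have hm := mid x ⟨h, h'⟩
        rw [← h5 ⟨h, h'⟩] at hm
        rw [h8 ⟨h, h'⟩]
        have hle : (Y' - Y) / (b' - a') ≤ 2 * (Y' - Y) / (b - a) := by
          rw [div_le_div_iff₀ hpos (by linarith)]
          nlinarith
        have h0 : 0 ≤ (Y' - Y) / (b' - a') := div_nonneg (by linarith) hpos.le
        calc ((Y' - Y) / (b' - a')) ^ 2 * 𝓔.energyLoc Γ (fun y => dist y x₀) x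
            ≤ (2 * (Y' - Y) / (b - a)) ^ 2 * 𝓔.energyLoc Γ (fun y => dist y x₀) x := by gcongr
          _ ≤ Λ * Y ^ 2 := h11 (haa.trans h) (h'.trans hbb)
          _ ≤ _ := by gcongr; linarith
      · rw [h9 h']
        positivity

theorem form_radial_cutoff_le [SFinite μ] (hΓ : 𝓔.IsCarreDuChamp Γ) (hreg : 𝓔.IsRegular)
    (hloc : 𝓔.IsStronglyLocal) (hd : 𝓔.MemLoc fun x => dist x x₀)
    (hball : ∀ r > 0, IsCompact (closure (Metric.ball x₀ r))) [IsFiniteMeasureOnCompacts μ]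
    {a b B : ℝ} (ha : 0 < a) (hab : a < b) (hB : 0 ≤ B)
    (he : ∀ᵐ x ∂μ, a < dist x x₀ → dist x x₀ < b →
      𝓔.energyLoc Γ (fun y => dist y x₀) x ≤ B) :
    ∃ φ : 𝓔.domain, (∀ᵐ x ∂μ, dist x x₀ ≤ a → φ.1 x = 1) ∧ (∀ᵐ x ∂μ, 0 ≤ φ.1 x ∧ φ.1 x ≤ 1) ∧
      (∀ᵐ x ∂μ, Γ φ φ x = 0 ∨ a < dist x x₀) ∧
      𝓔.form φ φ ≤ (2 / (b - a)) ^ 2 * B * μ.real (Metric.ball x₀ b \ Metric.ball x₀ a) := by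
  obtain ⟨φ, a', b', haa, hbb, hlen, hnull, h1, h2, h3⟩ :=
    exists_radial_cutoff hreg hd hball ha hab
  have hpos : 0 < b' - a' := by linarith
  have g1 := hΓ.eq_zero_of_const hreg hloc (isOpen_dist_lt x₀ a') (c := 1) h1
  have g2 := hΓ.eq_smul_energyLoc hreg hloc hd (q := φ) (α := b' / (b' - a')) (s := -(b' - a')⁻¹)
    ((isOpen_lt_dist x₀ a').inter (isOpen_dist_lt x₀ b')) (by
      filter_upwards [h2] with x h4 h5
      rw [h4 h5.1 h5.2]; field_simp; ring)
  have g3 := hΓ.eq_zero_of_const hreg hloc (isOpen_lt_dist x₀ b') (c := 0) h3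
  refine ⟨φ, ?_, ?_, ?_, ?_⟩
  · filter_upwards [h1] with x h4 h5
    exact h4 (by linarith)
  · filter_upwards [hnull, h1, h2, h3] with x hn h4 h5 h6
    rcases lt_or_gt_of_ne hn.1 with h | h
    · rw [h4 h]; norm_num
    · rcases lt_or_gt_of_ne hn.2 with h' | h'
      · rw [h5 h h']
        exact ⟨div_nonneg (by linarith) hpos.le, (div_le_one hpos).2 (by linarith)⟩
      · rw [h6 h']; norm_num
  · filter_upwards [g1] with x h4
    rcases lt_or_ge (dist x x₀) a' with h | h
    · exact Or.inl (h4 h)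
    · exact Or.inr (haa.trans_le h)
  · have hmeas : MeasurableSet (Metric.ball x₀ b \ Metric.ball x₀ a) :=
      Metric.isOpen_ball.measurableSet.diff Metric.isOpen_ball.measurableSet
    have hfin : μ (Metric.ball x₀ b \ Metric.ball x₀ a) ≠ ∞ := by
      refine ((measure_mono (Set.sdiff_subset.trans subset_closure)).trans_lt
        (hball b (ha.trans hab)).measure_lt_top).ne
    rw [hΓ.form_eq]
    calc ∫ x, Γ φ φ x ∂μ
        ≤ ∫ x, (Metric.ball x₀ b \ Metric.ball x₀ a).indicator
            (fun _ => (2 / (b - a)) ^ 2 * B) x ∂μ := by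
          refine integral_mono_ae (integrable_carre Γ φ φ)
            ((integrable_indicator_iff hmeas).2 (integrableOn_const hfin)) ?_
          filter_upwards [hnull, g1, g2, g3, he, hΓ.energyLoc_nonneg (fun y => dist y x₀)] with
            x hn h4 h5 h6 h7 h8
          have hout : Γ φ φ x = 0 ∨ (a' < dist x x₀ ∧ dist x x₀ < b') := by
            rcases lt_or_gt_of_ne hn.1 with h | h
            · exact Or.inl (h4 h)
            · rcases lt_or_gt_of_ne hn.2 with h' | h'
              · exact Or.inr ⟨h, h'⟩
              · exact Or.inl (h6 h')
          by_cases hx : x ∈ Metric.ball x₀ b \ Metric.ball x₀ a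
          · rw [Set.indicator_of_mem hx]
            rcases hout with h | h
            · rw [h]
              have hx1 : dist x x₀ < b := hx.1
              have hx2 : a ≤ dist x x₀ := not_lt.1 hx.2
              positivity
            · have hle : (b' - a')⁻¹ ≤ 2 / (b - a) := by
                rw [inv_eq_one_div, div_le_div_iff₀ hpos (by linarith)]
                linarith
              have h9 := h7 (haa.trans h.1) (h.2.trans hbb)
              rw [h5 h, neg_sq]
              gcongr
          · rw [Set.indicator_of_notMem hx]
            rcases hout with h | h
            · rw [h]
            · exfalso
              refine hx ⟨h.2.trans hbb, fun hxa => ?_⟩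
              have : dist x x₀ < a := hxa
              linarith [h.1]
      _ = _ := by
          rw [integral_indicator hmeas, setIntegral_const, smul_eq_mul, mul_comm]

end RadialWeights

end SymmDirichletForm

/-! ### Order intervals as closed convex subsets of `L²`. -/

section OrderLp

variable {X : Type*} [MeasurableSpace X] {μ : Measure X}

theorem ae_mem_Icc_of_tendsto_Lp_two {F : ℕ → Lp ℝ 2 μ} {G : Lp ℝ 2 μ}
    (h : Tendsto F atTop (𝓝 G)) {a b : ℝ} (hF : ∀ n, ∀ᵐ x ∂μ, a ≤ F n x ∧ F n x ≤ b) :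
    ∀ᵐ x ∂μ, a ≤ G x ∧ G x ≤ b := by
  obtain ⟨ns, -, hns⟩ := (tendstoInMeasure_of_tendsto_Lp h).exists_seq_tendsto_ae
  filter_upwards [hns, ae_all_iff.2 hF] with x h1 h2
  exact ⟨ge_of_tendsto' h1 fun n => (h2 _).1, le_of_tendsto' h1 fun n => (h2 _).2⟩

theorem ae_nonneg_of_tendsto_Lp_two {F : ℕ → Lp ℝ 2 μ} {G : Lp ℝ 2 μ}
    (h : Tendsto F atTop (𝓝 G)) (hF : ∀ n, ∀ᵐ x ∂μ, 0 ≤ F n x) : ∀ᵐ x ∂μ, 0 ≤ G x := by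
  obtain ⟨ns, -, hns⟩ := (tendstoInMeasure_of_tendsto_Lp h).exists_seq_tendsto_ae
  filter_upwards [hns, ae_all_iff.2 hF] with x h1 h2
  exact ge_of_tendsto' h1 fun n => h2 _

theorem convex_ae_mem_Icc (a b : ℝ) :
    Convex ℝ {f : Lp ℝ 2 μ | ∀ᵐ x ∂μ, a ≤ f x ∧ f x ≤ b} := by
  intro f hf g hg s t hs ht hst
  filter_upwards [hf, hg, Lp.coeFn_add (s • f) (t • g), Lp.coeFn_smul s f, Lp.coeFn_smul t g] with
    x h1 h2 h3 h4 h5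
  rw [h3, Pi.add_apply, h4, h5, Pi.smul_apply, Pi.smul_apply]
  exact convex_Icc a b h1 h2 hs ht hst

theorem isClosed_ae_mem_Icc (a b : ℝ) :
    IsClosed {f : Lp ℝ 2 μ | ∀ᵐ x ∂μ, a ≤ f x ∧ f x ≤ b} := by
  refine IsSeqClosed.isClosed fun F G hF hFG => ?_
  exact ae_mem_Icc_of_tendsto_Lp_two hFG hF

end OrderLp

/-! ### The semigroup: averaged orbits, symmetry, Markov property. -/

namespace SymmDirichletForm

variable {X : Type*} [MeasurableSpace X] {μ : Measure X} {𝓔 : SymmDirichletForm μ}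
  {T : ℝ → Lp ℝ 2 μ →L[ℝ] Lp ℝ 2 μ}

/-- The orbit of `f` under the semigroup, extended by `f` to negative times. -/
noncomputable def orbit (T : ℝ → Lp ℝ 2 μ →L[ℝ] Lp ℝ 2 μ) (f : Lp ℝ 2 μ) (s : ℝ) : Lp ℝ 2 μ :=
  T (max s 0) f

/-- The average of an orbit over `[s, s + h]`. -/
noncomputable def avgOrbit (T : ℝ → Lp ℝ 2 μ →L[ℝ] Lp ℝ 2 μ) (f : Lp ℝ 2 μ) (h s : ℝ) :
    Lp ℝ 2 μ :=
  h⁻¹ • ∫ r in s..(s + h), orbit T f r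

theorem orbit_of_nonneg (f : Lp ℝ 2 μ) {s : ℝ} (hs : 0 ≤ s) : orbit T f s = T s f := by
  rw [orbit, max_eq_left hs]

namespace IsSemigroup

theorem norm_apply_le (hT : 𝓔.IsSemigroup T) {t : ℝ} (ht : 0 ≤ t) (f : Lp ℝ 2 μ) :
    ‖T t f‖ ≤ ‖f‖ := by
  have := (T t).le_of_opNorm_le (hT.contraction t ht) f
  rwa [one_mul] at this

theorem apply_add (hT : 𝓔.IsSemigroup T) {s t : ℝ} (hs : 0 ≤ s) (ht : 0 ≤ t) (f : Lp ℝ 2 μ) :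
    T (s + t) f = T s (T t f) := by
  rw [hT.add s t hs ht]; rfl

theorem norm_sub_le (hT : 𝓔.IsSemigroup T) (f : Lp ℝ 2 μ) {s t : ℝ} (hs : 0 ≤ s) (hst : s ≤ t) :
    ‖T t f - T s f‖ ≤ ‖T (t - s) f - f‖ := by
  have h := hT.apply_add hs (sub_nonneg.2 hst) f
  rw [add_sub_cancel] at h
  rw [h, ← map_sub]
  exact hT.norm_apply_le hs _

theorem continuous_orbit (hT : 𝓔.IsSemigroup T) (f : Lp ℝ 2 μ) : Continuous (orbit T f) := by
  rw [Metric.continuous_iff]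
  intro b ε hε
  have h1 := hT.continuous f
  rw [Metric.tendsto_nhdsWithin_nhds] at h1
  obtain ⟨δ, hδ, h1⟩ := h1 ε hε
  have key : ∀ s t : ℝ, 0 ≤ s → s ≤ t → t - s < δ → ‖T t f - T s f‖ < ε := by
    intro s t hs hst hlt
    rcases hst.eq_or_lt with rfl | hst'
    · simpa using hε
    · refine (hT.norm_sub_le f hs hst).trans_lt ?_
      rw [← dist_eq_norm]
      refine h1 (sub_pos.2 hst') ?_
      rw [Real.dist_eq, sub_zero, abs_of_pos (sub_pos.2 hst')]
      exact hlt
  refine ⟨δ, hδ, fun a ha => ?_⟩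
  rw [Real.dist_eq] at ha
  have hmax := (abs_max_sub_max_le_abs a b 0).trans_lt ha
  rw [dist_eq_norm, orbit, orbit]
  rcases le_total (max a 0) (max b 0) with h | h
  · rw [norm_sub_rev]
    exact key _ _ (le_max_right _ _) h (by rw [abs_sub_comm] at hmax; exact (le_abs_self _).trans_lt hmax)
  · exact key _ _ (le_max_right _ _) h ((le_abs_self _).trans_lt hmax)

/-- Averaging makes every orbit differentiable in time. Differential inequalities are proved for
averages and passed to the limit `h → 0` by `tendsto_avgOrbit`. -/
theorem hasDerivAt_avgOrbit (hT : 𝓔.IsSemigroup T) (f : Lp ℝ 2 μ) (h s : ℝ) :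
    HasDerivAt (avgOrbit T f h) (h⁻¹ • (orbit T f (s + h) - orbit T f s)) s := by
  have hc := hT.continuous_orbit f
  have h1 : HasDerivAt (fun s => ∫ r in (0 : ℝ)..(s + h), orbit T f r) (orbit T f (s + h)) s :=
    (hc.integral_hasStrictDerivAt 0 (s + h)).hasDerivAt.comp_add_const s h
  have h2 : HasDerivAt (fun s => ∫ r in (0 : ℝ)..s, orbit T f r) (orbit T f s) s :=
    (hc.integral_hasStrictDerivAt 0 s).hasDerivAt
  have h3 := (h1.sub h2).const_smul h⁻¹
  refine h3.congr_of_eventuallyEq (Eventually.of_forall fun r => ?_)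
  simp only [avgOrbit, Pi.smul_apply, Pi.sub_apply]
  rw [intervalIntegral.integral_interval_sub_left (hc.intervalIntegrable _ _)
    (hc.intervalIntegrable _ _)]

theorem continuous_avgOrbit (hT : 𝓔.IsSemigroup T) (f : Lp ℝ 2 μ) (h : ℝ) :
    Continuous (avgOrbit T f h) :=
  continuous_iff_continuousAt.2 fun s => (hT.hasDerivAt_avgOrbit f h s).continuousAt

theorem apply_avgOrbit (hT : 𝓔.IsSemigroup T) (f : Lp ℝ 2 μ) {h s t : ℝ} (hh : 0 ≤ h)
    (hs : 0 ≤ s) (ht : 0 ≤ t) : T t (avgOrbit T f h s) = avgOrbit T f h (s + t) := by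
  have hc := hT.continuous_orbit f
  rw [avgOrbit, avgOrbit, map_smul, ← (T t).intervalIntegral_comp_comm (hc.intervalIntegrable _ _)]
  congr 1
  have : ∫ r in (s + t)..(s + t + h), orbit T f r = ∫ r in s..(s + h), orbit T f (r + t) := by
    rw [intervalIntegral.integral_comp_add_right (orbit T f)]
    congr 1; ring
  rw [this]
  refine intervalIntegral.integral_congr fun r hr => ?_
  rw [Set.uIcc_of_le (by linarith)] at hr
  have hr0 : 0 ≤ r := hs.trans hr.1
  rw [orbit_of_nonneg f hr0, orbit_of_nonneg f (add_nonneg hr0 ht), add_comm, hT.apply_add ht hr0]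

/-- The semigroup shifts averages in time, so its difference quotients at an average are those of
`avgOrbit`. -/
theorem isGenerator_avgOrbit (hT : 𝓔.IsSemigroup T) (f : Lp ℝ 2 μ) {h s : ℝ} (hh : 0 ≤ h)
    (hs : 0 ≤ s) :
    𝓔.IsGenerator (avgOrbit T f h s) (h⁻¹ • (orbit T f (s + h) - orbit T f s)) := by
  rw [← hT.generator]
  have h1 := (hT.hasDerivAt_avgOrbit f h s).tendsto_slope_zero_right
  refine h1.congr' ?_
  filter_upwards [self_mem_nhdsWithin] with t ht
  rw [hT.apply_avgOrbit f hh hs (le_of_lt ht)]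

theorem tendsto_avgOrbit (hT : 𝓔.IsSemigroup T) (f : Lp ℝ 2 μ) :
    Tendsto (fun n : ℕ => avgOrbit T f (1 / ((n : ℝ) + 1)) 0) atTop (𝓝 f) := by
  have hc := hT.continuous_orbit f
  have h2 : HasDerivAt (fun s => ∫ r in (0 : ℝ)..s, orbit T f r) (orbit T f 0) 0 :=
    (hc.integral_hasStrictDerivAt 0 0).hasDerivAt
  have h3 := h2.tendsto_slope_zero_right
  rw [orbit_of_nonneg f le_rfl, hT.zero] at h3
  have h4 : Tendsto (fun n : ℕ => 1 / ((n : ℝ) + 1)) atTop (𝓝[>] 0) :=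
    tendsto_nhdsWithin_iff.2 ⟨tendsto_one_div_add_atTop_nhds_zero_nat,
      Eventually.of_forall fun n => by simp only [Set.mem_Ioi]; positivity⟩
  have h5 := h3.comp h4
  refine h5.congr fun n => ?_
  simp [avgOrbit]

/-- The semigroup consists of symmetric operators. -/
theorem inner_apply_left (hT : 𝓔.IsSemigroup T) {t : ℝ} (ht : 0 ≤ t) (f g : Lp ℝ 2 μ) :
    inner ℝ (T t f) g = inner ℝ f (T t g) := by
  have key : ∀ h : ℝ, 0 < h → inner ℝ (T t (avgOrbit T f h 0)) (avgOrbit T g h 0) =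
      inner ℝ (avgOrbit T f h 0) (T t (avgOrbit T g h 0)) := by
    intro h hh
    have hcf := hT.continuous_avgOrbit f h
    have hcg := hT.continuous_avgOrbit g h
    -- Going forward along one orbit and backward along the other produces `(u, Lv) - (Lu, v)`,
    -- which is 0 by symmetry of `𝓔`.
    have hd : ∀ s ∈ Set.Ico 0 t, HasDerivWithinAt
        (fun s => inner ℝ (avgOrbit T f h (t - s)) (avgOrbit T g h s)) 0 (Set.Ici s) s := by
      intro s hs
      have d1 := (hT.hasDerivAt_avgOrbit f h (t - s)).scomp s ((hasDerivAt_id s).const_sub t)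
      have d2 := hT.hasDerivAt_avgOrbit g h s
      have d3 := d1.inner ℝ d2
      obtain ⟨m1, e1⟩ := hT.isGenerator_avgOrbit f hh.le (sub_nonneg.2 hs.2.le)
      obtain ⟨m2, e2⟩ := hT.isGenerator_avgOrbit g hh.le hs.1
      have e1' := e1 ⟨_, m2⟩
      have e2' := e2 ⟨_, m1⟩
      rw [𝓔.symm] at e2'
      have hz : inner ℝ (avgOrbit T f h (t - s)) (h⁻¹ • (orbit T g (s + h) - orbit T g s)) +
          inner ℝ ((-1 : ℝ) • h⁻¹ • (orbit T f (t - s + h) - orbit T f (t - s)))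
            (avgOrbit T g h s) = 0 := by
        rw [inner_smul_left, real_inner_comm]
        simp only [conj_trivial]
        linarith
      exact (hz ▸ d3).hasDerivWithinAt
    have := constant_of_has_deriv_right_zero (Continuous.continuousOn (by fun_prop)) hd t
      ⟨ht, le_rfl⟩
    simp only [sub_self, sub_zero] at this
    rw [hT.apply_avgOrbit f hh.le le_rfl ht, hT.apply_avgOrbit g hh.le le_rfl ht, zero_add]
    exact this.symm
  have l1 := ((T t).continuous.tendsto _).comp (hT.tendsto_avgOrbit f)
  have l2 := ((T t).continuous.tendsto _).comp (hT.tendsto_avgOrbit g)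
  refine tendsto_nhds_unique (l1.inner (hT.tendsto_avgOrbit g)) ?_
  refine ((hT.tendsto_avgOrbit f).inner l2).congr fun n => ?_
  exact (key _ (by positivity)).symm

theorem lipschitzWith_truncation (c : ℝ) : LipschitzWith 1 fun x : ℝ => min (max x 0) c :=
  (LipschitzWith.id.max_const 0).min_const c

/-- The distance to the functions with values in `[0, c]` does not grow along orbits. Let `P` be the
nearest-point projection. Freezing `P u` at time `s` can only enlarge the later distance, and the
squared frozen distance has derivative `-2 𝓔(u, u - P u) ≤ 0`, so `P` itself is never
differentiated. -/
theorem mem_Icc_of_mem_Icc (hT : 𝓔.IsSemigroup T) {t : ℝ} (ht : 0 ≤ t) {f : Lp ℝ 2 μ} {c : ℝ}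
    (hc : 0 < c) (hf : ∀ᵐ x ∂μ, 0 ≤ f x ∧ f x ≤ c) : ∀ᵐ x ∂μ, 0 ≤ T t f x ∧ T t f x ≤ c := by
  have h0 : min (max (0 : ℝ) 0) c = 0 := by simp [hc.le]
  let P : Lp ℝ 2 μ → Lp ℝ 2 μ := (lipschitzWith_truncation c).compLp h0
  have hPc : Continuous P := (lipschitzWith_truncation c).continuous_compLp h0
  have hP : ∀ u, P u =ᵐ[μ] fun x => min (max (u x) 0) c := fun u =>
    (lipschitzWith_truncation c).coeFn_compLp h0 u
  have hnear : ∀ u v, ‖u - P u‖ ≤ ‖u - P v‖ := by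
    intro u v
    refine norm_le_norm_Lp_two ?_
    filter_upwards [hP u, hP v, Lp.coeFn_sub u (P u), Lp.coeFn_sub u (P v)] with x h1 h2 h3 h4
    rw [h3, h4, Pi.sub_apply, Pi.sub_apply, h1, h2]
    have a1 : 0 ≤ min (max (v x) 0) c := le_min (le_max_right _ _) hc.le
    have a2 : min (max (v x) 0) c ≤ c := min_le_right _ _
    rcases le_total (u x) 0 with h | h
    · rw [max_eq_right h, min_eq_left hc.le, abs_of_nonpos (by linarith), abs_of_nonpos (by linarith)]
      linarith
    · rw [max_eq_left h]
      rcases le_total (u x) c with h' | h'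
      · rw [min_eq_left h', sub_self, abs_zero]; exact abs_nonneg _
      · rw [min_eq_right h', abs_of_nonneg (by linarith), abs_of_nonneg (by linarith)]
        linarith
  have key : ∀ h : ℝ, 0 < h → ‖T t (avgOrbit T f h 0) - P (T t (avgOrbit T f h 0))‖ ^ 2 ≤
      ‖avgOrbit T f h 0 - P (avgOrbit T f h 0)‖ ^ 2 := by
    intro h hh
    have hcf := hT.continuous_avgOrbit f h
    have := image_le_of_liminf_slope_right_le_deriv_boundary (a := 0) (b := t)
      (f := fun s => ‖avgOrbit T f h s - P (avgOrbit T f h s)‖ ^ 2)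
      (B := fun _ => ‖avgOrbit T f h 0 - P (avgOrbit T f h 0)‖ ^ 2) (B' := fun _ => 0)
      (Continuous.continuousOn (by fun_prop)) le_rfl continuousOn_const
      (fun x _ => hasDerivWithinAt_const _ _ _) ?_ (show t ∈ Set.Icc 0 t from ⟨ht, le_rfl⟩)
    · rwa [hT.apply_avgOrbit f hh.le le_rfl ht, zero_add]
    · intro s hs r hr
      have d1 := ((hT.hasDerivAt_avgOrbit f h s).sub_const (P (avgOrbit T f h s))).norm_sq
      obtain ⟨m1, e1⟩ := hT.isGenerator_avgOrbit f hh.le hs.1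
      obtain ⟨v, hv, -⟩ := 𝓔.exists_truncation ⟨_, m1⟩ hc
      have hvP : v.1 = P (avgOrbit T f h s) := by
        apply Lp.ext
        filter_upwards [hv, hP (avgOrbit T f h s)] with x h1 h2
        rw [h1, h2]
      have e2 := e1 (⟨_, m1⟩ - v)
      have e3 := 𝓔.form_sub_truncation_nonneg _ v hc hv
      have hle : 2 * inner ℝ (avgOrbit T f h s - P (avgOrbit T f h s))
          (h⁻¹ • (orbit T f (s + h) - orbit T f s)) ≤ 0 := by
        rw [e2] at e3
        have e4 : ((⟨_, m1⟩ - v : 𝓔.domain) : Lp ℝ 2 μ) =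
            avgOrbit T f h s - P (avgOrbit T f h s) := by rw [← hvP]; rfl
        rw [e4, real_inner_comm] at e3
        linarith
      have hsl := (hasDerivAt_iff_tendsto_slope.1 d1).mono_left
        (nhdsWithin_mono s (fun z (hz : s < z) => hz.ne'))
      refine Eventually.frequently ?_
      filter_upwards [hsl.eventually (gt_mem_nhds (hle.trans_lt hr)), self_mem_nhdsWithin] with
        z hz hsz
      refine lt_of_le_of_lt ?_ hz
      have hzs : 0 < z - s := sub_pos.2 hsz
      rw [slope_def_field, slope_def_field]
      gcongr
      exact hnear _ _
  have l1 := ((T t).continuous.tendsto _).comp (hT.tendsto_avgOrbit f)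
  have l2 : Tendsto (fun n : ℕ => ‖T t (avgOrbit T f (1 / ((n : ℝ) + 1)) 0) -
      P (T t (avgOrbit T f (1 / ((n : ℝ) + 1)) 0))‖ ^ 2) atTop (𝓝 (‖T t f - P (T t f)‖ ^ 2)) :=
    ((l1.sub ((hPc.tendsto _).comp l1)).norm).pow 2
  have l3 := (((hT.tendsto_avgOrbit f).sub
    ((hPc.tendsto _).comp (hT.tendsto_avgOrbit f))).norm).pow 2
  have hle := le_of_tendsto_of_tendsto' l2 l3 fun n => key _ (by positivity)
  have hPf : P f = f := by
    apply Lp.ext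
    filter_upwards [hP f, hf] with x h1 h2
    rw [h1, max_eq_left h2.1, min_eq_left h2.2]
  rw [hPf, sub_self, norm_zero] at hle
  have hz : T t f = P (T t f) := by
    have : ‖T t f - P (T t f)‖ = 0 := by
      have h1 := norm_nonneg (T t f - P (T t f))
      nlinarith
    exact sub_eq_zero.1 (norm_eq_zero.1 this)
  filter_upwards [hP (T t f)] with x h1
  rw [hz, h1]
  exact ⟨le_min (le_max_right _ _) hc.le, min_le_right _ _⟩

theorem nonneg_of_nonneg (hT : 𝓔.IsSemigroup T) {t : ℝ} (ht : 0 ≤ t) {f : Lp ℝ 2 μ}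
    (hf : ∀ᵐ x ∂μ, 0 ≤ f x) : ∀ᵐ x ∂μ, 0 ≤ T t f x := by
  choose F hF using fun n : ℕ => exists_Lp_two_of_le (μ := μ)
    (φ := fun x => min (max (f x) 0) ((n : ℝ) + 1))
    (((Lp.aestronglyMeasurable f).sup aestronglyMeasurable_const).inf
      aestronglyMeasurable_const) f
    (Eventually.of_forall fun x => abs_min_max_le _ _ (by positivity))
  have hlim : Tendsto F atTop (𝓝 f) := by
    refine tendsto_Lp_two_of_dominated (g := f) (fun n => ?_) ?_
    · filter_upwards [hF n] with x hx
      rw [hx]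
      exact abs_min_max_le _ _ (by positivity)
    · filter_upwards [ae_all_iff.2 hF, hf] with x hx hfx
      refine tendsto_const_nhds.congr' ?_
      obtain ⟨N, hN⟩ := exists_nat_ge (f x)
      filter_upwards [eventually_ge_atTop N] with n hn
      have hn' : (N : ℝ) ≤ n := by exact_mod_cast hn
      rw [hx n, max_eq_left hfx, min_eq_left]
      linarith
  refine ae_nonneg_of_tendsto_Lp_two (((T t).continuous.tendsto _).comp hlim) fun n => ?_
  filter_upwards [hT.mem_Icc_of_mem_Icc ht (f := F n) (c := (n : ℝ) + 1) (by positivity) (by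
    filter_upwards [hF n] with x hx
    rw [hx]
    exact ⟨le_min (le_max_right _ _) (by positivity), min_le_right _ _⟩)] with x hx
  exact hx.1

theorem mono (hT : 𝓔.IsSemigroup T) {t : ℝ} (ht : 0 ≤ t) {f g : Lp ℝ 2 μ}
    (hfg : ∀ᵐ x ∂μ, f x ≤ g x) : ∀ᵐ x ∂μ, T t f x ≤ T t g x := by
  have h := hT.nonneg_of_nonneg ht (f := g - f) (by
    filter_upwards [hfg, Lp.coeFn_sub g f] with x h1 h2
    rw [h2, Pi.sub_apply]; linarith)
  rw [map_sub] at h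
  filter_upwards [h, Lp.coeFn_sub (T t g) (T t f)] with x h1 h2
  rw [h2, Pi.sub_apply] at h1; linarith

theorem le_of_le (hT : 𝓔.IsSemigroup T) {t : ℝ} (ht : 0 ≤ t) {f : Lp ℝ 2 μ} {c : ℝ} (hc : 0 < c)
    (hf : ∀ᵐ x ∂μ, f x ≤ c) : ∀ᵐ x ∂μ, T t f x ≤ c := by
  obtain ⟨F, hF⟩ := exists_Lp_two_of_le (μ := μ) (φ := fun x => min (max (f x) 0) c)
    (((Lp.aestronglyMeasurable f).sup aestronglyMeasurable_const).inf
      aestronglyMeasurable_const) f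
    (Eventually.of_forall fun x => abs_min_max_le _ _ hc.le)
  filter_upwards [hT.mono ht (f := f) (g := F) (by
    filter_upwards [hF, hf] with x h1 h2
    rw [h1]; exact le_min (le_max_left _ _) h2), hT.mem_Icc_of_mem_Icc ht hc (f := F) (by
    filter_upwards [hF] with x hx
    rw [hx]
    exact ⟨le_min (le_max_right _ _) hc.le, min_le_right _ _⟩)] with x h1 h2
  exact h1.trans h2.2

theorem abs_le_of_abs_le (hT : 𝓔.IsSemigroup T) {t : ℝ} (ht : 0 ≤ t) {f : Lp ℝ 2 μ} {c : ℝ}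
    (hc : 0 < c) (hf : ∀ᵐ x ∂μ, |f x| ≤ c) : ∀ᵐ x ∂μ, |T t f x| ≤ c := by
  have h1 := hT.le_of_le ht hc (f := f) (by
    filter_upwards [hf] with x hx using (abs_le.1 hx).2)
  have h2 := hT.le_of_le ht hc (f := -f) (by
    filter_upwards [hf, Lp.coeFn_neg f] with x hx h
    rw [h, Pi.neg_apply]; linarith [(abs_le.1 hx).1])
  rw [map_neg] at h2
  filter_upwards [h1, h2, Lp.coeFn_neg (T t f)] with x h1 h2 h3
  rw [h3, Pi.neg_apply] at h2
  exact abs_le.2 ⟨by linarith, h1⟩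

theorem abs_avgOrbit_le (hT : 𝓔.IsSemigroup T) {f : Lp ℝ 2 μ} {c h s : ℝ} (hc : 0 < c)
    (hh : 0 < h) (hf : ∀ᵐ x ∂μ, |f x| ≤ c) :
    ∀ᵐ x ∂μ, |avgOrbit T f h s x| ≤ c := by
  have hcont := hT.continuous_orbit f
  have hmem : (⨍ r in s..(s + h), orbit T f r) ∈
      {f : Lp ℝ 2 μ | ∀ᵐ x ∂μ, -c ≤ f x ∧ f x ≤ c} := by
    refine (convex_ae_mem_Icc (-c) c).set_average_mem (isClosed_ae_mem_Icc (-c) c) ?_ ?_ ?_ ?_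
    · rw [Set.uIoc_of_le (by linarith), Real.volume_Ioc]; simpa using hh
    · rw [Set.uIoc_of_le (by linarith), Real.volume_Ioc]; exact ENNReal.ofReal_ne_top
    · refine Eventually.of_forall fun r => ?_
      filter_upwards [hT.abs_le_of_abs_le (le_max_right r 0) hc hf] with x hx
      exact abs_le.1 hx
    · exact (hcont.intervalIntegrable s (s + h)).def'
  rw [interval_average_eq, add_sub_cancel_left] at hmem
  filter_upwards [hmem] with x hx
  exact abs_le.2 hx

end IsSemigroup

end SymmDirichletForm

/-- Applied to a weight, it makes `∫ w u²` the quadratic form of a bounded operator, hence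
differentiable along averaged orbits. -/
theorem exists_multiplication_operator {X : Type*} [MeasurableSpace X] {μ : Measure X} {m : X → ℝ}
    (hm : AEStronglyMeasurable m μ) {c : ℝ} (hc : ∀ᵐ x ∂μ, |m x| ≤ c) :
    ∃ A : Lp ℝ 2 μ →L[ℝ] Lp ℝ 2 μ, ∀ f, A f =ᵐ[μ] fun x => m x * f x := by
  have hex : ∀ f : Lp ℝ 2 μ, ∃ F : Lp ℝ 2 μ, F =ᵐ[μ] fun x => m x * f x := fun f => by
    refine exists_Lp_two_of_le (hm.mul (Lp.aestronglyMeasurable f)) (|c| • f) ?_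
    filter_upwards [hc, Lp.coeFn_smul |c| f] with x h1 h2
    rw [h2, Pi.smul_apply, smul_eq_mul, abs_mul, abs_mul, abs_abs]
    exact mul_le_mul_of_nonneg_right (h1.trans (le_abs_self c)) (abs_nonneg _)
  choose F hF using hex
  let L : Lp ℝ 2 μ →ₗ[ℝ] Lp ℝ 2 μ :=
    { toFun := F
      map_add' := fun f g => by
        apply Lp.ext
        filter_upwards [hF (f + g), Lp.coeFn_add (F f) (F g), hF f, hF g, Lp.coeFn_add f g] with
          x h1 h2 h3 h4 h5
        rw [h1, h2, Pi.add_apply, h3, h4, h5, Pi.add_apply, mul_add]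
      map_smul' := fun a f => by
        apply Lp.ext
        filter_upwards [hF (a • f), Lp.coeFn_smul a (F f), hF f, Lp.coeFn_smul a f] with
          x h1 h2 h3 h4
        rw [h1, RingHom.id_apply, h2, Pi.smul_apply, h3, h4, Pi.smul_apply, smul_eq_mul,
          smul_eq_mul, mul_left_comm] }
  refine ⟨L.mkContinuous |c| fun f => ?_, hF⟩
  have h2 : |c| * ‖f‖ = ‖|c| • f‖ := by rw [norm_smul, Real.norm_eq_abs, abs_abs]
  rw [h2]
  refine norm_le_norm_Lp_two ?_
  filter_upwards [hc, hF f, Lp.coeFn_smul |c| f] with x h1 h2 h3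
  rw [h3, Pi.smul_apply, smul_eq_mul, abs_mul, abs_abs]
  change |F f x| ≤ _
  rw [h2, abs_mul]
  exact mul_le_mul_of_nonneg_right (h1.trans (le_abs_self c)) (abs_nonneg _)

namespace SymmDirichletForm

/-! ### The weighted energy estimate. -/

section Estimate

variable {X : Type*} [MetricSpace X] [MeasurableSpace X] {μ : Measure X} {𝓔 : SymmDirichletForm μ}
  {Γ : 𝓔.domain →ₗ[ℝ] 𝓔.domain →ₗ[ℝ] Lp ℝ 1 μ} {x₀ : X}
  {T : ℝ → Lp ℝ 2 μ →L[ℝ] Lp ℝ 2 μ}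

/-- The integrated maximum principle, tested against a cutoff function. -/
theorem IsSemigroup.abs_inner_sub_le (hT : 𝓔.IsSemigroup T) (hΓ : 𝓔.IsCarreDuChamp Γ)
    {Λ R a Y : ℝ} (hΛ : 0 ≤ Λ) {q : 𝓔.domain} (hq : IsWeight Γ x₀ Λ R a Y q) {φ : 𝓔.domain}
    (hφ : ∀ᵐ x ∂μ, Γ φ φ x = 0 ∨ q.1 x = 0) {f : Lp ℝ 2 μ} {c : ℝ} (hc : 0 < c)
    (hfc : ∀ᵐ x ∂μ, |f x| ≤ c) (hfR : ∀ᵐ x ∂μ, R ≤ dist x x₀ → f x = 0) {η t : ℝ} (hη : 0 < η)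
    (ht : 0 ≤ t) :
    |inner ℝ (T t f - f) φ.1| ≤
      η / 2 * Real.exp (Λ * t) * ‖f‖ ^ 2 + 𝓔.form φ φ / (2 * η * Y) * t := by
  obtain ⟨A, hA⟩ := exists_multiplication_operator (μ := μ) (m := fun x => Y + q.1 x) (c := Y)
    (aestronglyMeasurable_const.add (Lp.aestronglyMeasurable q.1)) (by
      filter_upwards [hq.lower, hq.upper] with x h1 h2
      rw [abs_of_nonneg (by linarith)]; linarith)
  have hAinner : ∀ u v : Lp ℝ 2 μ, inner ℝ u (A v) = ∫ x, (Y + q.1 x) * v x * u x ∂μ := by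
    intro u v
    rw [inner_Lp_two_eq_integral]
    refine integral_congr_ae ?_
    filter_upwards [hA v] with x hx
    rw [hx]; ring
  have hAsymm : ∀ u v : Lp ℝ 2 μ, inner ℝ u (A v) = inner ℝ v (A u) := by
    intro u v
    rw [hAinner, hAinner]
    refine integral_congr_ae (Eventually.of_forall fun x => ?_)
    simp only; ring
  have hAnonneg : ∀ u : Lp ℝ 2 μ, 0 ≤ inner ℝ u (A u) := by
    intro u
    rw [hAinner]
    refine integral_nonneg_of_ae ?_
    filter_upwards [hq.lower] with x hx
    simp only [Pi.zero_apply]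
    rw [mul_assoc]
    exact mul_nonneg (by linarith) (mul_self_nonneg _)
  have hAf : inner ℝ f (A f) = ‖f‖ ^ 2 := by
    rw [hAinner, norm_sq_Lp_two_eq_integral]
    refine integral_congr_ae ?_
    filter_upwards [hq.inner, hfR] with x h1 h2
    rcases lt_or_ge (dist x x₀) R with h | h
    · rw [h1 h]; ring
    · rw [h2 h]; ring
  set κ := 𝓔.form φ φ / (2 * η * Y)
  -- The function `σ (u_s, φ) + (η/2) exp(Λ(t - s)) ∫ w u_s²` has derivative at most `κ`: the
  -- dissipated weighted energy pays for `|𝓔(u, φ)|`. The sign `σ` gives the absolute value.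
  have key : ∀ σ : ℝ, |σ| = 1 → ∀ h : ℝ, 0 < h →
      σ * inner ℝ (avgOrbit T f h t) φ.1 ≤ σ * inner ℝ (avgOrbit T f h 0) φ.1 +
        η / 2 * Real.exp (Λ * t) * inner ℝ (avgOrbit T f h 0) (A (avgOrbit T f h 0)) + κ * t := by
    intro σ hσ h hh
    have hcu := hT.continuous_avgOrbit f h
    have hd1 : ∀ s, HasDerivAt (fun s => σ * inner ℝ (avgOrbit T f h s) φ.1 +
        η / 2 * Real.exp (Λ * (t - s)) * inner ℝ (avgOrbit T f h s) (A (avgOrbit T f h s)))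
        (σ * inner ℝ (h⁻¹ • (orbit T f (s + h) - orbit T f s)) φ.1 +
          η / 2 * Real.exp (Λ * (t - s)) *
            (2 * inner ℝ (h⁻¹ • (orbit T f (s + h) - orbit T f s)) (A (avgOrbit T f h s)) -
              Λ * inner ℝ (avgOrbit T f h s) (A (avgOrbit T f h s)))) s := by
      intro s
      have d1 := hT.hasDerivAt_avgOrbit f h s
      have d2 := (d1.inner ℝ (hasDerivAt_const s φ.1)).const_mul σ
      have d3 := d1.inner ℝ (A.hasFDerivAt.comp_hasDerivAt s d1)
      have d4 : HasDerivAt (fun s => η / 2 * Real.exp (Λ * (t - s)))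
          (η / 2 * (Real.exp (Λ * (t - s)) * (Λ * (-1)))) s :=
        ((((hasDerivAt_id s).const_sub t).const_mul Λ).exp).const_mul _
      refine (d2.add (d4.mul d3)).congr_deriv ?_
      simp only [inner_zero_right, zero_add, Function.comp_apply]
      rw [hAsymm (avgOrbit T f h s) (h⁻¹ • (orbit T f (s + h) - orbit T f s))]
      ring
    have := image_le_of_deriv_right_le_deriv_boundary (a := 0) (b := t)
      (f := fun s => σ * inner ℝ (avgOrbit T f h s) φ.1 +
        η / 2 * Real.exp (Λ * (t - s)) * inner ℝ (avgOrbit T f h s) (A (avgOrbit T f h s)))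
      (B := fun s => σ * inner ℝ (avgOrbit T f h 0) φ.1 +
        η / 2 * Real.exp (Λ * t) * inner ℝ (avgOrbit T f h 0) (A (avgOrbit T f h 0)) + κ * s)
      (B' := fun _ => κ)
      (fun s _ => (hd1 s).continuousAt.continuousWithinAt)
      (fun s _ => (hd1 s).hasDerivWithinAt) (by simp) (by fun_prop)
      (fun s _ => by
        have := ((hasDerivAt_id s).const_mul κ).const_add (σ * inner ℝ (avgOrbit T f h 0) φ.1 +
          η / 2 * Real.exp (Λ * t) * inner ℝ (avgOrbit T f h 0) (A (avgOrbit T f h 0)))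
        simpa using this.hasDerivWithinAt)
      ?_ (show t ∈ Set.Icc 0 t from ⟨ht, le_rfl⟩)
    · simp only [sub_self, mul_zero, Real.exp_zero, mul_one] at this
      have h3 := hAnonneg (avgOrbit T f h t)
      have h4 : 0 ≤ η / 2 * inner ℝ (avgOrbit T f h t) (A (avgOrbit T f h t)) := by positivity
      linarith
    · intro s hs
      obtain ⟨m1, e1⟩ := hT.isGenerator_avgOrbit f hh.le hs.1
      set u : 𝓔.domain := ⟨_, m1⟩
      -- Boundedness of `f` passes to `u`, as the Leibniz rule requires.
      have hub : 𝓔.IsBdd u := ⟨c, hT.abs_avgOrbit_le hc hh hfc⟩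
      obtain ⟨p, hp, -⟩ := 𝓔.exists_mul hub hq.isBdd
      have hU : (Y • u + p).1 = A (avgOrbit T f h s) := by
        apply Lp.ext
        filter_upwards [hp, hA (avgOrbit T f h s), 𝓔.coeFn_domain_add (Y • u) p,
          𝓔.coeFn_domain_smul Y u] with x h1 h2 h3 h4
        rw [h3, h4, h1, h2]
        simp only [u]; ring
      have e2 := e1 (Y • u + p)
      have e3 := e1 φ
      have e4 := integral_weight_mul_carre_le hΓ hΛ hq (u := u) (U := Y • u + p) hub (by
        rw [hU]; exact hA _)
      have e5 := abs_form_cutoff_le hΓ hq u φ hφ hη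
      have e6 : ∫ x, (Y + q.1 x) * u.1 x * u.1 x ∂μ =
          inner ℝ (avgOrbit T f h s) (A (avgOrbit T f h s)) := (hAinner _ _).symm
      have e7 : 0 ≤ ∫ x, (Y + q.1 x) * Γ u u x ∂μ := by
        refine integral_nonneg_of_ae ?_
        filter_upwards [hq.lower, hΓ.nonneg u] with x h1 h2
        exact mul_nonneg (by linarith) h2
      rw [e6, e2, hU] at e4
      have e8 : σ * inner ℝ (h⁻¹ • (orbit T f (s + h) - orbit T f s)) φ.1 ≤ |𝓔.form u φ| := by
        refine (le_abs_self _).trans ?_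
        rw [abs_mul, hσ, one_mul, e3, abs_neg]
      have e9 : 1 ≤ Real.exp (Λ * (t - s)) :=
        Real.one_le_exp (mul_nonneg hΛ (sub_nonneg.2 hs.2.le))
      have e10 : η / 2 * Real.exp (Λ * (t - s)) *
          (2 * inner ℝ (h⁻¹ • (orbit T f (s + h) - orbit T f s)) (A (avgOrbit T f h s)) -
            Λ * inner ℝ (avgOrbit T f h s) (A (avgOrbit T f h s))) ≤
          η / 2 * Real.exp (Λ * (t - s)) * (-∫ x, (Y + q.1 x) * Γ u u x ∂μ) := by
        gcongr
        linarith
      have e11 : η / 2 * (∫ x, (Y + q.1 x) * Γ u u x ∂μ) ≤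
          η / 2 * Real.exp (Λ * (t - s)) * (∫ x, (Y + q.1 x) * Γ u u x ∂μ) := by
        rw [mul_assoc]
        gcongr
        nlinarith
      linarith
  have lim0 := hT.tendsto_avgOrbit f
  have limt := ((T t).continuous.tendsto _).comp lim0
  have key2 : ∀ σ : ℝ, |σ| = 1 → σ * inner ℝ (T t f) φ.1 ≤ σ * inner ℝ f φ.1 +
      η / 2 * Real.exp (Λ * t) * ‖f‖ ^ 2 + κ * t := by
    intro σ hσ
    rw [← hAf]
    refine le_of_tendsto_of_tendsto' ((limt.inner tendsto_const_nhds).const_mul σ)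
      ((((lim0.inner tendsto_const_nhds).const_mul σ).add ((lim0.inner
        ((A.continuous.tendsto _).comp lim0)).const_mul _)).add_const _) fun n => ?_
    have := key σ hσ (1 / ((n : ℝ) + 1)) (by positivity)
    rw [Function.comp_apply, hT.apply_avgOrbit f (by positivity) le_rfl ht, zero_add]
    exact this
  rw [inner_sub_left, _root_.abs_le]
  constructor
  · have := key2 (-1) (by norm_num); linarith
  · have := key2 1 (by norm_num); linarith

end Estimate

/-! ### Conservation of mass and its equivalence with the pointwise limit by duality. -/

section Mass

variable {X : Type*} [MetricSpace X] [MeasurableSpace X] [BorelSpace X] {μ : Measure X}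
  {𝓔 : SymmDirichletForm μ} {T : ℝ → Lp ℝ 2 μ →L[ℝ] Lp ℝ 2 μ} {x₀ : X}

/-- Symmetry moves `T t` onto the indicator of a ball, where it stays at most 1; then the balls
exhaust the space. -/
theorem IsSemigroup.integral_apply_le (hT : 𝓔.IsSemigroup T)
    (hμ : ∀ r : ℝ, μ (Metric.ball x₀ r) ≠ ∞) {t : ℝ} (ht : 0 ≤ t) {f : Lp ℝ 2 μ}
    (hf : ∀ᵐ x ∂μ, 0 ≤ f x) (hfi : Integrable f μ) :
    Integrable (T t f) μ ∧ ∫ x, T t f x ∂μ ≤ ∫ x, f x ∂μ := by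
  have hT0 := hT.nonneg_of_nonneg ht hf
  have hcov : AECover μ atTop (fun n : ℕ => Metric.ball x₀ (n : ℝ)) :=
    aecover_ball tendsto_natCast_atTop_atTop
  have hset : ∀ n : ℕ, ∫ x in Metric.ball x₀ (n : ℝ), T t f x ∂μ ≤ ∫ x, f x ∂μ := by
    intro n
    rw [← L2.inner_indicatorConstLp_one (𝕜 := ℝ) Metric.isOpen_ball.measurableSet (hμ n) (T t f),
      real_inner_comm, hT.inner_apply_left ht, inner_Lp_two_eq_integral]
    set g := indicatorConstLp 2 Metric.isOpen_ball.measurableSet (hμ n) (1 : ℝ)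
    refine integral_mono_ae (integrable_mul_Lp_two _ _) hfi ?_
    filter_upwards [hf, hT.le_of_le ht one_pos (f := g) (by
      filter_upwards [indicatorConstLp_coeFn (p := 2) (hs := Metric.isOpen_ball.measurableSet)
        (hμs := hμ n) (c := (1 : ℝ))] with x hx
      rw [hx]
      exact Set.indicator_le_self' (fun _ _ => zero_le_one) x)] with x h1 h2
    exact mul_le_of_le_one_right h1 h2
  have hint : Integrable (T t f) μ := by
    refine hcov.integrable_of_integral_norm_bounded (∫ x, f x ∂μ)
      (fun n => integrableOn_Lp_of_measure_ne_top _ fact_one_le_two_ennreal.elim (hμ n))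
      (Eventually.of_forall fun n => ?_)
    refine le_trans (le_of_eq ?_) (hset n)
    refine integral_congr_ae (ae_restrict_of_ae ?_)
    filter_upwards [hT0] with x hx
    rw [Real.norm_of_nonneg hx]
  exact ⟨hint, le_of_tendsto' (hcov.integral_tendsto_of_countably_generated hint) hset⟩

/-- `T` preserves the integral of nonnegative integrable functions. -/
def PreservesIntegral (S : Lp ℝ 2 μ →L[ℝ] Lp ℝ 2 μ) : Prop :=
  ∀ f : Lp ℝ 2 μ, (∀ᵐ x ∂μ, 0 ≤ f x) → Integrable f μ → ∫ x, S f x ∂μ = ∫ x, f x ∂μ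

/-- Cutting `f` in height and in space gives `F n ≤ f` with `∫ F n → ∫ f` and `∫ F n = ∫ T t (F n) ≤
∫ T t f`. -/
theorem IsSemigroup.preservesIntegral_of_bounded (hT : 𝓔.IsSemigroup T)
    (hμ : ∀ r : ℝ, μ (Metric.ball x₀ r) ≠ ∞) {t : ℝ} (ht : 0 ≤ t)
    (h : ∀ (f : Lp ℝ 2 μ) (c R : ℝ), 0 < c → 0 < R → (∀ᵐ x ∂μ, 0 ≤ f x) →
      (∀ᵐ x ∂μ, |f x| ≤ c) → (∀ᵐ x ∂μ, R ≤ dist x x₀ → f x = 0) → Integrable f μ →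
      ∫ x, T t f x ∂μ = ∫ x, f x ∂μ) : PreservesIntegral (T t) := by
  intro f hf hfi
  refine le_antisymm (hT.integral_apply_le hμ ht hf hfi).2 ?_
  let g : ℕ → X → ℝ := fun n => (Metric.ball x₀ ((n : ℝ) + 1)).indicator
    fun x => min (max (f x) 0) ((n : ℝ) + 1)
  have hg0 : ∀ n x, 0 ≤ g n x := fun n x =>
    Set.indicator_nonneg (fun x _ => le_min (le_max_right _ _) (by positivity)) x
  have hgn : ∀ n x, g n x ≤ (n : ℝ) + 1 := fun n x =>
    Set.indicator_apply_le' (fun _ => min_le_right _ _) (fun _ => by positivity)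
  have hgf : ∀ n, ∀ᵐ x ∂μ, g n x ≤ f x := by
    intro n
    filter_upwards [hf] with x hx
    exact Set.indicator_apply_le' (fun _ => (min_le_left _ _).trans (max_eq_left hx).le)
      (fun _ => hx)
  have hgm : ∀ n, AEStronglyMeasurable (g n) μ := fun n =>
    (((Lp.aestronglyMeasurable f).sup aestronglyMeasurable_const).inf
      aestronglyMeasurable_const).indicator Metric.isOpen_ball.measurableSet
  have hgi : ∀ n, Integrable (g n) μ := fun n => hfi.mono (hgm n) (by
    filter_upwards [hgf n, hf] with x h1 h2
    rwa [Real.norm_of_nonneg (hg0 n x), Real.norm_of_nonneg h2])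
  choose F hF using fun n => exists_Lp_two_of_le (hgm n) f (by
    filter_upwards [hgf n, hf] with x h1 h2
    rwa [abs_of_nonneg (hg0 n x), abs_of_nonneg h2])
  have hlim : Tendsto (fun n => ∫ x, g n x ∂μ) atTop (𝓝 (∫ x, f x ∂μ)) := by
    refine tendsto_integral_of_dominated_convergence (fun x => f x) hgm hfi (fun n => ?_) ?_
    · filter_upwards [hgf n] with x h1
      rwa [Real.norm_of_nonneg (hg0 n x)]
    · filter_upwards [hf] with x hx
      refine tendsto_const_nhds.congr' ?_
      obtain ⟨N, hN⟩ := exists_nat_ge (max (f x) (dist x x₀))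
      filter_upwards [eventually_ge_atTop N] with n hn
      have hn' : (N : ℝ) ≤ n := by exact_mod_cast hn
      have h1 := (le_max_left _ _).trans hN
      have h2 := (le_max_right _ _).trans hN
      simp only [g]
      rw [Set.indicator_of_mem (by rw [Metric.mem_ball]; linarith), max_eq_left hx, min_eq_left]
      linarith
  refine le_of_tendsto' hlim fun n => ?_
  have hFf : ∀ᵐ x ∂μ, F n x ≤ f x := by
    filter_upwards [hF n, hgf n] with x h1 h2
    rwa [h1]
  have hF0 : ∀ᵐ x ∂μ, 0 ≤ F n x := by
    filter_upwards [hF n] with x h1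
    rw [h1]; exact hg0 n x
  have hFi : Integrable (F n) μ := (hgi n).congr (hF n).symm
  calc ∫ x, g n x ∂μ = ∫ x, F n x ∂μ := integral_congr_ae (hF n).symm
    _ = ∫ x, T t (F n) x ∂μ := by
        refine (h (F n) (n + 1) (n + 1) (by positivity) (by positivity) hF0 ?_ ?_ hFi).symm
        · filter_upwards [hF n] with x h1
          rw [h1, abs_of_nonneg (hg0 n x)]; exact hgn n x
        · filter_upwards [hF n] with x h1 h2
          rw [h1]
          exact Set.indicator_of_notMem (fun hx => absurd h2 (not_le.2 hx)) _
    _ ≤ ∫ x, T t f x ∂μ := integral_mono_ae (hT.integral_apply_le hμ ht hF0 hFi).1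
        (hT.integral_apply_le hμ ht hf hfi).1 (hT.mono ht hFf)

theorem IsSemigroup.preservesIntegral_add (hT : 𝓔.IsSemigroup T)
    (hμ : ∀ r : ℝ, μ (Metric.ball x₀ r) ≠ ∞) {s t : ℝ} (hs : 0 ≤ s) (ht : 0 ≤ t)
    (h1 : PreservesIntegral (T s)) (h2 : PreservesIntegral (T t)) :
    PreservesIntegral (T (s + t)) := by
  intro f hf hfi
  rw [hT.apply_add hs ht, h1 (T t f) (hT.nonneg_of_nonneg ht hf)
    (hT.integral_apply_le hμ ht hf hfi).1, h2 f hf hfi]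

/-- Splits `t` into equal steps of length at most `t₀`; this serves the growth regimes in which `Λ`
grows with the radius. -/
theorem IsSemigroup.preservesIntegral_of_small (hT : 𝓔.IsSemigroup T)
    (hμ : ∀ r : ℝ, μ (Metric.ball x₀ r) ≠ ∞) {t₀ : ℝ} (ht₀ : 0 < t₀)
    (h : ∀ t, 0 < t → t ≤ t₀ → PreservesIntegral (T t)) {t : ℝ} (ht : 0 < t) :
    PreservesIntegral (T t) := by
  obtain ⟨n, hn⟩ := exists_nat_ge (t / t₀)
  have hn0 : (0 : ℝ) < n := (div_pos ht ht₀).trans_le hn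
  have hmul : ∀ k : ℕ, PreservesIntegral (T ((k + 1) * (t / n))) := by
    intro k
    induction k with
    | zero =>
      have : t / n ≤ t₀ := by
        rw [div_le_iff₀ hn0]
        rw [div_le_iff₀ ht₀] at hn
        linarith
      simpa using h (t / n) (by positivity) this
    | succ k ih =>
      have e : (((k + 1 : ℕ) : ℝ) + 1) * (t / n) = (k + 1) * (t / n) + (0 + 1) * (t / n) := by
        push_cast; ring
      rw [e]
      refine hT.preservesIntegral_add hμ (by positivity) (by positivity) ih ?_
      have : t / n ≤ t₀ := by
        rw [div_le_iff₀ hn0]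
        rw [div_le_iff₀ ht₀] at hn
        linarith
      simpa using h (t / n) (by positivity) this
  obtain ⟨m, rfl⟩ : ∃ m : ℕ, n = m + 1 := Nat.exists_eq_succ_of_ne_zero (by
    rintro rfl; simp at hn0)
  have := hmul m
  have e : ((m : ℝ) + 1) * (t / ((m + 1 : ℕ) : ℝ)) = t := by push_cast; field_simp
  rwa [e] at this

/-- For `g` the indicator of a ball `B`, symmetry and conservation of mass give `∫_B (1 - T t (f n))
= ∫ (1 - f n) T t g → 0`. The left integrand is nonnegative and decreasing in `n`, so its infimum
vanishes almost everywhere on `B`. -/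
theorem IsSemigroup.isConservative (hT : 𝓔.IsSemigroup T)
    (hμ : ∀ r : ℝ, μ (Metric.ball x₀ r) ≠ ∞) (h : ∀ t > 0, PreservesIntegral (T t)) :
    IsConservative T := by
  intro t ht f _ hmono hlim
  have hfle : ∀ᵐ x ∂μ, ∀ n, f n x ≤ 1 := by
    filter_upwards [hmono, hlim] with x h1 h2 n
    exact h1.ge_of_tendsto h2 n
  have hTle : ∀ᵐ x ∂μ, ∀ n, T t (f n) x ≤ 1 := ae_all_iff.2 fun n =>
    hT.le_of_le ht.le one_pos (by filter_upwards [hfle] with x hx using hx n)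
  have hTmono : ∀ᵐ x ∂μ, Monotone fun n => T t (f n) x := by
    have : ∀ᵐ x ∂μ, ∀ n, T t (f n) x ≤ T t (f (n + 1)) x := ae_all_iff.2 fun n =>
      hT.mono ht.le (by filter_upwards [hmono] with x hx using hx n.le_succ)
    filter_upwards [this] with x hx using monotone_nat_of_le_succ hx
  have hball : ∀ k : ℕ, ∀ᵐ x ∂μ, x ∈ Metric.ball x₀ (k : ℝ) →
      ⨅ n, ENNReal.ofReal (1 - T t (f n) x) = 0 := by
    intro k
    have hms : MeasurableSet (Metric.ball x₀ (k : ℝ)) := Metric.isOpen_ball.measurableSet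
    set g := indicatorConstLp 2 hms (hμ k) (1 : ℝ) with hg
    have hgx := indicatorConstLp_coeFn (p := 2) (hs := hms) (hμs := hμ k) (c := (1 : ℝ))
    have hg0 : ∀ᵐ x ∂μ, 0 ≤ g x := by
      filter_upwards [hgx] with x hx
      rw [hx]; exact Set.indicator_nonneg (fun _ _ => zero_le_one) x
    have hgi : Integrable g μ := integrable_indicatorConstLp hms (hμ k) _
    obtain ⟨hTgi, -⟩ := hT.integral_apply_le hμ ht.le hg0 hgi
    have hTg := h t ht g hg0 hgi
    have hTg0 := hT.nonneg_of_nonneg ht.le hg0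
    have hTfi : ∀ n, IntegrableOn (T t (f n)) (Metric.ball x₀ (k : ℝ)) μ := fun n =>
      integrableOn_Lp_of_measure_ne_top _ fact_one_le_two_ennreal.elim (hμ k)
    have hone : IntegrableOn (fun _ => (1 : ℝ)) (Metric.ball x₀ (k : ℝ)) μ :=
      integrableOn_const (hμ k)
    have heq : ∀ n, ∫ x in Metric.ball x₀ (k : ℝ), (1 - T t (f n) x) ∂μ =
        ∫ x, (1 - f n x) * T t g x ∂μ := by
      intro n
      have i1 : ∫ x in Metric.ball x₀ (k : ℝ), T t (f n) x ∂μ = ∫ x, f n x * T t g x ∂μ := by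
        rw [← L2.inner_indicatorConstLp_one (𝕜 := ℝ) hms (hμ k) (T t (f n)), real_inner_comm,
          hT.inner_apply_left ht.le, inner_Lp_two_eq_integral]
      have i2 : ∫ _x in Metric.ball x₀ (k : ℝ), (1 : ℝ) ∂μ = ∫ x, g x ∂μ := by
        rw [← integral_indicator hms]
        exact integral_congr_ae hgx.symm
      rw [integral_sub hone (hTfi n), i1, i2, ← hTg,
        ← integral_sub hTgi (integrable_mul_Lp_two _ _)]
      simp only [sub_mul, one_mul]
    have hto : Tendsto (fun n => ∫ x, (1 - f n x) * T t g x ∂μ) atTop (𝓝 0) := by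
      have h0 : (0 : ℝ) = ∫ _x : X, (0 : ℝ) ∂μ := by simp
      rw [h0]
      refine tendsto_integral_of_dominated_convergence (fun x => (1 - f 0 x) * T t g x) ?_ ?_ ?_ ?_
      · exact fun n => (aestronglyMeasurable_const.sub (Lp.aestronglyMeasurable (f n))).mul
          (Lp.aestronglyMeasurable _)
      · simp only [sub_mul, one_mul]
        exact hTgi.sub (integrable_mul_Lp_two _ _)
      · intro n
        filter_upwards [hmono, hfle, hTg0] with x h1 h2 h3
        have h4 : f 0 x ≤ f n x := h1 (Nat.zero_le n)
        rw [Real.norm_of_nonneg (mul_nonneg (by linarith [h2 n]) h3)]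
        gcongr
      · filter_upwards [hlim] with x hx
        have := (hx.const_sub 1).mul_const (T t g x)
        simpa using this
    simp_rw [← heq] at hto
    have hmeas : ∀ n, AEMeasurable (fun x => ENNReal.ofReal (1 - T t (f n) x))
        (μ.restrict (Metric.ball x₀ (k : ℝ))) := fun n =>
      ((aemeasurable_const.sub (Lp.aestronglyMeasurable (T t (f n))).aemeasurable).ennreal_ofReal
        ).restrict
    have hzero : ∫⁻ x in Metric.ball x₀ (k : ℝ), ⨅ n, ENNReal.ofReal (1 - T t (f n) x) ∂μ = 0 := by
      have hto' := ENNReal.tendsto_ofReal hto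
      rw [ENNReal.ofReal_zero] at hto'
      refine le_antisymm (ge_of_tendsto' hto' fun n => ?_) bot_le
      rw [ofReal_integral_eq_lintegral_ofReal (f := fun x => 1 - T t (f n) x)
        (hone.sub (hTfi n))
        (ae_restrict_of_ae (by filter_upwards [hTle] with x hx using sub_nonneg.2 (hx n)))]
      exact lintegral_mono fun x => iInf_le _ n
    rw [lintegral_eq_zero_iff' (AEMeasurable.iInf hmeas)] at hzero
    exact (ae_restrict_iff' hms).1 hzero
  filter_upwards [ae_all_iff.2 hball, hTle, hTmono] with x h1 h2 h3
  obtain ⟨k, hk⟩ := exists_nat_gt (dist x x₀)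
  have hinf := h1 k hk
  refine tendsto_order.2 ⟨fun a ha => ?_, fun a ha => Eventually.of_forall fun n =>
    (h2 n).trans_lt ha⟩
  have : ⨅ n, ENNReal.ofReal (1 - T t (f n) x) < ENNReal.ofReal (1 - a) := by
    rw [hinf]; exact ENNReal.ofReal_pos.2 (by linarith)
  obtain ⟨n, hn⟩ := iInf_lt_iff.1 this
  have hn' := (ENNReal.ofReal_lt_ofReal_iff (by linarith)).1 hn
  filter_upwards [eventually_ge_atTop n] with m hm
  have : T t (f n) x ≤ T t (f m) x := h3 hm
  linarith

end Mass

end SymmDirichletForm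

namespace SymmDirichletForm

/-! ### From weights and cutoffs to conservation of mass. -/

section Criterion

variable {X : Type*} [MetricSpace X] [LocallyCompactSpace X] [SecondCountableTopology X]
  [MeasurableSpace X] [BorelSpace X] {μ : Measure X} [IsFiniteMeasureOnCompacts μ]
  {𝓔 : SymmDirichletForm μ} {Γ : 𝓔.domain →ₗ[ℝ] 𝓔.domain →ₗ[ℝ] Lp ℝ 1 μ}
  {T : ℝ → Lp ℝ 2 μ →L[ℝ] Lp ℝ 2 μ} {x₀ : X}

theorem measure_ball_ne_top (hball : ∀ r > 0, IsCompact (closure (Metric.ball x₀ r))) (r : ℝ) :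
    μ (Metric.ball x₀ r) ≠ ∞ := by
  rcases le_or_gt r 0 with h | h
  · rw [Metric.ball_eq_empty.2 h]; simp
  · exact ((measure_mono subset_closure).trans_lt (hball r h).measure_lt_top).ne

theorem IsWeight.mono {Λ R R' a a' Y : ℝ} {q : 𝓔.domain} (hq : IsWeight Γ x₀ Λ R' a Y q)
    (hR : R ≤ R') (ha : a ≤ a') : IsWeight Γ x₀ Λ R a' Y q where
  one_le := hq.one_le
  lower := hq.lower
  upper := hq.upper
  inner := by filter_upwards [hq.inner] with x h1 h2 using h1 (h2.trans_le hR)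
  outer := by filter_upwards [hq.outer] with x h1 h2 using h1 (ha.trans_lt h2)
  energy := hq.energy

/-- Starts from the constant weight 1 and adds one shell `a i < d < a (i + 1)` at a time, the outer
value rising from `Y i` to `Y (i + 1)`. -/
theorem exists_isWeight_chain (hΓ : 𝓔.IsCarreDuChamp Γ) (hreg : 𝓔.IsRegular)
    (hloc : 𝓔.IsStronglyLocal) (hd : 𝓔.MemLoc fun x => dist x x₀)
    (hball : ∀ r > 0, IsCompact (closure (Metric.ball x₀ r))) {Λ R : ℝ} (hΛ : 0 ≤ Λ)
    {a Y : ℕ → ℝ} (ha : StrictMono a) (hY : Monotone Y) (hY0 : Y 0 = 1) (hR : R ≤ a 0)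
    (ha0 : 0 < a 0) (k : ℕ)
    (he : ∀ i < k, ∀ᵐ x ∂μ, a i < dist x x₀ → dist x x₀ < a (i + 1) →
      (2 * (Y (i + 1) - Y i) / (a (i + 1) - a i)) ^ 2 *
        𝓔.energyLoc Γ (fun y => dist y x₀) x ≤ Λ * Y i ^ 2) :
    ∃ q : 𝓔.domain, IsWeight Γ x₀ Λ R (a k) (Y k) q := by
  induction k with
  | zero => exact ⟨0, by rw [hY0]; exact isWeight_zero hΛ⟩
  | succ k ih =>
    obtain ⟨q, hq⟩ := ih fun i hi => he i (hi.trans k.lt_succ_self)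
    have h0 := ha.monotone (Nat.zero_le k)
    exact hq.exists_extend hΓ hreg hloc hd hball hΛ (hR.trans h0) (ha0.trans_le h0)
      (ha k.lt_succ_self) (hY k.le_succ) (he k k.lt_succ_self)

/-- The mass defect is `(T t f - f, φ)` up to the `L¹` tail of `T t f - f` outside radius `2n`. The
choice `η = ε exp(-Λt)` balances the two terms of `abs_inner_sub_le`. -/
theorem IsSemigroup.integral_apply_eq (hT : 𝓔.IsSemigroup T) (hΓ : 𝓔.IsCarreDuChamp Γ)
    (hμ : ∀ r : ℝ, μ (Metric.ball x₀ r) ≠ ∞) {t : ℝ} (ht : 0 ≤ t) {f : Lp ℝ 2 μ} {c R : ℝ}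
    (hc : 0 < c) (hf : ∀ᵐ x ∂μ, 0 ≤ f x) (hfc : ∀ᵐ x ∂μ, |f x| ≤ c)
    (hfR : ∀ᵐ x ∂μ, R ≤ dist x x₀ → f x = 0) (hfi : Integrable f μ)
    (h : ∀ ε > 0, ∀ᶠ n : ℕ in atTop, ∃ (Λ Y : ℝ) (q φ : 𝓔.domain), 0 ≤ Λ ∧
      IsWeight Γ x₀ Λ R (2 * n) Y q ∧ (∀ᵐ x ∂μ, dist x x₀ ≤ 2 * n → φ.1 x = 1) ∧
      (∀ᵐ x ∂μ, 0 ≤ φ.1 x ∧ φ.1 x ≤ 1) ∧ (∀ᵐ x ∂μ, Γ φ φ x = 0 ∨ 2 * n < dist x x₀) ∧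
      Real.exp (Λ * t) * 𝓔.form φ φ / Y ≤ ε) :
    ∫ x, T t f x ∂μ = ∫ x, f x ∂μ := by
  obtain ⟨hTi, -⟩ := hT.integral_apply_le hμ ht hf hfi
  have hgi : Integrable (T t f - f : Lp ℝ 2 μ) μ :=
    (hTi.sub hfi).congr (Lp.coeFn_sub (T t f) f).symm
  have hgint : ∫ x, (T t f - f : Lp ℝ 2 μ) x ∂μ = (∫ x, T t f x ∂μ) - ∫ x, f x ∂μ := by
    rw [← integral_sub hTi hfi]
    exact integral_congr_ae (Lp.coeFn_sub (T t f) f)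
  set g : Lp ℝ 2 μ := T t f - f with hg
  have htail : Tendsto (fun n : ℕ => (∫ x, |g x| ∂μ) -
      ∫ x in Metric.ball x₀ (2 * (n : ℝ)), |g x| ∂μ) atTop (𝓝 0) := by
    have hcov : AECover μ atTop (fun n : ℕ => Metric.ball x₀ (2 * (n : ℝ))) :=
      aecover_ball (tendsto_natCast_atTop_atTop.const_mul_atTop two_pos)
    simpa using (hcov.integral_tendsto_of_countably_generated hgi.abs).const_sub
      (∫ x, |g x| ∂μ)
  have hbound : ∀ ε > 0, |∫ x, g x ∂μ| ≤ ε * ((‖f‖ ^ 2 + t) / 2 + 1) := by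
    intro ε hε
    obtain ⟨n, ⟨Λ, Y, q, φ, hΛ, hq, hφ1, hφ01, hφΓ, hle⟩, hn⟩ :=
      ((h (ε ^ 2) (by positivity)).and (htail.eventually (gt_mem_nhds hε))).exists
    have hY : 0 < Y := one_pos.trans_le hq.one_le
    have h1 := hT.abs_inner_sub_le hΓ hΛ hq (φ := φ) (by
      filter_upwards [hφΓ, hq.outer] with x h1 h2
      exact h1.imp_right h2) hc hfc hfR (η := ε * Real.exp (-(Λ * t))) (by positivity) ht
    have h2 : |inner ℝ g φ.1| ≤ ε * ((‖f‖ ^ 2 + t) / 2) := by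
      refine h1.trans ?_
      have e1 : Real.exp (-(Λ * t)) * Real.exp (Λ * t) = 1 := by
        rw [← Real.exp_add, neg_add_cancel, Real.exp_zero]
      have e2 : ε * Real.exp (-(Λ * t)) / 2 * Real.exp (Λ * t) * ‖f‖ ^ 2 = ε / 2 * ‖f‖ ^ 2 := by
        calc _ = ε / 2 * ‖f‖ ^ 2 * (Real.exp (-(Λ * t)) * Real.exp (Λ * t)) := by ring
          _ = _ := by rw [e1, mul_one]
      have e3 : 𝓔.form φ φ / (2 * (ε * Real.exp (-(Λ * t))) * Y) =
          (Real.exp (Λ * t) * 𝓔.form φ φ / Y) / (2 * ε) := by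
        rw [Real.exp_neg]; field_simp
      have e4 : (Real.exp (Λ * t) * 𝓔.form φ φ / Y) / (2 * ε) ≤ ε / 2 := by
        rw [div_le_iff₀ (by positivity)]
        refine hle.trans (le_of_eq ?_)
        ring
      rw [e2, e3]
      have e5 := mul_le_mul_of_nonneg_right e4 ht
      linarith
    have i1 := integrable_mul_Lp_two g φ.1
    have h3 : ∫ x, g x ∂μ = inner ℝ g φ.1 + ∫ x, (g x - g x * φ.1 x) ∂μ := by
      rw [inner_Lp_two_eq_integral, integral_sub hgi i1]; ring
    have h4 : |∫ x, (g x - g x * φ.1 x) ∂μ| ≤ ε := by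
      refine le_trans ?_ hn.le
      have e1 : (∫ x, |g x| ∂μ) - ∫ x in Metric.ball x₀ (2 * (n : ℝ)), |g x| ∂μ =
          ∫ x in (Metric.ball x₀ (2 * (n : ℝ)))ᶜ, |g x| ∂μ := by
        rw [← integral_add_compl Metric.isOpen_ball.measurableSet hgi.abs, add_sub_cancel_left]
      rw [e1, ← integral_indicator Metric.isOpen_ball.measurableSet.compl]
      refine abs_integral_le_integral_abs.trans (integral_mono_ae (hgi.sub i1).abs
        (hgi.abs.indicator Metric.isOpen_ball.measurableSet.compl) ?_)
      filter_upwards [hφ1, hφ01] with x h5 h6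
      by_cases hx : x ∈ Metric.ball x₀ (2 * (n : ℝ))
      · have : dist x x₀ ≤ 2 * n := le_of_lt hx
        rw [Set.indicator_of_notMem (by simpa using hx), h5 this]
        simp
      · rw [Set.indicator_of_mem (by simpa using hx)]
        have : g x - g x * φ.1 x = g x * (1 - φ.1 x) := by ring
        rw [this, abs_mul, abs_of_nonneg (a := 1 - φ.1 x) (by linarith [h6.2])]
        exact mul_le_of_le_one_right (abs_nonneg _) (by linarith [h6.1])
    rw [h3]
    refine (abs_add_le _ _).trans ?_
    linarith
  have hC : 0 < (‖f‖ ^ 2 + t) / 2 + 1 := by positivity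
  have hz : |∫ x, g x ∂μ| ≤ 0 := by
    refine le_of_forall_pos_le_add fun ε hε => ?_
    have := hbound (ε / ((‖f‖ ^ 2 + t) / 2 + 1)) (by positivity)
    rwa [div_mul_cancel₀ _ hC.ne', ← zero_add ε] at this
  have hz' := abs_nonpos_iff.1 hz
  linarith

/-- If the weights grow sufficiently fast compared to the energies of the cutoff functions, the
semigroup preserves integrals. -/
theorem IsSemigroup.preservesIntegral_of_weights (hT : 𝓔.IsSemigroup T)
    (hΓ : 𝓔.IsCarreDuChamp Γ) (hreg : 𝓔.IsRegular)
    (hloc : 𝓔.IsStronglyLocal) (hd : 𝓔.MemLoc fun x => dist x x₀)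
    (hball : ∀ r > 0, IsCompact (closure (Metric.ball x₀ r))) {t : ℝ} (ht : 0 ≤ t)
    {b V : ℕ → ℝ} (hb0 : ∀ n, 0 ≤ b n) (hV0 : ∀ n, 0 ≤ V n)
    (hb : ∀ᶠ n : ℕ in atTop, ∀ᵐ x ∂μ, 2 * n < dist x x₀ → dist x x₀ < 4 * n →
      𝓔.energyLoc Γ (fun y => dist y x₀) x ≤ b n)
    (hV : ∀ᶠ n : ℕ in atTop, μ (Metric.ball x₀ (4 * n) \ Metric.ball x₀ (2 * n)) ≤
      ENNReal.ofReal (V n))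
    {R₁ : ℝ} (h : ∀ R, R₁ ≤ R → ∃ Λ Y : ℕ → ℝ, (∀ᶠ n : ℕ in atTop, 0 ≤ Λ n ∧
      ∃ q, IsWeight Γ x₀ (Λ n) R (2 * n) (Y n) q) ∧
      Tendsto (fun n : ℕ => Real.exp (Λ n * t) * (b n / n ^ 2 * V n) / Y n) atTop (𝓝 0)) :
    PreservesIntegral (T t) := by
  refine hT.preservesIntegral_of_bounded (measure_ball_ne_top hball) ht
    fun f c R hc _ hf hfc hfR hfi => ?_
  obtain ⟨Λ, Y, hw, hlim⟩ := h (max R R₁) (le_max_right _ _)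
  refine hT.integral_apply_eq hΓ (measure_ball_ne_top hball) ht hc hf hfc hfR hfi fun ε hε => ?_
  filter_upwards [hw, hlim.eventually (gt_mem_nhds hε), hb, hV, eventually_gt_atTop 0] with
    n hn hnε hbn hVn hn0
  obtain ⟨hΛ, q, hq⟩ := hn
  have hn0' : (0 : ℝ) < n := by exact_mod_cast hn0
  obtain ⟨φ, h1, h2, h3, h4⟩ := form_radial_cutoff_le hΓ hreg hloc hd hball (a := 2 * (n : ℝ))
    (b := 4 * n) (B := b n) (by linarith) (by linarith) (hb0 n) hbn
  have hY : 0 < Y n := one_pos.trans_le hq.one_le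
  refine ⟨Λ n, Y n, q, φ, hΛ, hq.mono (le_max_left _ _) le_rfl, h1, h2, h3, le_trans ?_ hnε.le⟩
  have hVr : μ.real (Metric.ball x₀ (4 * n) \ Metric.ball x₀ (2 * n)) ≤ V n :=
    ENNReal.toReal_le_of_le_ofReal (hV0 n) hVn
  gcongr
  refine h4.trans ?_
  have e : (2 / (4 * (n : ℝ) - 2 * n)) ^ 2 * b n = b n / n ^ 2 := by
    field_simp; ring
  rw [e]
  have := hb0 n
  gcongr

end Criterion

end SymmDirichletForm

namespace SymmDirichletForm

/-! ### The three growth regimes. -/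

section Growth

variable {X : Type*} [MetricSpace X] [LocallyCompactSpace X] [SecondCountableTopology X]
  [MeasurableSpace X] [BorelSpace X] {μ : Measure X} [IsFiniteMeasureOnCompacts μ]
  {𝓔 : SymmDirichletForm μ} {Γ : 𝓔.domain →ₗ[ℝ] 𝓔.domain →ₗ[ℝ] Lp ℝ 1 μ}
  {T : ℝ → Lp ℝ 2 μ →L[ℝ] Lp ℝ 2 μ} {x₀ : X}

/-- The weight imitates `2^(A n (d - m))`: it doubles on each shell of width `1 / (A n)`, so `Λ = 4
A² n² M` and its final value is at least `exp(A n² - A m n / 2)`. The restriction on `t` ensures `Λ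
t ≤ n²`. -/
theorem IsSemigroup.isConservative_of_bounded_energy (hT : 𝓔.IsSemigroup T)
    (hΓ : 𝓔.IsCarreDuChamp Γ) (hreg : 𝓔.IsRegular)
    (hloc : 𝓔.IsStronglyLocal) (hd : 𝓔.MemLoc fun x => dist x x₀)
    (hball : ∀ r > 0, IsCompact (closure (Metric.ball x₀ r))) {M N R₁ : ℝ} (hM : 0 < M)
    (hN : 0 < N) (hR₁ : 1 < R₁)
    (he : ∀ᵐ x ∂μ, R₁ ≤ dist x x₀ → 𝓔.energyLoc Γ (fun y => dist y x₀) x ≤ M)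
    (hV : ∀ᶠ n : ℕ in atTop, μ (Metric.ball x₀ (4 * n) \ Metric.ball x₀ (2 * n)) ≤
      ENNReal.ofReal (Real.exp (2 * N * (n : ℝ) ^ 2))) :
    IsConservative T := by
  have hμ := measure_ball_ne_top (μ := μ) hball
  -- `A n²` must absorb `2 N n²` from the volume, `n²` from `exp(Λt)` and `n²` for the error `A m n
  -- / 2`; the remaining `n²` gives decay.
  obtain ⟨A, hA⟩ := exists_nat_ge (2 * N + 3)
  have hA0 : (0 : ℝ) < A := by linarith
  refine hT.isConservative hμ fun t ht => hT.preservesIntegral_of_small hμ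
    (t₀ := 1 / (4 * A ^ 2 * M)) (by positivity) (fun t ht htle => ?_) ht
  have htM : 4 * A ^ 2 * M * t ≤ 1 := by
    rw [le_div_iff₀ (by positivity)] at htle
    linarith
  refine hT.preservesIntegral_of_weights hΓ hreg hloc hd hball ht.le (b := fun _ => M)
    (V := fun n => Real.exp (2 * N * (n : ℝ) ^ 2)) (fun _ => hM.le) (fun _ => (Real.exp_pos _).le)
    ?_ hV (R₁ := R₁) fun R hR => ?_
  · obtain ⟨n₀, hn₀⟩ := exists_nat_ge R₁
    filter_upwards [eventually_ge_atTop n₀] with n hn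
    have hn' : (n₀ : ℝ) ≤ n := by exact_mod_cast hn
    filter_upwards [he] with x hx h1 _
    exact hx (by linarith)
  obtain ⟨m, hm⟩ := exists_nat_ge R
  have hm0 : (0 : ℝ) < m := by linarith
  -- This number of shells ends exactly at radius `2n`; the truncated subtraction is harmless once
  -- `n ≥ m`.
  refine ⟨fun n => 4 * A ^ 2 * n ^ 2 * M, fun n => 2 ^ (A * n * (2 * n - m)), ?_, ?_⟩
  · filter_upwards [eventually_ge_atTop m, eventually_gt_atTop 0] with n hn hn0
    have hn0' : (0 : ℝ) < n := by exact_mod_cast hn0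
    refine ⟨by positivity, ?_⟩
    have hAn : (0 : ℝ) < A * n := by positivity
    have hstep : ∀ i : ℕ, ((m : ℝ) + ((i + 1 : ℕ) : ℝ) / (A * n)) - (m + i / (A * n)) =
        1 / (A * n) := by
      intro i; push_cast; ring
    obtain ⟨q, hq⟩ := exists_isWeight_chain (R := R) (Λ := 4 * A ^ 2 * n ^ 2 * M)
      (a := fun i : ℕ => (m : ℝ) + i / (A * n)) (Y := fun i : ℕ => (2 : ℝ) ^ i) hΓ hreg hloc hd
      hball (by positivity) (fun i j hij => by
        have : (i : ℝ) < j := by exact_mod_cast hij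
        simp only
        gcongr) (fun i j hij => by
        simp only
        gcongr
        norm_num) (by simp) (by simpa using hm) (by simpa using hm0) (A * n * (2 * n - m)) (by
        intro i _
        filter_upwards [he, hΓ.energyLoc_nonneg (fun y => dist y x₀)] with x hx hx0 h1 h2
        have h3 : R₁ ≤ dist x x₀ := by
          have : (0 : ℝ) ≤ i / (A * n) := by positivity
          linarith
        rw [hstep]
        have e : (2 * ((2 : ℝ) ^ (i + 1) - 2 ^ i) / (1 / (A * n))) ^ 2 =
            4 * A ^ 2 * n ^ 2 * (2 ^ i) ^ 2 := by
          rw [pow_succ]; field_simp; ring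
        rw [e]
        calc 4 * (A : ℝ) ^ 2 * n ^ 2 * (2 ^ i) ^ 2 * 𝓔.energyLoc Γ (fun y => dist y x₀) x
            ≤ 4 * (A : ℝ) ^ 2 * n ^ 2 * (2 ^ i) ^ 2 * M := by gcongr; exact hx h3
          _ = _ := by ring)
    refine ⟨q, hq.mono le_rfl (le_of_eq ?_)⟩
    have hsub : ((2 * n - m : ℕ) : ℝ) = 2 * n - m := by
      rw [Nat.cast_sub (by omega)]; push_cast; ring
    push_cast
    rw [hsub]
    field_simp
    ring
  · have hlim : Tendsto (fun n : ℕ => M * Real.exp (-(n : ℝ))) atTop (𝓝 0) := by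
      have := (Real.tendsto_exp_neg_atTop_nhds_zero.comp tendsto_natCast_atTop_atTop).const_mul M
      simpa using this
    obtain ⟨n₀, hn₀⟩ := exists_nat_ge (A * m / 2 : ℝ)
    refine squeeze_zero' (Eventually.of_forall fun n => by positivity) ?_ hlim
    filter_upwards [eventually_ge_atTop m, eventually_gt_atTop 0, eventually_ge_atTop n₀] with
      n hn hn0 hn1
    have hn0' : (1 : ℝ) ≤ n := by exact_mod_cast hn0
    have hn1' : (n₀ : ℝ) ≤ n := by exact_mod_cast hn1
    have hsub : ((2 * n - m : ℕ) : ℝ) = 2 * n - m := by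
      rw [Nat.cast_sub (by omega)]; push_cast; ring
    have hnm : (m : ℝ) ≤ n := by exact_mod_cast hn
    have hYle : Real.exp (A * n ^ 2 - A * m / 2 * n) ≤ 2 ^ (A * n * (2 * n - m)) := by
      rw [← Real.exp_log (show (0 : ℝ) < 2 ^ (A * n * (2 * n - m)) by positivity), Real.log_pow]
      refine Real.exp_le_exp.2 ?_
      push_cast
      rw [hsub]
      have hl := Real.log_two_gt_d9
      have h1 : 0 ≤ (A : ℝ) * n * (2 * n - m) := mul_nonneg (by positivity) (by linarith)
      nlinarith
    calc Real.exp (4 * A ^ 2 * n ^ 2 * M * t) * (M / n ^ 2 * Real.exp (2 * N * n ^ 2)) /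
          2 ^ (A * n * (2 * n - m))
        ≤ Real.exp (n ^ 2) * (M * Real.exp (2 * N * n ^ 2)) /
          Real.exp (A * n ^ 2 - A * m / 2 * n) := by
          gcongr
          · nlinarith [sq_nonneg (n : ℝ)]
          · exact div_le_self hM.le (by nlinarith)
      _ = M * Real.exp (n ^ 2 + 2 * N * n ^ 2 - (A * n ^ 2 - A * m / 2 * n)) := by
          rw [Real.exp_sub ((n : ℝ) ^ 2 + 2 * N * n ^ 2), Real.exp_add]; ring
      _ ≤ M * Real.exp (-(n : ℝ)) := by
          gcongr
          nlinarith [mul_le_mul_of_nonneg_right hA (sq_nonneg (n : ℝ)),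
            mul_le_mul_of_nonneg_right (hn₀.trans hn1') (by linarith : (0 : ℝ) ≤ n)]

/-- With `σ = 1 / (1 + α)` one has `log (1 + ασ) ≥ ασ / 2` because `ασ ≤ 1`, and the exponent is at
least `l / (2σ) - 1` because `log (1 + σ) ≤ σ`. Rounding down costs `ασ / 2 ≤ 1 / 2`. -/
theorem exp_sub_le_pow_floor {α l r : ℝ} (hα : 0 < α) (hl : 0 ≤ l) (h : l / 2 ≤ r) :
    Real.exp (α * l / 4 - 1 / 2) ≤
      (1 + α / (1 + α)) ^ ⌊r / Real.log (1 + 1 / (1 + α))⌋₊ := by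
  set σ : ℝ := 1 / (1 + α) with hσ
  set k := ⌊r / Real.log (1 + σ)⌋₊ with hk'
  have hσ0 : 0 < σ := by positivity
  have hκ : α / (1 + α) = α * σ := by rw [hσ]; ring
  have hκ1 : α * σ ≤ 1 := by
    rw [← hκ]; exact (div_le_one (by positivity)).2 (by linarith)
  have hκ0 : 0 < α * σ := by positivity
  rw [hκ, ← Real.exp_log (show 0 < (1 + α * σ) ^ k by positivity), Real.log_pow]
  refine Real.exp_le_exp.2 ?_
  have hlogκ : α * σ / 2 ≤ Real.log (1 + α * σ) := by
    refine le_trans ?_ (Real.one_sub_inv_le_log_of_pos (by linarith))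
    have : 1 - (1 + α * σ)⁻¹ = α * σ / (1 + α * σ) := by
      rw [eq_div_iff (by positivity), sub_mul, inv_mul_cancel₀ (by positivity)]; ring
    rw [this]
    gcongr
    linarith
  have hlogσ0 : 0 < Real.log (1 + σ) := Real.log_pos (by linarith)
  have hlogσ : Real.log (1 + σ) ≤ σ := by
    have := Real.log_le_sub_one_of_pos (show 0 < 1 + σ by linarith)
    linarith
  have hk : l / 2 / σ - 1 ≤ k := by
    have h1 := (Nat.lt_floor_add_one (r / Real.log (1 + σ))).le
    have h2 : l / 2 / σ ≤ r / Real.log (1 + σ) := by gcongr; linarith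
    linarith
  calc α * l / 4 - 1 / 2 ≤ α * l / 4 - α * σ / 2 := by linarith
    _ = (l / 2 / σ - 1) * (α * σ / 2) := by
        rw [sub_mul, div_mul_eq_mul_div, eq_sub_iff_add_eq]
        field_simp
        ring
    _ ≤ k * (α * σ / 2) := by gcongr
    _ ≤ k * Real.log (1 + α * σ) := by gcongr

theorem sq_mul_log_rpow_div_le {β s : ℝ} (hβ0 : 0 ≤ β) (hβ2 : β ≤ 2) (hs : 1 ≤ s)
    (hs1 : 1 ≤ Real.log (2 * s + 1)) :
    (4 * s + 1) ^ 2 * Real.log (4 * s + 1) ^ β / s ^ 2 ≤ 100 * Real.log (2 * s + 1) ^ 2 := by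
  have h1 : Real.log (4 * s + 1) ≤ 2 * Real.log (2 * s + 1) := by
    have : 2 * Real.log (2 * s + 1) = Real.log ((2 * s + 1) ^ 2) := by
      rw [Real.log_pow]; push_cast; rfl
    rw [this]
    exact Real.log_le_log (by positivity) (by nlinarith)
  have h0 : 0 ≤ Real.log (4 * s + 1) := Real.log_nonneg (by linarith)
  have h2 : Real.log (4 * s + 1) ^ β ≤ (2 * Real.log (2 * s + 1)) ^ 2 := by
    calc Real.log (4 * s + 1) ^ β ≤ (2 * Real.log (2 * s + 1)) ^ β := by gcongr
      _ ≤ (2 * Real.log (2 * s + 1)) ^ (2 : ℝ) :=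
        Real.rpow_le_rpow_of_exponent_le (by linarith) hβ2
      _ = _ := Real.rpow_two _
  have h3 : (4 * s + 1) ^ 2 ≤ 25 * s ^ 2 := by nlinarith
  rw [div_le_iff₀ (by positivity)]
  calc (4 * s + 1) ^ 2 * Real.log (4 * s + 1) ^ β
      ≤ (25 * s ^ 2) * (2 * Real.log (2 * s + 1)) ^ 2 := by gcongr
    _ = _ := by ring

/-- The weight imitates `((d + 1) / (R + 1))^α`, sampled at the radii `d + 1 = (R + 1)(1 + σ)^i`.
Its logarithmic slope is about `α / (d + 1)`, so `Λ` is of order `α² L^β`; with `α = A L^(1 - β)`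
this is `A² L^(2 - β)`, the same order as `log Y` and as the logarithm of the volume bound. -/
theorem IsSemigroup.isConservative_of_log_energy (hT : 𝓔.IsSemigroup T)
    (hΓ : 𝓔.IsCarreDuChamp Γ) (hreg : 𝓔.IsRegular)
    (hloc : 𝓔.IsStronglyLocal) (hd : 𝓔.MemLoc fun x => dist x x₀)
    (hball : ∀ r > 0, IsCompact (closure (Metric.ball x₀ r))) {M N β R₁ : ℝ} (hM : 0 < M)
    (hN : 0 < N) (hβ0 : 0 ≤ β) (hβ2 : β < 2) (hR₁ : 1 < R₁)
    (he : ∀ᵐ x ∂μ, R₁ ≤ dist x x₀ → 𝓔.energyLoc Γ (fun y => dist y x₀) x ≤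
      M * (dist x x₀ + 1) ^ 2 * Real.log (dist x x₀ + 1) ^ β)
    (hV : ∀ᶠ n : ℕ in atTop, μ (Metric.ball x₀ (4 * n) \ Metric.ball x₀ (2 * n)) ≤
      ENNReal.ofReal (Real.exp (2 * N * Real.log (n + 1) ^ (2 - β)))) :
    IsConservative T := by
  have hμ := measure_ball_ne_top (μ := μ) hball
  -- Then `A / 4 = 2 N + 2` exceeds by 1 the coefficient `2 N + 1` due to the volume and to
  -- `exp(Λt)`, which leaves `exp(-Z)`.
  set A : ℝ := 8 * N + 8 with hA
  have hA0 : 0 < A := by positivity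
  refine hT.isConservative hμ fun t ht => hT.preservesIntegral_of_small hμ
    (t₀ := 1 / (16 * M * A ^ 2)) (by positivity) (fun t ht htle => ?_) ht
  have htM : 16 * M * A ^ 2 * t ≤ 1 := by
    rw [le_div_iff₀ (by positivity)] at htle
    linarith
  have hlog0 : ∀ n : ℕ, 0 ≤ Real.log ((n : ℝ) + 1) := fun n =>
    Real.log_nonneg (by linarith [(Nat.cast_nonneg n : (0 : ℝ) ≤ n)])
  refine hT.preservesIntegral_of_weights hΓ hreg hloc hd hball ht.le
    (b := fun n : ℕ => M * (4 * (n : ℝ) + 1) ^ 2 * Real.log (4 * n + 1) ^ β)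
    (V := fun n => Real.exp (2 * N * Real.log (n + 1) ^ (2 - β))) (fun n => ?_)
    (fun _ => (Real.exp_pos _).le) ?_ hV (R₁ := R₁) fun R hR => ?_
  · have : 0 ≤ Real.log (4 * (n : ℝ) + 1) := by
      refine Real.log_nonneg ?_
      linarith [(Nat.cast_nonneg n : (0 : ℝ) ≤ n)]
    positivity
  · obtain ⟨n₀, hn₀⟩ := exists_nat_ge R₁
    filter_upwards [eventually_ge_atTop n₀] with n hn
    have hn' : (n₀ : ℝ) ≤ n := by exact_mod_cast hn
    filter_upwards [he] with x hx h1 h2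
    refine (hx (by linarith)).trans ?_
    have hdx : 0 ≤ dist x x₀ := dist_nonneg
    have : 0 ≤ Real.log (dist x x₀ + 1) := Real.log_nonneg (by linarith)
    gcongr
  let L : ℕ → ℝ := fun n => Real.log (2 * n + 1)
  have hL : Tendsto L atTop atTop := Real.tendsto_log_atTop.comp
    (tendsto_atTop_add_const_right _ 1 (tendsto_natCast_atTop_atTop.const_mul_atTop two_pos))
  let α : ℕ → ℝ := fun n => A * L n ^ (1 - β)
  let k : ℕ → ℕ := fun n => ⌊Real.log ((2 * n + 1) / (R + 1)) / Real.log (1 + 1 / (1 + α n))⌋₊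
  have hR0 : 0 < R := by linarith
  refine ⟨fun n => 16 * M * α n ^ 2 * L n ^ β, fun n => (1 + α n / (1 + α n)) ^ k n, ?_, ?_⟩
  · filter_upwards [hL.eventually_ge_atTop 1, eventually_ge_atTop ⌈R⌉₊] with n hn hnR
    have hnR' : R ≤ n := (Nat.le_ceil R).trans (by exact_mod_cast hnR)
    have hα : 0 < α n := by positivity
    refine ⟨by positivity, ?_⟩
    -- This handles both `α n → ∞` (`β < 1`) and `α n → 0` (`β > 1`): since `σ ≤ 1` and `ασ ≤ 1`,
    -- neither `d + 1` nor the weight more than doubles on a shell.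
    set σ : ℝ := 1 / (1 + α n) with hσ
    have hσ0 : 0 < σ := by positivity
    have hσ1 : σ ≤ 1 := (div_le_one (by positivity)).2 (by linarith)
    have hκ : α n / (1 + α n) = α n * σ := by rw [hσ]; ring
    have hlogσ : 0 < Real.log (1 + σ) := Real.log_pos (by linarith)
    have hratio : 1 ≤ (2 * (n : ℝ) + 1) / (R + 1) := by
      rw [le_div_iff₀ (by linarith)]; linarith
    have hak : ∀ i, i ≤ k n → (R + 1) * (1 + σ) ^ i ≤ 2 * n + 1 := by
      intro i hi
      have h1 : (i : ℝ) ≤ Real.log ((2 * n + 1) / (R + 1)) / Real.log (1 + σ) :=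
        (Nat.cast_le.2 hi).trans (Nat.floor_le (div_nonneg (Real.log_nonneg hratio) hlogσ.le))
      rw [le_div_iff₀ hlogσ, ← Real.log_pow, Real.log_le_log_iff (by positivity) (by positivity),
        le_div_iff₀ (by positivity)] at h1
      linarith
    obtain ⟨q, hq⟩ := exists_isWeight_chain (R := R) (Λ := 16 * M * α n ^ 2 * L n ^ β)
      (a := fun i : ℕ => (R + 1) * (1 + σ) ^ i - 1) (Y := fun i : ℕ => (1 + α n * σ) ^ i) hΓ hreg
      hloc hd hball (by positivity) (strictMono_nat_of_lt_succ fun i => by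
        rw [pow_succ]
        have : 0 < (R + 1) * (1 + σ) ^ i := by positivity
        nlinarith) (monotone_nat_of_le_succ fun i => by
        rw [pow_succ]
        have : 0 < (1 + α n * σ) ^ i := by positivity
        have : 0 < α n * σ := by positivity
        nlinarith) (by simp) (by simp) (by simpa using hR0) (k n) (by
        intro i hi
        filter_upwards [he, hΓ.energyLoc_nonneg (fun y => dist y x₀)] with x hx hx0 h1 h2
        set p := (R + 1) * (1 + σ) ^ i with hp
        have hpow : 1 ≤ (1 + σ) ^ i := one_le_pow₀ (by linarith)
        have hp0 : R + 1 ≤ p := by rw [hp]; nlinarith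
        have hsucc : (R + 1) * (1 + σ) ^ (i + 1) = p * (1 + σ) := by rw [hp, pow_succ]; ring
        have hlast := hak (i + 1) hi
        rw [hsucc] at h2 hlast
        have hdle : dist x x₀ + 1 ≤ 2 * p := by nlinarith
        have hdle2 : dist x x₀ + 1 ≤ 2 * n + 1 := by linarith
        have hlogd : 0 ≤ Real.log (dist x x₀ + 1) := Real.log_nonneg (by linarith)
        have hex : 𝓔.energyLoc Γ (fun y => dist y x₀) x ≤ M * (2 * p) ^ 2 * L n ^ β := by
          refine (hx (by linarith)).trans ?_
          have hdx : 0 ≤ dist x x₀ := dist_nonneg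
          simp only [L]
          gcongr
        rw [hsucc]
        have e : (2 * ((1 + α n * σ) ^ (i + 1) - (1 + α n * σ) ^ i) / (p * (1 + σ) - 1 - (p - 1))) ^ 2
            = 4 * α n ^ 2 * ((1 + α n * σ) ^ i) ^ 2 / p ^ 2 := by
          have hp' : p ≠ 0 := by linarith
          have : p * (1 + σ) - 1 - (p - 1) = p * σ := by ring
          rw [this, pow_succ]; field_simp; ring
        rw [e]
        calc 4 * α n ^ 2 * ((1 + α n * σ) ^ i) ^ 2 / p ^ 2 * 𝓔.energyLoc Γ (fun y => dist y x₀) x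
            ≤ 4 * α n ^ 2 * ((1 + α n * σ) ^ i) ^ 2 / p ^ 2 * (M * (2 * p) ^ 2 * L n ^ β) := by
              gcongr
          _ = 16 * M * α n ^ 2 * L n ^ β * ((1 + α n * σ) ^ i) ^ 2 := by
              have hp' : p ≠ 0 := by linarith
              field_simp; norm_num)
    rw [hκ]
    exact ⟨q, hq.mono le_rfl (by linarith [hak (k n) le_rfl])⟩
  · have hlim : Tendsto (fun n : ℕ => 100 * M * Real.exp (1 / 2) *
        ((L n ^ (2 - β)) ^ (2 / (2 - β)) * Real.exp (-1 * L n ^ (2 - β)))) atTop (𝓝 0) := by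
      have h1 := (tendsto_rpow_mul_exp_neg_mul_atTop_nhds_zero (2 / (2 - β)) 1 one_pos).comp
        ((tendsto_rpow_atTop (show 0 < 2 - β by linarith)).comp hL)
      simpa using h1.const_mul (100 * M * Real.exp (1 / 2))
    refine squeeze_zero' ?_ ?_ hlim
    · filter_upwards [hL.eventually_ge_atTop 1] with n hn
      have hα : 0 < α n := by positivity
      have : 0 ≤ Real.log (4 * (n : ℝ) + 1) := by
        refine Real.log_nonneg ?_
        linarith [(Nat.cast_nonneg n : (0 : ℝ) ≤ n)]
      positivity
    · filter_upwards [hL.eventually_ge_atTop 1, hL.eventually_ge_atTop (2 * Real.log (R + 1)),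
        eventually_ge_atTop ⌈R⌉₊, eventually_gt_atTop 0] with n hn hn2 hnR hn0
      have hn0' : (1 : ℝ) ≤ n := by exact_mod_cast hn0
      have hnR' : R ≤ n := (Nat.le_ceil R).trans (by exact_mod_cast hnR)
      have hL0 : 0 < L n := by linarith
      have hα : 0 < α n := by positivity
      set Z := L n ^ (2 - β) with hZ
      have hZ0 : 0 < Z := by positivity
      have hαL : α n * L n = A * Z := by
        simp only [α]
        rw [mul_assoc, ← Real.rpow_add_one hL0.ne', hZ]
        congr 2; ring
      have hα2 : α n ^ 2 * L n ^ β = A ^ 2 * Z := by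
        simp only [α]
        rw [mul_pow, mul_assoc, ← Real.rpow_natCast (L n ^ (1 - β)), ← Real.rpow_mul hL0.le,
          ← Real.rpow_add hL0, hZ]
        congr 2; push_cast; ring
      have hZL : Z ^ (2 / (2 - β)) = L n ^ 2 := by
        rw [hZ, ← Real.rpow_mul hL0.le, mul_div_cancel₀ _ (by linarith), Real.rpow_two]
      have hlogn : Real.log (n + 1) ^ (2 - β) ≤ Z := by
        have := hlog0 n
        rw [hZ]
        simp only [L]
        have h2 : (0 : ℝ) ≤ 2 - β := by linarith
        gcongr
        linarith
      have hb : M * (4 * (n : ℝ) + 1) ^ 2 * Real.log (4 * n + 1) ^ β / n ^ 2 ≤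
          100 * M * L n ^ 2 := by
        have := sq_mul_log_rpow_div_le hβ0 hβ2.le hn0' hn
        rw [mul_assoc, mul_div_assoc]
        calc M * ((4 * (n : ℝ) + 1) ^ 2 * Real.log (4 * n + 1) ^ β / n ^ 2)
            ≤ M * (100 * Real.log (2 * n + 1) ^ 2) := by gcongr
          _ = _ := by ring
      have hY : Real.exp (A / 4 * Z - 1 / 2) ≤ (1 + α n / (1 + α n)) ^ k n := by
        have hlogR : Real.log ((2 * n + 1) / (R + 1)) = L n - Real.log (R + 1) :=
          Real.log_div (by positivity) (by positivity)
        have := exp_sub_le_pow_floor hα hL0.le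
          (show L n / 2 ≤ Real.log ((2 * n + 1) / (R + 1)) by rw [hlogR]; linarith)
        rwa [hαL, show A * Z / 4 = A / 4 * Z by ring] at this
      have hΛ : 16 * M * α n ^ 2 * L n ^ β * t ≤ Z := by
        calc 16 * M * α n ^ 2 * L n ^ β * t = 16 * M * A ^ 2 * t * Z := by
              have : 16 * M * α n ^ 2 * L n ^ β * t = 16 * M * t * (α n ^ 2 * L n ^ β) := by ring
              rw [this, hα2]; ring
          _ ≤ 1 * Z := by gcongr
          _ = Z := one_mul Z
      have h4 : 0 ≤ Real.log (4 * (n : ℝ) + 1) := Real.log_nonneg (by linarith)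
      rw [hZL]
      calc Real.exp (16 * M * α n ^ 2 * L n ^ β * t) *
            (M * (4 * (n : ℝ) + 1) ^ 2 * Real.log (4 * n + 1) ^ β / n ^ 2 *
              Real.exp (2 * N * Real.log (n + 1) ^ (2 - β))) / (1 + α n / (1 + α n)) ^ k n
          ≤ Real.exp Z * (100 * M * L n ^ 2 * Real.exp (2 * N * Z)) /
            Real.exp (A / 4 * Z - 1 / 2) := by
            gcongr
        _ = 100 * M * L n ^ 2 * Real.exp (Z + 2 * N * Z - (A / 4 * Z - 1 / 2)) := by
            rw [Real.exp_sub (Z + 2 * N * Z), Real.exp_add]; ring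
        _ = 100 * M * L n ^ 2 * Real.exp (1 / 2 + -1 * Z) := by
            congr 2; rw [hA]; ring
        _ = _ := by rw [Real.exp_add]; ring

/-- The right side is the chord over `[0, 1]` of the convex function `(1 + x) ^ m`. -/
theorem one_add_pow_le (m : ℕ) {x : ℝ} (hx : 0 ≤ x) (hx1 : x ≤ 1) :
    (1 + x) ^ m ≤ 1 + (2 ^ m - 1) * x := by
  induction m with
  | zero => simp
  | succ m ih =>
    have h2 : (1 : ℝ) ≤ 2 ^ m := one_le_pow₀ (by norm_num)
    rw [pow_succ, pow_succ]
    calc (1 + x) ^ m * (1 + x) ≤ (1 + (2 ^ m - 1) * x) * (1 + x) := by gcongr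
      _ ≤ 1 + (2 ^ m * 2 - 1) * x := by nlinarith [mul_nonneg (sub_nonneg.2 h2) hx]

/-- The weight imitates a multiple of `(log (d + 1))^m`, sampled at `d + 1 = 2^p`. On a dyadic shell
it changes by a relative amount of order `1 / p` while `√Γ(d, d)` is of order `2^p p`, so `Λ` does
not depend on `n` and every `t` is treated at once. -/
theorem IsSemigroup.isConservative_of_log_sq_energy (hT : 𝓔.IsSemigroup T)
    (hΓ : 𝓔.IsCarreDuChamp Γ) (hreg : 𝓔.IsRegular)
    (hloc : 𝓔.IsStronglyLocal) (hd : 𝓔.MemLoc fun x => dist x x₀)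
    (hball : ∀ r > 0, IsCompact (closure (Metric.ball x₀ r))) {M N R₁ : ℝ} (hM : 0 < M)
    (hN : 0 < N) (hR₁ : 1 < R₁)
    (he : ∀ᵐ x ∂μ, R₁ ≤ dist x x₀ → 𝓔.energyLoc Γ (fun y => dist y x₀) x ≤
      M * (dist x x₀ + 1) ^ 2 * Real.log (dist x x₀ + 1) ^ 2)
    (hV : ∀ᶠ n : ℕ in atTop, μ (Metric.ball x₀ (4 * n) \ Metric.ball x₀ (2 * n)) ≤
      ENNReal.ofReal (Real.log (n + 1) ^ (2 * N))) :
    IsConservative T := by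
  have hμ := measure_ball_ne_top (μ := μ) hball
  refine hT.isConservative hμ fun t ht => ?_
  -- `L^m` must beat `L^(2N)` from the volume and `L²` from the energy bound; the third unit leaves
  -- `1 / L`.
  obtain ⟨m, hm⟩ := exists_nat_ge (2 * N + 3)
  have hlog0 : ∀ n : ℕ, 0 ≤ Real.log ((n : ℝ) + 1) := fun n =>
    Real.log_nonneg (by linarith [(Nat.cast_nonneg n : (0 : ℝ) ≤ n)])
  refine hT.preservesIntegral_of_weights hΓ hreg hloc hd hball ht.le
    (b := fun n : ℕ => M * (4 * (n : ℝ) + 1) ^ 2 * Real.log (4 * n + 1) ^ 2)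
    (V := fun n => Real.log (n + 1) ^ (2 * N)) (fun n => by positivity)
    (fun n => by have := hlog0 n; positivity) ?_ hV (R₁ := R₁) fun R hR => ?_
  · obtain ⟨n₀, hn₀⟩ := exists_nat_ge R₁
    filter_upwards [eventually_ge_atTop n₀] with n hn
    have hn' : (n₀ : ℝ) ≤ n := by exact_mod_cast hn
    filter_upwards [he] with x hx h1 h2
    refine (hx (by linarith)).trans ?_
    have hdx : 0 ≤ dist x x₀ := dist_nonneg
    have : 0 ≤ Real.log (dist x x₀ + 1) := Real.log_nonneg (by linarith)
    gcongr
  have hR0 : 1 < R := by linarith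
  -- The shells start outside radius `R`; dividing by `i₀` below normalises the initial weight to 1.
  obtain ⟨i₀, hi₀⟩ := pow_unbounded_of_one_lt (R + 1) (one_lt_two : (1 : ℝ) < 2)
  have hi₀1 : 1 ≤ i₀ := by
    by_contra h
    have : i₀ = 0 := by omega
    rw [this, pow_zero] at hi₀
    linarith
  have hi₀' : (1 : ℝ) ≤ i₀ := by exact_mod_cast hi₀1
  let j : ℕ → ℕ := fun n => Nat.log 2 (2 * n + 1)
  have hj : Tendsto j atTop atTop := by
    refine tendsto_atTop.2 fun b => ?_
    filter_upwards [eventually_ge_atTop (2 ^ b)] with n hn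
    exact Nat.le_log_of_pow_le one_lt_two (by omega)
  refine ⟨fun _ => 64 * M * 4 ^ m, fun n => ((j n : ℝ) / i₀) ^ m, ?_, ?_⟩
  · filter_upwards [hj.eventually_ge_atTop i₀] with n hn
    refine ⟨by positivity, ?_⟩
    obtain ⟨q, hq⟩ := exists_isWeight_chain (R := R) (Λ := 64 * M * 4 ^ m)
      (a := fun i : ℕ => (2 : ℝ) ^ (i₀ + i) - 1) (Y := fun i : ℕ => (((i₀ + i : ℕ) : ℝ) / i₀) ^ m)
      hΓ hreg hloc hd hball (by positivity) (strictMono_nat_of_lt_succ fun i => by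
        have : (2 : ℝ) ^ (i₀ + i) < 2 ^ (i₀ + (i + 1)) := by
          gcongr
          · norm_num
          · omega
        linarith) (fun i i' hii => by
        simp only
        gcongr) (by simp only [add_zero]; rw [div_self (by positivity), one_pow])
      (by simp only [add_zero]; linarith) (by simp only [add_zero]; linarith) (j n - i₀) (by
        intro i hi
        filter_upwards [he, hΓ.energyLoc_nonneg (fun y => dist y x₀)] with x hx hx0 h1 h2
        set p : ℕ := i₀ + i with hp
        have hp1 : (1 : ℝ) ≤ p := by
          have : 1 ≤ p := by omega
          exact_mod_cast this
        have hpR : R + 1 < 2 ^ p :=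
          hi₀.trans_le (pow_le_pow_right₀ one_le_two (by omega))
        have hsucc : (2 : ℝ) ^ (i₀ + (i + 1)) = 2 * 2 ^ p := by
          rw [← add_assoc, pow_succ]; ring
        rw [hsucc] at h2 ⊢
        have hcast : ((i₀ + (i + 1) : ℕ) : ℝ) = p + 1 := by rw [hp]; push_cast; ring
        rw [hcast]
        have hlogd : 0 ≤ Real.log (dist x x₀ + 1) := Real.log_nonneg (by linarith)
        have hlogle : Real.log (dist x x₀ + 1) ≤ 2 * p := by
          calc Real.log (dist x x₀ + 1) ≤ Real.log (2 ^ (p + 1)) := by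
                refine Real.log_le_log (by linarith) ?_
                rw [pow_succ]; linarith
            _ = (p + 1) * Real.log 2 := by rw [Real.log_pow]; push_cast; ring
            _ ≤ (p + 1) * 1 := by
                gcongr
                have := Real.log_two_lt_d9
                linarith
            _ ≤ 2 * p := by linarith
        have hex : 𝓔.energyLoc Γ (fun y => dist y x₀) x ≤ M * (2 * 2 ^ p) ^ 2 * (2 * p) ^ 2 := by
          refine (hx (by linarith)).trans ?_
          have hdx : 0 ≤ dist x x₀ := dist_nonneg
          gcongr
          linarith
        have hdiff0 : 0 ≤ (((p : ℝ) + 1) / i₀) ^ m - ((p : ℝ) / i₀) ^ m := by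
          rw [sub_nonneg]
          gcongr
          linarith
        -- The relative increment of the weight is at most `2 ^ m / p`; this factor `1 / p` offsets
        -- the logarithm in the energy bound.
        have hdiff : p * ((((p : ℝ) + 1) / i₀) ^ m - ((p : ℝ) / i₀) ^ m) ≤
            2 ^ m * ((p : ℝ) / i₀) ^ m := by
          have e1 : ((p : ℝ) + 1) / i₀ = (p : ℝ) / i₀ * (1 + 1 / p) := by field_simp
          have h3 := one_add_pow_le m (x := 1 / (p : ℝ)) (by positivity)
            ((div_le_one (by positivity)).2 hp1)
          rw [e1, mul_pow]
          calc (p : ℝ) * (((p : ℝ) / i₀) ^ m * (1 + 1 / p) ^ m - ((p : ℝ) / i₀) ^ m)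
              ≤ p * (((p : ℝ) / i₀) ^ m * (1 + (2 ^ m - 1) * (1 / p)) - ((p : ℝ) / i₀) ^ m) := by
                gcongr
            _ = (2 ^ m - 1) * ((p : ℝ) / i₀) ^ m := by field_simp; ring
            _ ≤ _ := by gcongr; linarith
        set D := (((p : ℝ) + 1) / i₀) ^ m - ((p : ℝ) / i₀) ^ m
        have e2 : 2 * (2 : ℝ) ^ p - 1 - (2 ^ p - 1) = 2 ^ p := by ring
        rw [e2]
        calc (2 * D / 2 ^ p) ^ 2 * 𝓔.energyLoc Γ (fun y => dist y x₀) x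
            ≤ (2 * D / 2 ^ p) ^ 2 * (M * (2 * 2 ^ p) ^ 2 * (2 * p) ^ 2) := by gcongr
          _ = 64 * M * (p * D) ^ 2 := by field_simp; ring
          _ ≤ 64 * M * (2 ^ m * ((p : ℝ) / i₀) ^ m) ^ 2 := by gcongr
          _ = 64 * M * 4 ^ m * (((p : ℝ) / i₀) ^ m) ^ 2 := by
              rw [mul_pow (2 ^ m : ℝ), ← pow_mul, mul_comm m 2, pow_mul (2 : ℝ) 2 m]
              norm_num
              ring)
    have hji : i₀ + (j n - i₀) = j n := by omega
    rw [hji] at hq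
    refine ⟨q, hq.mono le_rfl ?_⟩
    have h3 : (2 : ℕ) ^ j n ≤ 2 * n + 1 := Nat.pow_log_le_self 2 (by omega)
    have h4 : (2 : ℝ) ^ j n ≤ 2 * n + 1 := by exact_mod_cast h3
    linarith
  · let L : ℕ → ℝ := fun n => Real.log (2 * n + 1)
    have hL : Tendsto L atTop atTop := Real.tendsto_log_atTop.comp
      (tendsto_atTop_add_const_right _ 1 (tendsto_natCast_atTop_atTop.const_mul_atTop two_pos))
    set C := Real.exp (64 * M * 4 ^ m * t) * (100 * M) * (2 * i₀) ^ m with hC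
    have hlim : Tendsto (fun n : ℕ => C * (L n)⁻¹) atTop (𝓝 0) := by
      simpa using (tendsto_inv_atTop_zero.comp hL).const_mul C
    refine squeeze_zero' ?_ ?_ hlim
    · filter_upwards with n
      have := hlog0 n
      positivity
    · filter_upwards [hL.eventually_ge_atTop 2, eventually_gt_atTop 0] with n hn hn0
      have hn0' : (1 : ℝ) ≤ n := by exact_mod_cast hn0
      have hL0 : 0 < L n := by linarith
      have hb : M * (4 * (n : ℝ) + 1) ^ 2 * Real.log (4 * n + 1) ^ 2 / n ^ 2 ≤
          100 * M * L n ^ 2 := by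
        have := sq_mul_log_rpow_div_le zero_le_two le_rfl hn0' (one_le_two.trans hn)
        rw [Real.rpow_two] at this
        rw [mul_assoc, mul_div_assoc]
        calc M * ((4 * (n : ℝ) + 1) ^ 2 * Real.log (4 * n + 1) ^ 2 / n ^ 2)
            ≤ M * (100 * Real.log (2 * n + 1) ^ 2) := by gcongr
          _ = _ := by ring
      have hVL : Real.log (n + 1) ^ (2 * N) * L n ^ 3 ≤ L n ^ m := by
        have h1 : Real.log (n + 1) ^ (2 * N) ≤ L n ^ (2 * N) := by
          have := hlog0 n
          simp only [L]
          gcongr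
          linarith
        calc Real.log (n + 1) ^ (2 * N) * L n ^ 3 ≤ L n ^ (2 * N) * L n ^ 3 := by gcongr
          _ = L n ^ (2 * N + 3) := by
              rw [← Real.rpow_natCast (L n) 3, ← Real.rpow_add hL0]; norm_num
          _ ≤ L n ^ (m : ℝ) := Real.rpow_le_rpow_of_exponent_le (by linarith) hm
          _ = L n ^ m := Real.rpow_natCast _ _
      have hjL : L n / 2 ≤ j n := by
        have h1 : 2 * n + 1 < 2 ^ (j n + 1) := Nat.lt_pow_succ_log_self one_lt_two _
        have h2 : (2 * n + 1 : ℝ) ≤ 2 ^ (j n + 1) := by exact_mod_cast h1.le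
        have h3 : L n ≤ (j n + 1) * Real.log 2 := by
          calc L n ≤ Real.log (2 ^ (j n + 1)) := Real.log_le_log (by positivity) h2
            _ = _ := by rw [Real.log_pow]; push_cast; ring
        have h4 := Real.log_two_lt_d9
        have h5 : (0 : ℝ) ≤ j n := Nat.cast_nonneg _
        nlinarith
      have hV0 : 0 ≤ Real.log ((n : ℝ) + 1) ^ (2 * N) := Real.rpow_nonneg (hlog0 n) _
      calc Real.exp (64 * M * 4 ^ m * t) * (M * (4 * (n : ℝ) + 1) ^ 2 * Real.log (4 * n + 1) ^ 2 /
            n ^ 2 * Real.log (n + 1) ^ (2 * N)) / ((j n : ℝ) / i₀) ^ m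
          ≤ Real.exp (64 * M * 4 ^ m * t) * (100 * M * L n ^ 2 * Real.log (n + 1) ^ (2 * N)) /
            (L n / 2 / i₀) ^ m := by gcongr
        _ = C * (L n)⁻¹ * (Real.log (n + 1) ^ (2 * N) * L n ^ 3 / L n ^ m) := by
            rw [hC, div_div, div_pow]; field_simp
        _ ≤ C * (L n)⁻¹ * 1 := by
            gcongr
            exact (div_le_one (by positivity)).2 hVL
        _ = _ := mul_one _

end Growth

end SymmDirichletForm

theorem mainTheorem3 {X : Type*} [MetricSpace X] [LocallyCompactSpace X]
    [SecondCountableTopology X] [MeasurableSpace X] [BorelSpace X]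
    (μ : Measure X) [IsFiniteMeasureOnCompacts μ] [μ.IsOpenPosMeasure]
    (𝓔 : SymmDirichletForm μ) (hreg : 𝓔.IsRegular) (hloc : 𝓔.IsStronglyLocal)
    (Γ : 𝓔.domain →ₗ[ℝ] 𝓔.domain →ₗ[ℝ] Lp ℝ 1 μ) (hΓ : 𝓔.IsCarreDuChamp Γ)
    (T : ℝ → Lp ℝ 2 μ →L[ℝ] Lp ℝ 2 μ) (hT : 𝓔.IsSemigroup T)
    (x₀ : X) (hd : 𝓔.MemLoc fun x => dist x x₀)
    (hball : ∀ r > 0, IsCompact (closure (Metric.ball x₀ r)))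
    (K₀ : Set X) (hK₀ : IsCompact K₀)
    (hbdd : ∀ V : Set X, IsOpen V → IsCompact (closure V) → closure V ⊆ K₀ᶜ →
      ∃ C : ℝ, ∀ᵐ x ∂μ, x ∈ V → |𝓔.energyLoc Γ (fun y => dist y x₀) x| ≤ C) :
    (∀ (M N β : ℝ) (K : Set X), 0 < M → 0 < N → 0 ≤ β → β ≤ 2 → IsCompact K → K₀ ⊆ K →
      (∀ᵐ x ∂μ, x ∉ K → 𝓔.energyLoc Γ (fun y => dist y x₀) x
        ≤ M * (dist x x₀ + 1) ^ 2 * Real.log (dist x x₀ + 1) ^ β) →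
      (β < 2 → ∀ᶠ n : ℕ in atTop, μ (Metric.ball x₀ (4 * n) \ Metric.ball x₀ (2 * n))
        ≤ ENNReal.ofReal (Real.exp (2 * N * Real.log (n + 1) ^ (2 - β)))) →
      (β = 2 → ∀ᶠ n : ℕ in atTop, μ (Metric.ball x₀ (4 * n) \ Metric.ball x₀ (2 * n))
        ≤ ENNReal.ofReal (Real.log (n + 1) ^ (2 * N))) →
      IsConservative T) ∧
    (∀ (M N : ℝ) (K : Set X), 0 < M → 0 < N → IsCompact K → K₀ ⊆ K →
      (∀ᵐ x ∂μ, x ∉ K → 𝓔.energyLoc Γ (fun y => dist y x₀) x ≤ M) →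
      (∀ᶠ n : ℕ in atTop, μ (Metric.ball x₀ (4 * n) \ Metric.ball x₀ (2 * n))
        ≤ ENNReal.ofReal (Real.exp (2 * N * (n : ℝ) ^ 2))) →
      IsConservative T) := by
  -- A compact exceptional set lies in a ball, and the weights are constant there, so bounds outside
  -- a radius suffice.
  have hK : ∀ (K : Set X) (P : X → Prop), IsCompact K → (∀ᵐ x ∂μ, x ∉ K → P x) →
      ∃ R₁ : ℝ, 1 < R₁ ∧ ∀ᵐ x ∂μ, R₁ ≤ dist x x₀ → P x := fun K P hK h => by
    obtain ⟨r, hr1, hr⟩ := hK.isBounded.subset_ball_lt 1 x₀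
    exact ⟨r, hr1, h.mono fun x hx hrx => hx fun hxK => absurd (hr hxK) (not_lt.2 hrx)⟩
  refine ⟨fun M N β K hM hN hβ0 hβ2 hKc _ he hV1 hV2 => ?_, fun M N K hM hN hKc _ he hV => ?_⟩
  · obtain ⟨R₁, hR₁, he⟩ := hK K _ hKc he
    rcases hβ2.lt_or_eq with hβ | rfl
    · exact hT.isConservative_of_log_energy hΓ hreg hloc hd hball hM hN hβ0 hβ hR₁ he (hV1 hβ)
    · refine hT.isConservative_of_log_sq_energy hΓ hreg hloc hd hball hM hN hR₁ ?_ (hV2 rfl)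
      simpa only [Real.rpow_two] using he
  · obtain ⟨R₁, hR₁, he⟩ := hK K _ hKc he
    exact hT.isConservative_of_bounded_energy hΓ hreg hloc hd hball hM hN hR₁ he hV
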